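/- Consider a $K$-armed bandit ($K\ge 1$) over rounds $t=1,\dots,T$ with $T\ge 2$. An oblivious adversary fixes in advance a law for the reward vector $(Y_t(a))_{a\in[K]}\in[0,1]^K$ of every round $t$; the vectors of different rounds are independent. Let $\mu_t(a)=\mathbb E\,Y_t(a)$ and $\delta_t(a)=\max_{a'}\mu_t(a')-\mu_t(a)$. The dynamic regret of a policy $\pi$, which observes only the rewards $Y_t(\pi_t)$ of the arms it plays, is $R(\pi,T)=\sum_{t=1}^T\max_a\mu_t(a)-\mathbb E\big[\sum_{t=1}^T\mu_t(\pi_t)\big]$. **Significant shifts.** Let $\tau_0=1$ and recursively let $\tau_{i+1}$ be the earliest $\tau\in(\tau_i,T]$ such that for every arm $a$ there are rounds $s_1<s_2$ with $[s_1,s_2]\subseteq[\tau_i,\tau]$ and $\sum_{t=s_1}^{s_2}\delta_t(a)\ge\sqrt{K(s_2-s_1)}$. The number of significant shifts $\tau_1,\tau_2,\dots$ obtained by time $T$ is $\tilde L$. **META** with horizon $T$ and constant $C_0>0$. The procedure works in episodes, the first one starting at round $1$. At the start $t_\ell$ of an episode the master set is set to $[K]$, fresh independent bits $B_{s,m}\sim\mathrm{Bernoulli}\big(1/\sqrt{m(s-t_\ell)}\big)$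 are sampled for $t_\ell<s\le T$ and $m\in\{2,4,\dots,2^{\lceil\log_2T\rceil}\}$, and Base-Alg$(t_\ell,T+1-t_\ell)$ is run. An instance Base-Alg$(u,m_0)$ starts at round $u$ with its own candidate set equal to $[K]$ and repeats the following while $t\le T$. 1. Play an arm uniformly at random from the candidate set, and increase $t$ by $1$. 2. If $B_{t,m}=1$ for some $m$, run Base-Alg$(t,m)$ for the largest such $m$, and continue when it returns, with $t$ now the current round. 3. If $t>u+m_0$, return. 4. Remove from the master set (respectively, from its own candidate set) every arm $a$ for which there are rounds $s_1<s_2$ with $[s_1,s_2]\subseteq[t_\ell,t)$ (respectively, $[s_1,s_2]\subseteq[u,t)$) and $$\max_{a'\in[K]}\sum_{s=s_1}^{s_2}\hat\delta_s(a',a)>\log(T)\sqrt{C_0\big(K(s_2-s_1)\vee K^2\big)}.$$ 5. If the master set is empty, return. Here $\hat\delta_s(a',a)=|\mathcal A_s|\big(Y_s(a')\mathbf 1\{\pi_s=a'\}-Y_s(a)\mathbf 1\{\pi_s=a\}\big)$, where $\mathcal A_s$ is the candidate set from which $\pi_s$ was drawn. When the Base-Alg run of an episode has returned and $t\le T$,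 a new episode starts at round $t$. **Claim.** There is a universal constant $c_0>0$ such that for every $C_0\ge c_0$ there is a constant $C>0$, depending only on $C_0$, such that for all $K\ge1$, all $T\ge2$ and all environments as above, META satisfies $$R(\pi,T)\le C\log^3(T)\sqrt{(\tilde L+1)KT}.$$ Moreover, with the same $C$, and without META using any knowledge of $S$, $$R(\pi,T)\le C\log^3(T)\sqrt{(S+1)KT},$$ where $S=\#\{2\le t\le T: a^*_t\ne a^*_{t-1}\}$ is the number of best-arm switches, for any choice of best arms $a^*_t\in\arg\max_a\mu_t(a)$. -/

import Mathlib

namespace SigShift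

open MeasureTheory ProbabilityTheory

/-! ### Environment and dynamic regret -/

/-- A `K`-armed bandit environment chosen by an oblivious adversary: for every round `t` a law of the
vector of rewards `(Y_t(a))_a`, with values in `[0,1]`.  Rewards of different rounds are drawn
independently (see `seedLaw`); rewards of different arms in one round may be dependent. -/
structure Environment (K : ℕ) where
  law : ℕ → Measure (Fin K → ℝ)
  isProb : ∀ t, IsProbabilityMeasure (law t)
  reward_mem : ∀ t, ∀ᵐ y ∂(law t), ∀ a, y a ∈ Set.Icc (0 : ℝ) 1

attribute [instance] Environment.isProb

variable {K : ℕ}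

/-- Mean reward `μ_t(a)`. -/
noncomputable def Environment.mean (E : Environment K) (t : ℕ) (a : Fin K) : ℝ :=
  ∫ y, y a ∂(E.law t)

/-- Worst gap `δ_t(a) = max_{a'} (μ_t(a') - μ_t(a))`. -/
noncomputable def Environment.gap (E : Environment K) (t : ℕ) (a : Fin K) : ℝ :=
  ⨆ a' : Fin K, (E.mean t a' - E.mean t a)

/-- Dynamic regret `∑_{t=1}^T max_a μ_t(a) - 𝔼[∑_{t=1}^T μ_t(π_t)]` of the arms `π` played. -/
noncomputable def Environment.regret (E : Environment K) {Ω : Type*} [MeasurableSpace Ω]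
    (P : Measure Ω) (π : ℕ → Ω → Fin K) (T : ℕ) : ℝ :=
  (∑ t ∈ Finset.Icc 1 T, ⨆ a : Fin K, E.mean t a)
    - ∫ ω, ∑ t ∈ Finset.Icc 1 T, E.mean t (π t ω) ∂P

/-! ### Significant shifts -/

/-- Arm `a` incurs significant regret on the interval of rounds `[s₁, s₂]`. -/
def Environment.SigRegret (E : Environment K) (a : Fin K) (s₁ s₂ : ℕ) : Prop :=
  √((K : ℝ) * ((s₂ : ℝ) - (s₁ : ℝ))) ≤ ∑ t ∈ Finset.Icc s₁ s₂, E.gap t a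

/-- Every arm incurs significant regret on some `[s₁, s₂] ⊆ [u, v]` with `s₁ < s₂`. -/
def Environment.NoSafeArm (E : Environment K) (u v : ℕ) : Prop :=
  ∀ a : Fin K, ∃ s₁ s₂ : ℕ, u ≤ s₁ ∧ s₁ < s₂ ∧ s₂ ≤ v ∧ E.SigRegret a s₁ s₂

/-- `τ_i`: `τ_0 = 1`, and `τ_{i+1}` is the earliest `τ ∈ (τ_i, T]` such that no arm is safe on
`[τ_i, τ]`, or `T + 1` if there is none. -/
noncomputable def Environment.shiftTime (E : Environment K) (T : ℕ) : ℕ → ℕ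
  | 0 => 1
  | i + 1 => sInf ({τ | E.shiftTime T i < τ ∧ τ ≤ T ∧ E.NoSafeArm (E.shiftTime T i) τ} ∪ {T + 1})

/-- `L̃`, the number of significant shifts: the index for which `τ_{L̃+1} = T + 1` first holds. -/
noncomputable def Environment.numSigShifts (E : Environment K) (T : ℕ) : ℕ :=
  sInf {L | E.shiftTime T (L + 1) = T + 1}

/-- `best t` is an arm of maximal mean reward at each round `t ∈ [1, T]`. -/
def Environment.IsBestArmSeq (E : Environment K) (T : ℕ) (best : ℕ → Fin K) : Prop :=
  ∀ t ∈ Finset.Icc 1 T, ∀ a : Fin K, E.mean t a ≤ E.mean t (best t)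

/-- Number of switches of a sequence of arms over the rounds `1, …, T`. -/
def numSwitches (T : ℕ) (best : ℕ → Fin K) : ℕ :=
  ((Finset.Icc 2 T).filter (fun t => best t ≠ best (t - 1))).card

/-! ### The procedure META -/

/-- What is recorded about one round: the size of the candidate set `𝒜_t`, the arm played and the
observed reward. -/
structure Obs (K : ℕ) where
  size : ℕ
  arm : Fin K
  reward : ℝ

/-- The importance-weighted estimate `δ̂_t(a', a)` of the relative gap. -/
noncomputable def Obs.gapEst (o : Obs K) (a' a : Fin K) : ℝ :=
  (o.size : ℝ) * ((if o.arm = a' then o.reward else 0) - (if o.arm = a then o.reward else 0))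

/-- The eviction criterion for arm `a` on the interval `[s₁, s₂]`: the maximum over `a'` of the
estimated aggregate gap exceeds `log T √(C₀ (K (s₂ - s₁) ∨ K²))`. -/
def ElimOn (C₀ : ℝ) (T : ℕ) (h : ℕ → Obs K) (s₁ s₂ : ℕ) (a : Fin K) : Prop :=
  ∃ a' : Fin K,
    Real.log T * √(C₀ * max ((K : ℝ) * ((s₂ : ℝ) - (s₁ : ℝ))) ((K : ℝ) ^ 2))
      < ∑ t ∈ Finset.Icc s₁ s₂, (h t).gapEst a' a

open Classical in
/-- The arms satisfying the eviction criterion on some `[s₁, s₂] ⊆ [u, t)`, `s₁ < s₂`. -/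
noncomputable def evicted (C₀ : ℝ) (T : ℕ) (h : ℕ → Obs K) (u t : ℕ) : Finset (Fin K) :=
  Finset.univ.filter
    (fun a => ∃ s₁ s₂ : ℕ, u ≤ s₁ ∧ s₁ < s₂ ∧ s₂ < t ∧ ElimOn C₀ T h s₁ s₂ a)

/-- A running instance `Base-Alg(start, dur)` with its own candidate arm set. -/
structure Frame (K : ℕ) where
  start : ℕ
  dur : ℕ
  cand : Finset (Fin K)

/-- State of META just before playing round `round`: start `t_ℓ` of the current episode, master
candidate set, call stack of base algorithms (the head is the active one, its candidate set is
`𝒜_t`; the others are its interrupted ancestors), and the record of past rounds. -/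
structure State (K : ℕ) where
  round : ℕ
  epStart : ℕ
  master : Finset (Fin K)
  stack : List (Frame K)
  hist : ℕ → Obs K

/-- Start a new episode at round `t`: reset the master set and run `Base-Alg(t, T + 1 - t)`. -/
def newEpisode (T t : ℕ) (h : ℕ → Obs K) : State K where
  round := t
  epStart := t
  master := Finset.univ
  stack := [⟨t, T + 1 - t, Finset.univ⟩]
  hist := h

/-- The candidate set `𝒜_t` of the active base algorithm (the stack is never empty). -/
def State.active (s : State K) : Finset (Fin K) :=
  match s.stack with
  | [] => Finset.univ
  | f :: _ => f.cand

/-- The replay durations `2, 4, …, 2^⌈log₂ T⌉`. -/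
def replayDurations (T : ℕ) : Finset ℕ :=
  (Finset.Icc 1 (Nat.clog 2 T)).image (fun n => 2 ^ n)

/-- What happens at round `s.round` (after the counter has been incremented) when no replay starts.
Base algorithms past their scheduled end return to their parents; the first one that is not
past its end evicts arms from the master set and from its own candidate set. If the master set is
now empty, all base algorithms return and a new episode starts. -/
noncomputable def State.resume (C₀ : ℝ) (T : ℕ) (s : State K) : State K :=
  match s.stack.dropWhile (fun f => decide (f.start + f.dur < s.round)) with
  | [] => newEpisode T s.round s.hist
  | f :: rest =>
    let master' := s.master \ evicted C₀ T s.hist s.epStart s.round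
    if master' = ∅ then newEpisode T s.round s.hist
    else
      { s with
        master := master'
        stack := ⟨f.start, f.dur, f.cand \ evicted C₀ T s.hist f.start s.round⟩ :: rest }

/-- Play arm `a` in the current round, observe reward `y`, move to the next round `t`, and either
start the longest replay `Base-Alg(t, m)` among the durations with `B m = true`, if any, or resume.
Here `B m` is the stored replay bit `B_{t,m}` of the current episode. -/
noncomputable def State.step (C₀ : ℝ) (T : ℕ) (s : State K) (a : Fin K) (y : ℝ) (B : ℕ → Bool) :
    State K :=
  let s' : State K :=
    { s with
      round := s.round + 1
      hist := Function.update s.hist s.round ⟨s.active.card, a, y⟩ }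
  let M := (replayDurations T).filter (fun m => B m = true)
  if hM : M.Nonempty then
    { s' with stack := ⟨s'.round, M.max' hM, Finset.univ⟩ :: s'.stack }
  else s'.resume C₀ T

/-! ### Randomness of the interaction -/

/-- A point `(Y, U, B)` of the sample space: `Y t a` is the reward of arm `a` at round `t`;
`U (t, A)` is the arm that is played at round `t` if the candidate set is `A`; `B (u, t, m)` is the
replay bit `B_{t,m}` sampled at the start of an episode beginning at round `u`. -/
abbrev Seed (K : ℕ) : Type :=
  (ℕ → Fin K → ℝ) × (ℕ × Finset (Fin K) → Fin K) × (ℕ × ℕ × ℕ → Bool)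

/-- The uniform law on `A` (on all arms for the never occurring `A = ∅`). -/
noncomputable def uniformArm [NeZero K] (A : Finset (Fin K)) : PMF (Fin K) :=
  if hA : A.Nonempty then PMF.uniformOfFinset A hA else PMF.uniformOfFintype (Fin K)

/-- `1 / √(m (t - u))`, the probability of `B_{t,m} = 1` in an episode started at round `u < t`. -/
noncomputable def replayProb (u t m : ℕ) : unitInterval :=
  ⟨1 / √((m : ℝ) * ((t - u : ℕ) : ℝ)), by positivity, by
    rcases Nat.eq_zero_or_pos (m * (t - u)) with h | h
    · have h' : (m : ℝ) * ((t - u : ℕ) : ℝ) = 0 := by exact_mod_cast h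
      rw [h']; simp
    · have h' : (1 : ℝ) ≤ (m : ℝ) * ((t - u : ℕ) : ℝ) := by exact_mod_cast h
      exact div_le_one_of_le₀ (Real.one_le_sqrt.2 h') (Real.sqrt_nonneg _)⟩

/-- The law of `(Y, U, B)`: all coordinates are independent. -/
noncomputable def seedLaw [NeZero K] (E : Environment K) : Measure (Seed K) :=
  (Measure.infinitePi E.law).prod
    ((Measure.infinitePi fun q : ℕ × Finset (Fin K) => (uniformArm q.2).toMeasure).prod
      (Measure.infinitePi fun q : ℕ × ℕ × ℕ =>
        bernoulliMeasure true false (replayProb q.1 q.2.1 q.2.2)))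

instance [NeZero K] (E : Environment K) : IsProbabilityMeasure (seedLaw E) := by
  unfold seedLaw; infer_instance

/-- The arm played from state `s`: uniform on the active candidate set. -/
def State.play (s : State K) (ω : Seed K) : Fin K := ω.2.1 (s.round, s.active)

/-- State of META with horizon `T` after `n` rounds. -/
noncomputable def metaState [NeZero K] (C₀ : ℝ) (T : ℕ) (ω : Seed K) : ℕ → State K
  | 0 => newEpisode T 1 (fun _ => ⟨0, 0, 0⟩)
  | n + 1 =>
    let s := metaState C₀ T ω n
    s.step C₀ T (s.play ω) (ω.1 s.round (s.play ω)) (fun m => ω.2.2 (s.epStart, s.round + 1, m))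

/-- The arm `π_t` played by META with horizon `T` at round `t ≥ 1`. -/
noncomputable def metaArm [NeZero K] (C₀ : ℝ) (T : ℕ) (t : ℕ) (ω : Seed K) : Fin K :=
  (metaState C₀ T ω (t - 1)).play ω

/-- `R(π, T)` for `π` the procedure META with threshold constant `C₀` and horizon `T`. -/
noncomputable def metaRegret [NeZero K] (C₀ : ℝ) (E : Environment K) (T : ℕ) : ℝ :=
  E.regret (seedLaw E) (metaArm C₀ T) T

end SigShift

open SigShift

/-!
The regret is controlled through any finite set `S` of rounds that meets every interval `(x, y]` such
that no arm is safe on `[x, y]` (`Hitting`). The bound has the order of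
`log³ T √((|S| + 1) K T)` (`metaRegret_le`). The significant shifts form such a set, because a shift
is by definition the first round at which no arm is safe any more, and so do the switches of the best
arm, because the best arm of a period without a switch has no regret on it.

On every sample path META is described without its call stack (`Run.Valid`, `metaRun_valid`): the
active base algorithm of a round is the latest one of the episode that is not past its scheduled end,
and its candidate set is what its own eviction criterion leaves of all arms. Two events have
probability `1 - O(1 / T)`: the aggregate gap estimates are close to the sums of their conditional
means (`Run.Concentrated`, by exponential moments), and replays occur where many of them are to be
expected (`ReplaysOccur`, by independence of the bits). The rest of the analysis is for a fixed run on
these events.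

* An arm is evicted only after significant regret (`Run.Valid.exists_sigRegret_of_evicted`), so
  there are at most `|S| + 1` episodes.
* Some arm survives an episode. Were its regret large, many replays could expose it: each of them
  keeps a safe arm, against which the surviving arm would look bad enough to be evicted
  (`Run.Valid.not_bit_of_exposing`). As one of many such replays takes place, the regret of the
  survivor over an episode of `n` rounds has the order of `log² T √(K n)`, up to one more term for
  each point of `S` (`Run.Valid.sum_gap_survivor_le`).
* Relative to the survivor, an arm that is a candidate of a base algorithm has an aggregate gap of
  order `log T √(K n)` on any interval of `n` rounds. The rounds played by one base algorithm are an
  interval minus the disjoint intervals taken away by those that interrupt it (`IsNest.ite_life_eq`),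
  each of which is charged only once. Averaging over the shrinking candidate set costs a harmonic sum
  (`Run.Valid.sum_top_avg_le`). Thus an episode pays `log² T √K` times `√m` for each replay of
  duration `m` (`Run.Valid.sum_avg_survivor_le`).

In expectation the replays cost little, since the bit for duration `m` in the `n`-th round of an episode
is set with probability `1 / √(m n)` (`lintegral_replayCost_le`). Sums of `√n` over episodes are
linearized by `2 √n ≤ l n + 1 / l`, with `l = √((|S| + 1) / T)` in the end.
-/

namespace SigShift

open MeasureTheory ProbabilityTheory

section

variable {K : ℕ}

/-! ### Runs of META in closed form -/

theorem mem_evicted {C₀ : ℝ} {T : ℕ} {h : ℕ → Obs K} {u t : ℕ} {a : Fin K} :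
    a ∈ evicted C₀ T h u t ↔
      ∃ s₁ s₂ : ℕ, u ≤ s₁ ∧ s₁ < s₂ ∧ s₂ < t ∧ ElimOn C₀ T h s₁ s₂ a := by
  classical
  unfold evicted
  rw [Finset.mem_filter]
  simp

theorem elimOn_congr {C₀ : ℝ} {T : ℕ} {h h' : ℕ → Obs K} {s₁ s₂ : ℕ} {a : Fin K}
    (hh : ∀ i, s₁ ≤ i → i ≤ s₂ → h i = h' i) : ElimOn C₀ T h s₁ s₂ a ↔ ElimOn C₀ T h' s₁ s₂ a := by
  unfold ElimOn
  refine exists_congr fun a' => ?_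
  rw [Finset.sum_congr rfl fun i hi => ?_]
  rw [hh i (Finset.mem_Icc.1 hi).1 (Finset.mem_Icc.1 hi).2]

theorem evicted_congr {C₀ : ℝ} {T : ℕ} {h h' : ℕ → Obs K} {u t : ℕ}
    (hh : ∀ i, u ≤ i → i < t → h i = h' i) : evicted C₀ T h u t = evicted C₀ T h' u t := by
  ext a
  simp only [mem_evicted]
  refine exists_congr fun s₁ => exists_congr fun s₂ => ?_
  constructor
  · rintro ⟨h1, h2, h3, h4⟩
    exact ⟨h1, h2, h3, (elimOn_congr fun i hi hi' => hh i (by omega) (by omega)).1 h4⟩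
  · rintro ⟨h1, h2, h3, h4⟩
    exact ⟨h1, h2, h3, (elimOn_congr fun i hi hi' => hh i (by omega) (by omega)).2 h4⟩

theorem evicted_mono {C₀ : ℝ} {T : ℕ} {h : ℕ → Obs K} {u u' t t' : ℕ} (hu : u' ≤ u) (ht : t ≤ t') :
    evicted C₀ T h u t ⊆ evicted C₀ T h u' t' := by
  intro a ha
  rw [mem_evicted] at ha ⊢
  obtain ⟨s₁, s₂, h1, h2, h3, h4⟩ := ha
  exact ⟨s₁, s₂, by omega, h2, by omega, h4⟩

theorem evicted_self {C₀ : ℝ} {T : ℕ} {h : ℕ → Obs K} {t : ℕ} : evicted C₀ T h t t = ∅ := by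
  rw [Finset.eq_empty_iff_forall_notMem]
  intro a ha
  rw [mem_evicted] at ha
  obtain ⟨s₁, s₂, h1, h2, h3, h4⟩ := ha
  omega

/-- What the analysis needs to know of one run of META, indexed by rounds `t`: the start `ep t` of
the current episode, the start `top t` and the scheduled duration `dur t` of the active base
algorithm, its candidate set `cand t`, and the record `obs t` of the round. -/
structure Run (K : ℕ) where
  ep : ℕ → ℕ
  top : ℕ → ℕ
  dur : ℕ → ℕ
  cand : ℕ → Finset (Fin K)
  obs : ℕ → Obs K

/-- The description of META without a call stack. A base algorithm is identified with its starting
round, so `s` is the start of one iff `top s = s`. The active base algorithm of round `t` is the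
latest one of the current episode that is not past its scheduled end (`top_top`, `le_top_dur`,
`le_top`), and its candidate set is what its own eviction criterion leaves of all arms. Some arm
stays in the master set, which is not updated in rounds at which a base algorithm starts
(`survivor`). The replay bits are `bit u t m`. -/
structure Run.Valid (C₀ : ℝ) (T : ℕ) (bit : ℕ → ℕ → ℕ → Bool) (R : Run K) : Prop where
  ep_one : R.ep 1 = 1
  one_le_ep : ∀ t, 1 ≤ t → t ≤ T → 1 ≤ R.ep t
  ep_le_top : ∀ t, 1 ≤ t → t ≤ T → R.ep t ≤ R.top t
  top_le : ∀ t, 1 ≤ t → t ≤ T → R.top t ≤ t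
  cand_eq : ∀ t, 1 ≤ t → t ≤ T →
    R.cand t = Finset.univ \ evicted C₀ T R.obs (R.top t) t
  ep_step : ∀ t, 1 ≤ t → t < T → R.ep (t + 1) = R.ep t ∨
    (R.ep (t + 1) = t + 1 ∧ evicted C₀ T R.obs (R.ep t) (t + 1) = Finset.univ)
  replay : ∀ t, 1 ≤ t → t < T → ∀ m ∈ replayDurations T, bit (R.ep t) (t + 1) m = true →
    R.ep (t + 1) = R.ep t ∧ R.top (t + 1) = t + 1 ∧ m ≤ R.dur (t + 1)
  bit_of_replay : ∀ t, 1 ≤ t → t < T → R.ep (t + 1) = R.ep t → R.top (t + 1) = t + 1 →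
    R.dur (t + 1) ∈ replayDurations T ∧ bit (R.ep t) (t + 1) (R.dur (t + 1)) = true
  top_top : ∀ t, 1 ≤ t → t ≤ T → R.top (R.top t) = R.top t
  le_top_dur : ∀ t, 1 ≤ t → t ≤ T → t ≤ R.top t + R.dur (R.top t)
  le_top : ∀ s t, t ≤ T → s ≤ t → 1 ≤ s → R.ep t ≤ s → R.top s = s → t ≤ s + R.dur s → s ≤ R.top t
  survivor : ∀ t, 1 ≤ t → t ≤ T → ∃ a, ∀ s, R.ep t ≤ s → s ≤ t →
    R.top s = s ∨ a ∉ evicted C₀ T R.obs (R.ep t) s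

/-- The state of META just before round `t ≥ 1`. -/
noncomputable def stateAt [NeZero K] (C₀ : ℝ) (T : ℕ) (ω : Seed K) (t : ℕ) : State K :=
  metaState C₀ T ω (t - 1)

/-- The active base algorithm. The default value is irrelevant, since the stack is never empty. -/
def State.headFrame (s : State K) : Frame K := s.stack.headD ⟨0, 0, Finset.univ⟩

/-- The run of META on a given seed. -/
noncomputable def metaRun [NeZero K] (C₀ : ℝ) (T : ℕ) (ω : Seed K) : Run K where
  ep t := (stateAt C₀ T ω t).epStart
  top t := (stateAt C₀ T ω t).headFrame.start
  dur t := (stateAt C₀ T ω t).headFrame.dur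
  cand t := (stateAt C₀ T ω t).active
  obs t := ⟨(stateAt C₀ T ω t).active.card, (stateAt C₀ T ω t).play ω,
    ω.1 t ((stateAt C₀ T ω t).play ω)⟩

/-- The invariant linking the state before round `t` to the run. The candidate sets of interrupted
base algorithms and the master set are not updated in every round, so that for them only inclusions
hold. -/
structure StateInv (C₀ : ℝ) (T : ℕ) (R : Run K) (s : State K) (t : ℕ) : Prop where
  round_eq : s.round = t
  hist_eq : ∀ i, 1 ≤ i → i < t → s.hist i = R.obs i
  one_le_ep : 1 ≤ s.epStart
  ep_le : s.epStart ≤ t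
  sorted : s.stack.Pairwise (fun f g => g.start < f.start)
  mem_bounds : ∀ f ∈ s.stack, s.epStart ≤ f.start ∧ f.start ≤ t
  root : ∃ f ∈ s.stack, T + 1 ≤ f.start + f.dur
  cand_sup : ∀ f ∈ s.stack, Finset.univ \ evicted C₀ T R.obs f.start t ⊆ f.cand
  head : ∃ f l, s.stack = f :: l ∧ f.cand = Finset.univ \ evicted C₀ T R.obs f.start t ∧
    t ≤ f.start + f.dur
  frames : ∀ f ∈ s.stack, R.top f.start = f.start ∧ R.dur f.start = f.dur ∧
    R.ep f.start = s.epStart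
  opened : ∀ i, s.epStart ≤ i → i ≤ t → R.top i = i → t ≤ i + R.dur i → ∃ f ∈ s.stack, f.start = i
  master_nonempty : s.master.Nonempty
  master_disj : ∀ i, s.epStart ≤ i → i ≤ t →
    R.top i = i ∨ Disjoint s.master (evicted C₀ T R.obs s.epStart i)
  master_sup : Finset.univ \ evicted C₀ T R.obs s.epStart t ⊆ s.master

theorem mem_dropWhile_of_not {α : Type*} {p : α → Bool} {l : List α} {x : α} (hx : x ∈ l)
    (hp : p x = false) : x ∈ l.dropWhile p := by
  induction l with
  | nil => simp at hx
  | cons y l ih =>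
    rw [List.dropWhile_cons]
    split_ifs with h
    · rcases List.mem_cons.1 hx with rfl | hx
      · simp [hp] at h
      · exact ih hx
    · exact hx

theorem head_dropWhile_not {α : Type*} {p : α → Bool} {l l' : List α} {x : α}
    (h : l.dropWhile p = x :: l') : p x = false := by
  induction l with
  | nil => simp at h
  | cons y l ih =>
    rw [List.dropWhile_cons] at h
    split_ifs at h with hy
    · exact ih h
    · obtain ⟨rfl, rfl⟩ := List.cons.inj h
      simpa using hy

theorem StateInv.of_newEpisode {C₀ : ℝ} {T t : ℕ} {R : Run K} [NeZero K] {h : ℕ → Obs K}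
    (ht : 1 ≤ t) (htT : t ≤ T) (hh : ∀ i, 1 ≤ i → i < t → h i = R.obs i)
    (h1 : R.top t = t) (h2 : R.dur t = T + 1 - t) (h3 : R.ep t = t) :
    StateInv C₀ T R (newEpisode T t h) t where
  round_eq := rfl
  hist_eq := hh
  one_le_ep := ht
  ep_le := le_rfl
  sorted := by simp [newEpisode]
  mem_bounds := by simp [newEpisode]
  root := by simp only [newEpisode, List.mem_singleton, exists_eq_left]; omega
  cand_sup := by simp [newEpisode]
  head := ⟨_, _, rfl, by simp [evicted_self], by simp only; omega⟩
  frames := by simp [newEpisode, h1, h2, h3]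
  opened := by
    intro i hi hi' _ _
    have : i = t := le_antisymm hi' hi
    subst this
    simp [newEpisode]
  master_nonempty := ⟨0, by simp [newEpisode]⟩
  master_disj := by
    intro i hi hi'
    have : i = t := le_antisymm hi' hi
    subst this
    exact Or.inl h1
  master_sup := by simp [newEpisode]

/-- One round preserves the invariant and produces the transitions listed in `Run.Valid`. -/
theorem StateInv.step {C₀ : ℝ} {T t : ℕ} {R : Run K} [NeZero K] {s s' : State K} {a : Fin K} {y : ℝ}
    {B : ℕ → Bool} (hs : StateInv C₀ T R s t) (ht : 1 ≤ t) (htT : t < T)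
    (hs' : s' = s.step C₀ T a y B) (hobs : R.obs t = ⟨s.active.card, a, y⟩)
    (htop : R.top (t + 1) = s'.headFrame.start) (hdur : R.dur (t + 1) = s'.headFrame.dur)
    (hep : R.ep (t + 1) = s'.epStart) :
    StateInv C₀ T R s' (t + 1) ∧
      (s'.epStart = s.epStart ∨
        (s'.epStart = t + 1 ∧ evicted C₀ T R.obs s.epStart (t + 1) = Finset.univ)) ∧
      (∀ m ∈ replayDurations T, B m = true →
        s'.epStart = s.epStart ∧ R.top (t + 1) = t + 1 ∧ m ≤ R.dur (t + 1)) ∧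
      (s'.epStart = s.epStart → R.top (t + 1) = t + 1 →
        R.dur (t + 1) ∈ replayDurations T ∧ B (R.dur (t + 1)) = true) := by
  classical
  have hround := hs.round_eq
  set h' : ℕ → Obs K := Function.update s.hist s.round ⟨s.active.card, a, y⟩ with hh'
  have hist' : ∀ i, 1 ≤ i → i < t + 1 → h' i = R.obs i := by
    intro i hi hit
    by_cases h : i = t
    · subst h
      rw [hh', hround, Function.update_self, hobs]
    · rw [hh', hround, Function.update_of_ne h]
      exact hs.hist_eq i hi (by omega)
  have hev : ∀ u, 1 ≤ u → evicted C₀ T h' u (t + 1) = evicted C₀ T R.obs u (t + 1) :=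
    fun u hu => evicted_congr fun i hi hi' => hist' i (by omega) hi'
  set M := (replayDurations T).filter (fun m => B m = true) with hM
  by_cases hMne : M.Nonempty
  · -- a replay starts
    have e : s' = ⟨s.round + 1, s.epStart, s.master,
        ⟨s.round + 1, M.max' hMne, Finset.univ⟩ :: s.stack, h'⟩ := by
      rw [hs']
      unfold State.step
      simp only [← hM, hMne, dif_pos, ← hh']
    have etop : R.top (t + 1) = t + 1 := by rw [htop, e, ← hround]; rfl
    have edur : R.dur (t + 1) = M.max' hMne := by rw [hdur, e]; rfl
    have eep : s'.epStart = s.epStart := by rw [e]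
    have hmaxM : M.max' hMne ∈ M := M.max'_mem hMne
    refine ⟨?_, Or.inl eep, ?_, ?_⟩
    · have hep' : R.ep (t + 1) = s.epStart := by rw [hep, eep]
      rw [e]
      refine ⟨by simp [hround], hist', hs.one_le_ep, by simpa using hs.ep_le.trans (Nat.le_succ t),
        ?_, ?_, ?_, ?_, ?_, ?_, ?_, hs.master_nonempty, ?_, ?_⟩
      · rw [List.pairwise_cons]
        exact ⟨fun g hg => by have := hs.mem_bounds g hg; simp only; omega, hs.sorted⟩
      · intro f hf
        rcases List.mem_cons.1 hf with rfl | hf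
        · have := hs.ep_le
          simp only; omega
        · have := hs.mem_bounds f hf
          simp only; omega
      · obtain ⟨f, hf, hf'⟩ := hs.root
        exact ⟨f, List.mem_cons_of_mem _ hf, hf'⟩
      · intro f hf
        rcases List.mem_cons.1 hf with rfl | hf
        · simp
        · exact (Finset.sdiff_subset_sdiff le_rfl
            (evicted_mono le_rfl (Nat.le_succ t))).trans (hs.cand_sup f hf)
      · exact ⟨_, _, rfl, by simp [hround, evicted_self], by simp [hround]⟩
      · intro f hf
        rcases List.mem_cons.1 hf with rfl | hf
        · simp only [hround]
          exact ⟨etop, edur, hep'⟩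
        · exact hs.frames f hf
      · intro i hi hi' h1 h2
        rcases Nat.lt_or_ge i (t + 1) with h | h
        · obtain ⟨f, hf, hf'⟩ := hs.opened i hi (by omega) h1 (by omega)
          exact ⟨f, List.mem_cons_of_mem _ hf, hf'⟩
        · exact ⟨_, List.mem_cons_self, by simp only [hround]; omega⟩
      · intro i hi hi'
        rcases Nat.lt_or_ge i (t + 1) with h | h
        · exact hs.master_disj i hi (by omega)
        · obtain rfl : i = t + 1 := le_antisymm hi' h
          exact Or.inl etop
      · exact (Finset.sdiff_subset_sdiff le_rfl
            (evicted_mono le_rfl (Nat.le_succ t))).trans hs.master_sup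
    · intro m hm hBm
      refine ⟨eep, etop, ?_⟩
      rw [edur]
      exact M.le_max' m (Finset.mem_filter.2 ⟨hm, hBm⟩)
    · intro _ _
      rw [edur]
      exact Finset.mem_filter.1 hmaxM
  · -- no replay starts
    have e : s' = State.resume C₀ T { s with round := s.round + 1, hist := h' } := by
      rw [hs']
      unfold State.step
      simp only [← hM, hMne, dif_neg, not_false_eq_true, ← hh']
    have hnoB : ∀ m ∈ replayDurations T, B m = true → False := by
      intro m hm hBm
      exact hMne ⟨m, Finset.mem_filter.2 ⟨hm, hBm⟩⟩
    set p : Frame K → Bool := fun f => decide (f.start + f.dur < t + 1) with hp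
    obtain ⟨f₀, hf₀, hf₀'⟩ := hs.root
    have hmem : f₀ ∈ s.stack.dropWhile p :=
      mem_dropWhile_of_not hf₀ (by simp [hp]; omega)
    obtain ⟨f, rest, hfr⟩ : ∃ f rest, s.stack.dropWhile p = f :: rest := by
      cases h : s.stack.dropWhile p with
      | nil => rw [h] at hmem; simp at hmem
      | cons f rest => exact ⟨f, rest, rfl⟩
    have hsub : (s.stack.dropWhile p).Sublist s.stack := (List.dropWhile_suffix p).sublist
    have hfmem : f ∈ s.stack := hsub.subset (by rw [hfr]; simp)
    have hrest : ∀ g ∈ rest, g ∈ s.stack := fun g hg =>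
      hsub.subset (by rw [hfr]; exact List.mem_cons_of_mem _ hg)
    have hfb := hs.mem_bounds f hfmem
    have h1ep := hs.one_le_ep
    have hfend : t + 1 ≤ f.start + f.dur := by
      have := head_dropWhile_not hfr
      simpa [hp] using this
    set master' := s.master \ evicted C₀ T h' s.epStart (t + 1) with hmaster
    by_cases hme : master' = ∅
    · have e2 : s' = newEpisode T (t + 1) h' := by
        rw [e]
        unfold State.resume
        simp only [hround, ← hp, hfr, ← hmaster, hme, if_true]
      have etop : R.top (t + 1) = t + 1 := by rw [htop, e2]; rfl
      have edur : R.dur (t + 1) = T + 1 - (t + 1) := by rw [hdur, e2]; rfl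
      have eep : s'.epStart = t + 1 := by rw [e2]; rfl
      refine ⟨?_, Or.inr ⟨eep, ?_⟩, fun m hm hBm => (hnoB m hm hBm).elim, ?_⟩
      · rw [e2]
        exact StateInv.of_newEpisode (by omega) (by omega) hist' etop edur (by rw [hep, eep])
      · rw [Finset.eq_univ_iff_forall]
        intro b
        by_contra hb
        have hb1 : b ∈ s.master := hs.master_sup (Finset.mem_sdiff.2 ⟨Finset.mem_univ _,
          fun h => hb (evicted_mono le_rfl (Nat.le_succ t) h)⟩)
        have hb2 : b ∈ master' := by
          rw [hmaster, hev _ h1ep]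
          exact Finset.mem_sdiff.2 ⟨hb1, hb⟩
        rw [hme] at hb2
        simp at hb2
      · intro h
        have := hs.ep_le
        omega
    · have e2 : s' = ⟨t + 1, s.epStart, master',
          ⟨f.start, f.dur, f.cand \ evicted C₀ T h' f.start (t + 1)⟩ :: rest, h'⟩ := by
        rw [e]
        unfold State.resume
        simp only [hround, ← hp, hfr, ← hmaster, hme, if_false]
      have etop : R.top (t + 1) = f.start := by rw [htop, e2]; rfl
      have eep : s'.epStart = s.epStart := by rw [e2]
      -- on resuming, the eviction criterion is applied to the whole past of the base algorithm, so
      -- the updates missed during the interruption are made up for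
      have hcand : f.cand \ evicted C₀ T h' f.start (t + 1)
          = Finset.univ \ evicted C₀ T R.obs f.start (t + 1) := by
        rw [hev _ (by omega)]
        refine le_antisymm (Finset.sdiff_subset_sdiff (Finset.subset_univ _) le_rfl) ?_
        intro b hb
        rw [Finset.mem_sdiff] at hb ⊢
        refine ⟨hs.cand_sup f hfmem (Finset.mem_sdiff.2 ⟨Finset.mem_univ _, fun h => hb.2 ?_⟩), hb.2⟩
        exact evicted_mono le_rfl (Nat.le_succ t) h
      have hpw : (f :: rest).Pairwise (fun f g => g.start < f.start) := by
        rw [← hfr]; exact hs.sorted.sublist hsub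
      refine ⟨?_, Or.inl eep, fun m hm hBm => (hnoB m hm hBm).elim, fun _ h => by omega⟩
      rw [e2]
      refine ⟨rfl, hist', h1ep, by simpa using hs.ep_le.trans (Nat.le_succ t),
        ?_, ?_, ?_, ?_, ?_, ?_, ?_, Finset.nonempty_iff_ne_empty.2 hme, ?_, ?_⟩
      · rw [List.pairwise_cons] at hpw ⊢
        exact hpw
      · intro g hg
        rcases List.mem_cons.1 hg with rfl | hg
        · simp only; omega
        · have := hs.mem_bounds g (hrest g hg)
          simp only; omega
      · rw [hfr] at hmem
        rcases List.mem_cons.1 hmem with h | h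
        · exact ⟨_, List.mem_cons_self, by simp only; rw [← h]; exact hf₀'⟩
        · exact ⟨f₀, List.mem_cons_of_mem _ h, hf₀'⟩
      · intro g hg
        rcases List.mem_cons.1 hg with rfl | hg
        · simp only; rw [hcand]
        · exact (Finset.sdiff_subset_sdiff le_rfl
            (evicted_mono le_rfl (Nat.le_succ t))).trans (hs.cand_sup g (hrest g hg))
      · exact ⟨_, _, rfl, hcand, hfend⟩
      · intro g hg
        rcases List.mem_cons.1 hg with rfl | hg
        · exact hs.frames f hfmem
        · exact hs.frames g (hrest g hg)
      · intro i hi hi' h1 h2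
        rcases Nat.lt_or_ge i (t + 1) with h | h
        · obtain ⟨g, hg, hg'⟩ := hs.opened i hi (by omega) h1 (by omega)
          have hg2 : g ∈ s.stack.dropWhile p := by
            refine mem_dropWhile_of_not hg ?_
            have := (hs.frames g hg).2.1
            rw [hg'] at this
            simp only [hp, decide_eq_false_iff_not]
            omega
          rw [hfr] at hg2
          rcases List.mem_cons.1 hg2 with h | h
          · exact ⟨_, List.mem_cons_self, by simp only; rw [← h]; exact hg'⟩
          · exact ⟨g, List.mem_cons_of_mem _ h, hg'⟩
        · obtain rfl : i = t + 1 := le_antisymm hi' h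
          omega
      · intro i hi hi'
        rcases Nat.lt_or_ge i (t + 1) with h | h
        · rcases hs.master_disj i hi (by omega) with h1 | h1
          · exact Or.inl h1
          · exact Or.inr (Finset.disjoint_of_subset_left Finset.sdiff_subset h1)
        · obtain rfl : i = t + 1 := le_antisymm hi' h
          right
          simp only
          rw [hmaster, hev _ h1ep]
          exact Finset.sdiff_disjoint
      · intro b hb
        simp only at hb ⊢
        rw [hmaster, hev _ h1ep]
        rw [Finset.mem_sdiff] at hb ⊢
        refine ⟨hs.master_sup (Finset.mem_sdiff.2 ⟨Finset.mem_univ _, fun h => hb.2 ?_⟩), hb.2⟩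
        exact evicted_mono le_rfl (Nat.le_succ t) h

section MetaRun

variable [NeZero K] (C₀ : ℝ) (T : ℕ) (ω : Seed K)

theorem metaState_round (n : ℕ) : (metaState C₀ T ω n).round = n + 1 := by
  induction n with
  | zero => rfl
  | succ n ih =>
    have key : ∀ s : State K, (s.resume C₀ T).round = s.round := by
      intro s
      unfold State.resume
      split
      · rfl
      · simp only; split_ifs <;> rfl
    simp only [metaState, State.step]
    split_ifs
    · simp [ih]
    · rw [key]; simp [ih]

theorem stateAt_succ {t : ℕ} (ht : 1 ≤ t) :
    stateAt C₀ T ω (t + 1) = (stateAt C₀ T ω t).step C₀ T ((stateAt C₀ T ω t).play ω)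
      (ω.1 t ((stateAt C₀ T ω t).play ω))
      (fun m => ω.2.2 ((stateAt C₀ T ω t).epStart, t + 1, m)) := by
  obtain ⟨n, rfl⟩ : ∃ n, t = n + 1 := ⟨t - 1, by omega⟩
  have h := metaState_round C₀ T ω n
  unfold stateAt
  simp only [Nat.add_sub_cancel, metaState, h]

theorem stateInv_stateAt {t : ℕ} (ht : 1 ≤ t) (htT : t ≤ T) :
    StateInv C₀ T (metaRun C₀ T ω) (stateAt C₀ T ω t) t := by
  induction t, ht using Nat.le_induction with
  | base => exact StateInv.of_newEpisode le_rfl htT (fun i h1 h2 => by omega) rfl rfl rfl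
  | succ t ht ih =>
    exact (StateInv.step (ih (by omega)) ht (by omega) (stateAt_succ C₀ T ω ht) rfl rfl rfl rfl).1

theorem metaRun_valid :
    (metaRun C₀ T ω).Valid C₀ T (fun u t m => ω.2.2 (u, t, m)) := by
  have inv := fun t h1 h2 => stateInv_stateAt C₀ T ω (t := t) h1 h2
  have hstep := fun t (h1 : 1 ≤ t) (h2 : t < T) =>
    (StateInv.step (inv t h1 h2.le) h1 h2 (stateAt_succ C₀ T ω h1) rfl rfl rfl rfl).2
  have hhead : ∀ t, 1 ≤ t → t ≤ T → ∃ f ∈ (stateAt C₀ T ω t).stack,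
      (stateAt C₀ T ω t).headFrame = f ∧ (stateAt C₀ T ω t).active = f.cand ∧
      f.cand = Finset.univ \ evicted C₀ T (metaRun C₀ T ω).obs f.start t ∧ t ≤ f.start + f.dur ∧
      ∀ g ∈ (stateAt C₀ T ω t).stack, g.start ≤ f.start := by
    intro t h1 h2
    obtain ⟨f, l, hfl, hc, he⟩ := (inv t h1 h2).head
    have hs := (inv t h1 h2).sorted
    refine ⟨f, by rw [hfl]; simp, by simp [State.headFrame, hfl], by simp [State.active, hfl],
      hc, he, ?_⟩
    rw [hfl] at hs ⊢
    rw [List.pairwise_cons] at hs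
    intro g hg
    rcases List.mem_cons.1 hg with rfl | hg
    · exact le_rfl
    · exact (hs.1 g hg).le
  refine ⟨rfl, fun t h1 h2 => (inv t h1 h2).one_le_ep, ?_, ?_, ?_, fun t h1 h2 => (hstep t h1 h2).1,
    fun t h1 h2 => (hstep t h1 h2).2.1, fun t h1 h2 => (hstep t h1 h2).2.2, ?_, ?_, ?_, ?_⟩
  · intro t h1 h2
    obtain ⟨f, hf, hf', -⟩ := hhead t h1 h2
    have := ((inv t h1 h2).mem_bounds f hf).1
    simpa [metaRun, hf'] using this
  · intro t h1 h2
    obtain ⟨f, hf, hf', -⟩ := hhead t h1 h2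
    have := ((inv t h1 h2).mem_bounds f hf).2
    simpa [metaRun, hf'] using this
  · intro t h1 h2
    obtain ⟨f, hf, hf', hc, hc', -⟩ := hhead t h1 h2
    change (stateAt C₀ T ω t).active
      = Finset.univ \ evicted C₀ T (metaRun C₀ T ω).obs (stateAt C₀ T ω t).headFrame.start t
    rw [hc, hf', hc']
  · intro t h1 h2
    obtain ⟨f, hf, hf', -⟩ := hhead t h1 h2
    have e : (metaRun C₀ T ω).top t = f.start := by simp [metaRun, hf']
    rw [e]
    exact ((inv t h1 h2).frames f hf).1
  · intro t h1 h2
    obtain ⟨f, hf, hf', -, -, he, -⟩ := hhead t h1 h2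
    have e : (metaRun C₀ T ω).top t = f.start := by simp [metaRun, hf']
    rw [e, ((inv t h1 h2).frames f hf).2.1]
    exact he
  · intro s t h2 hst h1 hep htop hd
    obtain ⟨f, hf, hf', -, -, -, hmax⟩ := hhead t (h1.trans hst) h2
    have e : (metaRun C₀ T ω).top t = f.start := by simp [metaRun, hf']
    obtain ⟨g, hg, rfl⟩ := (inv t (h1.trans hst) h2).opened s hep hst htop hd
    rw [e]
    exact hmax g hg
  · intro t h1 h2
    obtain ⟨a, ha⟩ := (inv t h1 h2).master_nonempty
    refine ⟨a, fun s hs hs' => ?_⟩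
    rcases (inv t h1 h2).master_disj s hs hs' with h | h
    · exact Or.inl h
    · exact Or.inr fun h' => (Finset.disjoint_left.1 h) ha h'

end MetaRun

end

section

variable {K : ℕ}

/-! ### Mean rewards and gaps -/

namespace Environment

theorem integrable_apply (E : Environment K) (t : ℕ) (a : Fin K) :
    Integrable (fun y : Fin K → ℝ => y a) (E.law t) := by
  refine Integrable.of_bound (measurable_pi_apply a).aestronglyMeasurable 1 ?_
  filter_upwards [E.reward_mem t] with y hy
  rw [Real.norm_eq_abs, abs_le]
  exact ⟨by linarith [(hy a).1], (hy a).2⟩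

theorem mean_nonneg (E : Environment K) (t : ℕ) (a : Fin K) : 0 ≤ E.mean t a := by
  refine integral_nonneg_of_ae ?_
  filter_upwards [E.reward_mem t] with y hy
  exact (hy a).1

theorem mean_le_one (E : Environment K) (t : ℕ) (a : Fin K) : E.mean t a ≤ 1 := by
  have h : E.mean t a ≤ ∫ _, (1 : ℝ) ∂(E.law t) := by
    refine integral_mono_ae (E.integrable_apply t a) (integrable_const _) ?_
    filter_upwards [E.reward_mem t] with y hy
    exact (hy a).2
  simpa using h

theorem sub_le_gap (E : Environment K) (t : ℕ) (a' a : Fin K) :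
    E.mean t a' - E.mean t a ≤ E.gap t a :=
  le_ciSup (f := fun a' => E.mean t a' - E.mean t a) (Set.finite_range _).bddAbove a'

theorem gap_nonneg (E : Environment K) (t : ℕ) (a : Fin K) : 0 ≤ E.gap t a := by
  simpa using E.sub_le_gap t a a

theorem gap_eq [NeZero K] (E : Environment K) (t : ℕ) (a : Fin K) :
    E.gap t a = (⨆ a', E.mean t a') - E.mean t a := by
  refine le_antisymm (ciSup_le fun a' => ?_) ?_
  · exact sub_le_sub_right (le_ciSup (f := fun a' => E.mean t a') (Set.finite_range _).bddAbove a') _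
  · rw [sub_le_iff_le_add]
    exact ciSup_le fun a' => by linarith [E.sub_le_gap t a' a]

theorem gap_le_one [NeZero K] (E : Environment K) (t : ℕ) (a : Fin K) : E.gap t a ≤ 1 :=
  ciSup_le fun a' => by linarith [E.mean_le_one t a', E.mean_nonneg t a]

theorem gap_sub_gap [NeZero K] (E : Environment K) (t : ℕ) (a b : Fin K) :
    E.gap t b - E.gap t a = E.mean t a - E.mean t b := by
  rw [gap_eq, gap_eq]; ring

theorem NoSafeArm.mono {E : Environment K} {x x' y y' : ℕ} (h : E.NoSafeArm x y) (hx : x' ≤ x)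
    (hy : y ≤ y') : E.NoSafeArm x' y' := by
  intro a
  obtain ⟨s₁, s₂, h1, h2, h3, h4⟩ := h a
  exact ⟨s₁, s₂, by omega, h2, by omega, h4⟩

end Environment

theorem half_le_log {T : ℕ} (hT : 2 ≤ T) : 1 / 2 ≤ Real.log T := by
  have h1 : Real.log 2 ≤ Real.log T :=
    Real.log_le_log (by norm_num) (by exact_mod_cast hT)
  have := Real.log_two_gt_d9
  linarith

/-! ### Three summation lemmas -/

/-- Abel summation: a monotone weight costs no more than its upper bound, if all tail sums are
bounded above. -/
theorem sum_mul_le_of_tail_le (D : Finset ℕ) (x w : ℕ → ℝ) {F W : ℝ} (hF : 0 ≤ F) (hW : 0 ≤ W)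
    (hw0 : ∀ t ∈ D, 0 ≤ w t) (hwW : ∀ t ∈ D, w t ≤ W)
    (hmono : ∀ s ∈ D, ∀ t ∈ D, s ≤ t → w s ≤ w t)
    (htail : ∀ r ∈ D, ∑ t ∈ D with r ≤ t, x t ≤ F) : ∑ t ∈ D, w t * x t ≤ W * F := by
  classical
  induction D using Finset.induction_on_min generalizing w W with
  | empty => simpa using mul_nonneg hW hF
  | insert t₀ D h ih =>
    have hn : t₀ ∉ D := fun hm => (h t₀ hm).false
    have e1 : ∑ t ∈ insert t₀ D, x t ≤ F := by
      refine le_of_eq_of_le (Finset.sum_congr ?_ fun _ _ => rfl) (htail t₀ (by simp))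
      ext t
      simp only [Finset.mem_insert, Finset.mem_filter, iff_self_and]
      rintro (rfl | ht)
      · exact le_rfl
      · exact (h t ht).le
    have e2 := ih (fun t => w t - w t₀) (W := W - w t₀)
      (sub_nonneg.2 (hwW t₀ (by simp)))
      (fun t ht => sub_nonneg.2 (hmono t₀ (by simp) t (by simp [ht]) (h t ht).le))
      (fun t ht => sub_le_sub_right (hwW t (by simp [ht])) _)
      (fun s hs t ht hst => sub_le_sub_right (hmono s (by simp [hs]) t (by simp [ht]) hst) _)
      (fun r hr => by
        refine le_of_eq_of_le (Finset.sum_congr ?_ fun _ _ => rfl) (htail r (by simp [hr]))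
        ext t
        simp only [Finset.mem_insert, Finset.mem_filter]
        constructor
        · rintro ⟨h1, h2⟩; exact ⟨Or.inr h1, h2⟩
        · rintro ⟨rfl | h1, h2⟩
          · exact absurd (h r hr) (not_lt.2 h2)
          · exact ⟨h1, h2⟩)
    have e3 : ∑ t ∈ insert t₀ D, w t * x t
        = w t₀ * ∑ t ∈ insert t₀ D, x t + ∑ t ∈ D, (w t - w t₀) * x t := by
      rw [Finset.sum_insert hn, Finset.sum_insert hn, mul_add, Finset.mul_sum, add_assoc,
        ← Finset.sum_add_distrib]
      congr 1
      exact Finset.sum_congr rfl fun t _ => by ring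
    rw [e3]
    have := mul_le_mul_of_nonneg_left e1 (hw0 t₀ (by simp))
    linarith

/-- If the `n` elements of a finite set are ranked by `θ`, from the largest value down, the
reciprocals of the ranks add up to at most the `n`-th harmonic number. -/
theorem sum_inv_rank_le {α : Type*} [DecidableEq α] (S : Finset α) (θ : α → ℕ) :
    ∑ b ∈ S, (1 : ℝ) / (S.filter fun b' => θ b ≤ θ b').card ≤ harmonic S.card := by
  induction S using Finset.strongInduction with
  | H S ih =>
    rcases S.eq_empty_or_nonempty with rfl | hS
    · simp
    obtain ⟨b₀, hb₀, hmin⟩ := S.exists_min_image θ hS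
    have hss := Finset.erase_ssubset hb₀
    have h1 := ih _ hss
    have hc : S.card = (S.erase b₀).card + 1 := (Finset.card_erase_add_one hb₀).symm
    rw [← Finset.add_sum_erase S _ hb₀, hc, harmonic_succ]
    have e : S.filter (fun b' => θ b₀ ≤ θ b') = S :=
      Finset.filter_true_of_mem fun b hb => hmin b hb
    rw [e, hc]
    push_cast
    rw [add_comm]
    refine add_le_add (le_trans (Finset.sum_le_sum fun b hb => ?_) h1) (by rw [one_div])
    refine one_div_le_one_div_of_le ?_ ?_
    · exact_mod_cast Finset.card_pos.2 ⟨b, Finset.mem_filter.2 ⟨hb, le_refl (θ b)⟩⟩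
    · exact_mod_cast Finset.card_le_card (Finset.filter_subset_filter _ (Finset.erase_subset _ _))

/-- If `θ b` is the last round at which arm `b` is a candidate and `N b` the number of candidates left
in that round, the arms leave in the order of `θ`, so the reciprocals add up to the harmonic number. -/
theorem sum_inv_card_le {K T : ℕ} (hK : 1 ≤ K) (hKT : K ≤ T) (hT : 2 ≤ T) (θ : Fin K → ℕ) (N : Fin K → ℕ)
    (hN : ∀ b, (Finset.univ.filter fun b' => θ b ≤ θ b').card ≤ N b) :
    ∑ b, (1 : ℝ) / N b ≤ 3 * Real.log T := by
  classical
  have h1 := sum_inv_rank_le (Finset.univ : Finset (Fin K)) θ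
  have h2 : (harmonic K : ℝ) ≤ 1 + Real.log K := harmonic_le_one_add_log K
  have h3 : Real.log K ≤ Real.log T :=
    Real.log_le_log (by exact_mod_cast hK) (by exact_mod_cast hKT)
  have h4 := half_le_log hT
  have h5 : ∑ b, (1 : ℝ) / N b
      ≤ ∑ b, (1 : ℝ) / (Finset.univ.filter fun b' => θ b ≤ θ b').card := by
    refine Finset.sum_le_sum fun b _ => one_div_le_one_div_of_le ?_ (by exact_mod_cast hN b)
    exact_mod_cast Finset.card_pos.2 ⟨b, by simp⟩
  rw [Finset.card_univ, Fintype.card_fin] at h1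
  linarith

/-- An initial piece of an interval of integers is an interval. -/
theorem filter_Ico_eq_Ico {x y : ℕ} (P : ℕ → Prop) [DecidablePred P]
    (hP : ∀ s t, x ≤ s → s ≤ t → t < y → P t → P s) :
    ∃ z, z ≤ max x y ∧ x ≤ z ∧ (Finset.Ico x y).filter P = Finset.Ico x z := by
  by_cases h : ∃ z, x ≤ z ∧ (z < y → ¬ P z)
  · classical
    refine ⟨Nat.find h, ?_, (Nat.find_spec h).1, ?_⟩
    · exact Nat.find_min' h ⟨le_max_left _ _, fun hlt => absurd hlt (by simp)⟩
    · ext t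
      simp only [Finset.mem_filter, Finset.mem_Ico]
      constructor
      · rintro ⟨⟨h1, h2⟩, h3⟩
        refine ⟨h1, ?_⟩
        by_contra hlt
        have hz := Nat.find_spec h
        exact hz.2 (by omega) (hP _ t hz.1 (by omega) h2 h3)
      · rintro ⟨h1, h2⟩
        have := Nat.find_min h h2
        push Not at this
        have := this h1
        exact ⟨⟨h1, this.1⟩, this.2⟩
  · push Not at h
    have := h (max x y) (le_max_left _ _)
    have := this.1
    omega

/-! ### Eviction means significant regret -/

/-- The conditional mean `μ_s(a') 1{a' ∈ 𝒜_s} - μ_s(a) 1{a ∈ 𝒜_s}` of the estimate `δ̂_s(a', a)`. -/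
noncomputable def Run.meanEst (E : Environment K) (R : Run K) (s : ℕ) (a' a : Fin K) : ℝ :=
  (if a' ∈ R.cand s then E.mean s a' else 0) - (if a ∈ R.cand s then E.mean s a else 0)

/-- All aggregate estimates are close to the sums of their conditional means. The constant `20` makes
the probability of each exception of the order of `T⁻¹⁰`. -/
def Run.Concentrated (E : Environment K) (T : ℕ) (R : Run K) : Prop :=
  ∀ (a' a : Fin K) (s₁ s₂ : ℕ), 1 ≤ s₁ → s₁ < s₂ → s₂ ≤ T →
    |∑ s ∈ Finset.Icc s₁ s₂, ((R.obs s).gapEst a' a - R.meanEst E s a' a)|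
      ≤ 20 * Real.log T * √(max ((K : ℝ) * ((s₂ : ℝ) - (s₁ : ℝ))) ((K : ℝ) ^ 2))

/-- Every interval of rounds without a safe arm contains a point of `S`, its left end excluded. -/
def Hitting (E : Environment K) (T : ℕ) (S : Finset ℕ) : Prop :=
  ∀ x y, 1 ≤ x → y ≤ T → E.NoSafeArm x y → ∃ s ∈ S, x < s ∧ s ≤ y

namespace Run.Valid

variable {C₀ : ℝ} {T : ℕ} {bit : ℕ → ℕ → ℕ → Bool} {R : Run K}

theorem ep_le (hR : R.Valid C₀ T bit) {t : ℕ} (h1 : 1 ≤ t) (h2 : t ≤ T) : R.ep t ≤ t :=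
  (hR.ep_le_top t h1 h2).trans (hR.top_le t h1 h2)

theorem ep_eq (hR : R.Valid C₀ T bit) {s t : ℕ} (h1 : 1 ≤ t) (h2 : t ≤ T) (hs : R.ep t ≤ s)
    (hst : s ≤ t) : R.ep s = R.ep t := by
  induction t, h1 using Nat.le_induction with
  | base =>
    have := hR.ep_one
    have : s = 1 := by omega
    rw [this]
  | succ t ht ih =>
    rcases Nat.lt_or_ge s (t + 1) with h | h
    · rcases hR.ep_step t ht (by omega) with h' | h'
      · rw [h'] at hs ⊢
        exact ih (by omega) hs (by omega)
      · omega
    · rw [le_antisymm hst h]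

theorem ep_ep (hR : R.Valid C₀ T bit) {t : ℕ} (h1 : 1 ≤ t) (h2 : t ≤ T) :
    R.ep (R.ep t) = R.ep t :=
  hR.ep_eq h1 h2 le_rfl (hR.ep_le h1 h2)

theorem top_ep (hR : R.Valid C₀ T bit) {t : ℕ} (h1 : 1 ≤ t) (h2 : t ≤ T) :
    R.top (R.ep t) = R.ep t := by
  have h3 := hR.one_le_ep t h1 h2
  have h4 := hR.ep_le h1 h2
  have h5 := hR.ep_le_top (R.ep t) h3 (by omega)
  have h6 := hR.top_le (R.ep t) h3 (by omega)
  rw [hR.ep_ep h1 h2] at h5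
  omega

/-- If all rounds of `[j, t)` are played by base algorithms started at `j` or later, an arm that
their eviction criterion removes by round `t` has incurred significant regret: up to the earliest
interval on which the criterion holds, it was a candidate in every round, so that its estimated gaps
cannot exceed its true ones on average. -/
theorem exists_sigRegret_of_evicted (hR : R.Valid C₀ T bit) {E : Environment K} [NeZero K]
    (hT : 2 ≤ T) (hC : 22 ≤ √C₀) (hconc : R.Concentrated E T) {j t : ℕ} (hj : 1 ≤ j) (ht : t ≤ T + 1)
    (htop : ∀ s, j ≤ s → s < t → j ≤ R.top s) {b : Fin K} (hb : b ∈ evicted C₀ T R.obs j t) :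
    ∃ s₁ s₂, j ≤ s₁ ∧ s₁ < s₂ ∧ s₂ < t ∧ E.SigRegret b s₁ s₂ := by
  classical
  rw [mem_evicted] at hb
  have hex : ∃ s₂ s₁, j ≤ s₁ ∧ s₁ < s₂ ∧ s₂ < t ∧ ElimOn C₀ T R.obs s₁ s₂ b := by
    obtain ⟨s₁, s₂, h⟩ := hb
    exact ⟨s₂, s₁, h⟩
  obtain ⟨s₁, h1, h2, h3, a', h4⟩ := Nat.find_spec hex
  set s₂ := Nat.find hex
  refine ⟨s₁, s₂, h1, h2, h3, ?_⟩
  have hcand : ∀ s, j ≤ s → s ≤ s₂ → b ∈ R.cand s := by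
    intro s hs hs'
    rw [hR.cand_eq s (by omega) (by omega), Finset.mem_sdiff]
    refine ⟨Finset.mem_univ _, fun hev => ?_⟩
    obtain ⟨r₁, r₂, g1, g2, g3, g4⟩ := mem_evicted.1 hev
    have hjt := htop s hs (by omega)
    exact Nat.find_min hex (show r₂ < s₂ by omega) ⟨r₁, by omega, g2, by omega, g4⟩
  set X : ℝ := max ((K : ℝ) * ((s₂ : ℝ) - (s₁ : ℝ))) ((K : ℝ) ^ 2) with hX
  have hL := half_le_log hT
  have hc := (abs_le.1 (hconc a' b s₁ s₂ (by omega) h2 (by omega))).2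
  rw [Finset.sum_sub_distrib] at hc
  have hm : ∑ s ∈ Finset.Icc s₁ s₂, R.meanEst E s a' b ≤ ∑ s ∈ Finset.Icc s₁ s₂, E.gap s b := by
    refine Finset.sum_le_sum fun s hs => ?_
    have hs := Finset.mem_Icc.1 hs
    rw [Run.meanEst, if_pos (hcand s (by omega) hs.2)]
    split_ifs
    · exact E.sub_le_gap s a' b
    · linarith [E.mean_nonneg s b, E.gap_nonneg s b]
  have hC0 : 0 ≤ C₀ := by
    by_contra h
    rw [Real.sqrt_eq_zero_of_nonpos (by linarith)] at hC
    norm_num at hC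
  rw [Real.sqrt_mul hC0] at h4
  have hXle : √((K : ℝ) * ((s₂ : ℝ) - (s₁ : ℝ))) ≤ √X := Real.sqrt_le_sqrt (le_max_left _ _)
  have hX0 : 0 ≤ √X := Real.sqrt_nonneg X
  unfold Environment.SigRegret
  -- the threshold exceeds the fluctuations by `2 * log T * √X`, and `log T ≥ 1 / 2`
  have h5 : √X ≤ Real.log T * (√C₀ * √X) - 20 * Real.log T * √X := by
    have : 1 ≤ Real.log T * (√C₀ - 20) := by nlinarith
    nlinarith
  linarith

/-- A new episode starts only after every arm has incurred significant regret in the old one. -/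
theorem noSafeArm_of_ep_ne (hR : R.Valid C₀ T bit) {E : Environment K} [NeZero K]
    (hT : 2 ≤ T) (hC : 22 ≤ √C₀) (hconc : R.Concentrated E T) {t : ℕ} (h1 : 1 ≤ t) (h2 : t < T)
    (h : R.ep (t + 1) ≠ R.ep t) : E.NoSafeArm (R.ep t) t := by
  obtain ⟨-, h3⟩ := (hR.ep_step t h1 h2).resolve_left h
  intro a
  have ha : a ∈ evicted C₀ T R.obs (R.ep t) (t + 1) := by rw [h3]; simp
  obtain ⟨s₁, s₂, g1, g2, g3, g4⟩ := hR.exists_sigRegret_of_evicted hT hC hconc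
    (hR.one_le_ep t h1 h2.le) (by omega) (fun s hs hs' => by
      have := hR.ep_eq h1 h2.le hs (by omega)
      have h4 := hR.one_le_ep t h1 h2.le
      rw [← this]
      exact hR.ep_le_top s (by omega) (by omega)) ha
  exact ⟨s₁, s₂, g1, g2, by omega, g4⟩

/-- There is at most one episode more than there are points in a hitting set. -/
theorem card_episodes_le (hR : R.Valid C₀ T bit) {E : Environment K} [NeZero K]
    (hT : 2 ≤ T) (hC : 22 ≤ √C₀) (hconc : R.Concentrated E T) {S : Finset ℕ} (hS : Hitting E T S)
    {t : ℕ} (h1 : 1 ≤ t) (h2 : t ≤ T) :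
    ((Finset.Icc 1 t).filter fun s => R.ep s = s).card
      ≤ (S.filter fun s => s < R.ep t).card + 1 := by
  induction t, h1 using Nat.le_induction with
  | base => exact (Finset.card_filter_le _ _).trans (by simp)
  | succ t ht ih =>
    have e : Finset.Icc 1 (t + 1) = insert (t + 1) (Finset.Icc 1 t) := by
      ext i; simp only [Finset.mem_Icc, Finset.mem_insert]; omega
    have hle := hR.ep_le ht (by omega : t ≤ T)
    rw [e, Finset.filter_insert]
    by_cases h : R.ep (t + 1) = R.ep t
    · rw [if_neg (by omega), h]
      exact ih (by omega)
    · obtain ⟨s, hs, hs1, hs2⟩ := hS _ _ (hR.one_le_ep t ht (by omega)) (by omega)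
        (hR.noSafeArm_of_ep_ne hT hC hconc ht (by omega) h)
      have h3 := ((hR.ep_step t ht (by omega)).resolve_left h).1
      rw [if_pos h3, Finset.card_insert_of_notMem (by simp)]
      have : (S.filter fun s => s < R.ep t).card < (S.filter fun s => s < R.ep (t + 1)).card := by
        refine Finset.card_lt_card (Finset.ssubset_iff_of_subset ?_ |>.2 ⟨s, ?_, ?_⟩)
        · intro i hi
          rw [Finset.mem_filter] at hi ⊢
          exact ⟨hi.1, by omega⟩
        · exact Finset.mem_filter.2 ⟨hs, by omega⟩
        · exact fun hm => absurd (Finset.mem_filter.1 hm).2 (by omega)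
      have := ih (by omega)
      omega

end Run.Valid

end

section

variable {K : ℕ}

/-! ### Regret of an arm that survives an episode -/

open Classical in
/-- The replays `Base-Alg(t, m)` with `t ∈ (u, r)` that are sure to expose arm `a` before round `r`:
within the replay and between two points of `S` the arm incurs regret well above the eviction
threshold. -/
noncomputable def exposing (E : Environment K) (T : ℕ) (S : Finset ℕ) (κ : ℝ) (u r : ℕ)
    (a : Fin K) : Finset (ℕ × ℕ) :=
  (Finset.Ioo u r ×ˢ replayDurations T).filter fun p => ∃ s₂, p.1 < s₂ ∧ s₂ < r ∧ s₂ ≤ p.1 + p.2 ∧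
    (∀ s ∈ S, ¬ (p.1 < s ∧ s ≤ s₂)) ∧
    κ * Real.log T * √(max ((K : ℝ) * ((s₂ : ℝ) - (p.1 : ℝ))) ((K : ℝ) ^ 2))
      ≤ ∑ s ∈ Finset.Icc p.1 s₂, E.gap s a

theorem mem_exposing {E : Environment K} {T : ℕ} {S : Finset ℕ} {κ : ℝ} {u r : ℕ} {a : Fin K}
    {p : ℕ × ℕ} : p ∈ exposing E T S κ u r a ↔ (u < p.1 ∧ p.1 < r) ∧ p.2 ∈ replayDurations T ∧
      ∃ s₂, p.1 < s₂ ∧ s₂ < r ∧ s₂ ≤ p.1 + p.2 ∧ (∀ s ∈ S, ¬ (p.1 < s ∧ s ≤ s₂)) ∧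
        κ * Real.log T * √(max ((K : ℝ) * ((s₂ : ℝ) - (p.1 : ℝ))) ((K : ℝ) ^ 2))
          ≤ ∑ s ∈ Finset.Icc p.1 s₂, E.gap s a := by
  classical
  unfold exposing
  rw [Finset.mem_filter, Finset.mem_product, Finset.mem_Ioo, and_assoc]

/-- Whenever many exposing replays are to be expected, one takes place. -/
def ReplaysOccur (E : Environment K) (T : ℕ) (S : Finset ℕ) (κ : ℝ) (bit : ℕ → ℕ → ℕ → Bool) :
    Prop :=
  ∀ (a : Fin K) (u r : ℕ), 1 ≤ u → u ≤ T → r ≤ T →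
    ∑ p ∈ exposing E T S κ u r a, (replayProb u p.1 p.2 : ℝ) ≤ 10 * Real.log T ∨
      ∃ p ∈ exposing E T S κ u r a, bit u p.1 p.2 = true

/-- An exposing replay that takes place leads to the eviction of the arm: the replay keeps a safe
arm, against which the regret of the exposed arm shows up in the estimates. -/
theorem Run.Valid.not_bit_of_exposing [NeZero K] {C₀ : ℝ} {T : ℕ} {bit : ℕ → ℕ → ℕ → Bool}
    {R : Run K} (hR : R.Valid C₀ T bit) {E : Environment K} {S : Finset ℕ} (hT : 2 ≤ T)
    (hC : 22 ≤ √C₀) (hconc : R.Concentrated E T) (hS : Hitting E T S) {v r : ℕ} (hv1 : 1 ≤ v)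
    (hv : v ≤ T) (hrv : r ≤ v) {a : Fin K} (ha : a ∉ evicted C₀ T R.obs (R.ep v) r) {p : ℕ × ℕ}
    (hp : p ∈ exposing E T S (√C₀ + 23) (R.ep v) r a) : bit (R.ep v) p.1 p.2 ≠ true := by
  classical
  intro hbit
  obtain ⟨⟨hut, htr⟩, hm, s₂, hts, hsr, hsm, hSs, hreg⟩ := mem_exposing.1 hp
  obtain ⟨t, m⟩ := p
  simp only at *
  have hu1 := hR.one_le_ep v hv1 hv
  obtain ⟨t', rfl⟩ : ∃ t', t = t' + 1 := ⟨t - 1, by omega⟩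
  have hep' : R.ep t' = R.ep v := hR.ep_eq hv1 hv (by omega) (by omega)
  rw [← hep'] at hbit
  obtain ⟨-, htop, hdur⟩ := hR.replay t' (by omega) (by omega) m hm hbit
  set t := t' + 1 with ht
  have hep : ∀ s, t ≤ s → s ≤ s₂ → R.ep s = R.ep v := fun s h1 h2 =>
    hR.ep_eq hv1 hv (by omega) (by omega)
  have hge : ∀ s, t ≤ s → s ≤ s₂ → t ≤ R.top s := fun s h1 h2 =>
    hR.le_top t s (by omega) h1 (by omega) (by rw [hep s h1 h2]; omega) htop (by omega)
  -- an arm that is safe on `[t, s₂]`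
  have hsafe : ¬ E.NoSafeArm t s₂ := by
    intro h
    obtain ⟨s, hs, h1, h2⟩ := hS t s₂ (by omega) (by omega) h
    exact hSs s hs ⟨h1, h2⟩
  unfold Environment.NoSafeArm at hsafe
  push Not at hsafe
  obtain ⟨a', ha'⟩ := hsafe
  have hcand : ∀ s, t ≤ s → s ≤ s₂ → a' ∈ R.cand s := by
    intro s h1 h2
    rw [hR.cand_eq s (by omega) (by omega), Finset.mem_sdiff]
    refine ⟨Finset.mem_univ _, fun h => ?_⟩
    obtain ⟨x₁, x₂, g1, g2, g3, g4⟩ := hR.exists_sigRegret_of_evicted hT hC hconc (j := t)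
      (by omega) (by omega) (fun i hi hi' => hge i hi (by omega))
      (evicted_mono (hge s h1 h2) le_rfl h)
    exact ha' x₁ x₂ g1 g2 (by omega) g4
  refine ha (mem_evicted.2 ⟨t, s₂, hut.le, hts, hsr, a', ?_⟩)
  have hc := (abs_le.1 (hconc a' a t s₂ (by omega) hts (by omega))).1
  rw [Finset.sum_sub_distrib] at hc
  have hsr' : ∑ s ∈ Finset.Icc t s₂, E.gap s a' < √((K : ℝ) * ((s₂ : ℝ) - (t : ℝ))) := by
    have := ha' t s₂ le_rfl hts le_rfl
    unfold Environment.SigRegret at this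
    exact not_le.1 this
  have hm' : ∑ s ∈ Finset.Icc t s₂, E.gap s a - ∑ s ∈ Finset.Icc t s₂, E.gap s a'
      ≤ ∑ s ∈ Finset.Icc t s₂, R.meanEst E s a' a := by
    rw [← Finset.sum_sub_distrib]
    refine Finset.sum_le_sum fun s hs => ?_
    have hs := Finset.mem_Icc.1 hs
    rw [E.gap_sub_gap, Run.meanEst, if_pos (hcand s hs.1 hs.2)]
    split_ifs
    · exact le_rfl
    · linarith [E.mean_nonneg s a]
  have hC0 : 0 ≤ C₀ := by
    by_contra h
    rw [Real.sqrt_eq_zero_of_nonpos (by linarith)] at hC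
    norm_num at hC
  rw [Real.sqrt_mul hC0]
  set X : ℝ := max ((K : ℝ) * ((s₂ : ℝ) - (t : ℝ))) ((K : ℝ) ^ 2) with hX
  have hL := half_le_log hT
  have hK : (0 : ℝ) < K := by exact_mod_cast NeZero.pos K
  have hX0 : 0 < √X := Real.sqrt_pos.2 (lt_max_of_lt_right (by positivity))
  have hXle : √((K : ℝ) * ((s₂ : ℝ) - (t : ℝ))) ≤ √X := Real.sqrt_le_sqrt (le_max_left _ _)
  -- of the regret `(√C₀ + 23) * log T * √X`, fluctuations hide `20 * log T * √X` and the regret of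
  -- the safe arm less than `√X`, so that more than the eviction threshold is left
  nlinarith

theorem two_mul_sqrt_le {n l : ℝ} (hn : 0 ≤ n) (hl : 0 < l) : 2 * √n ≤ l * n + 1 / l := by
  have h1 : l * n + 1 / l - 2 * √n = (l * √n - 1) ^ 2 / l := by
    field_simp
    nlinarith [Real.sq_sqrt hn]
  have : 0 ≤ (l * √n - 1) ^ 2 / l := by positivity
  linarith

/-- A minimal interval `[x, z)` on which arm `a` has large regret supports many exposing replays:
all those of about its length that start in its first quarter. -/
theorem sqrt_le_exposing [NeZero K] (E : Environment K) {T : ℕ} (hT : 2 ≤ T) (S : Finset ℕ) {κ : ℝ}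
    (hκ : 16 ≤ κ) {u r x z : ℕ} (hu : u ≤ x) (hxz : x < z) (hzr : z ≤ r) (hr : r ≤ T) (a : Fin K)
    (hS : ∀ s ∈ S, ¬ (x < s ∧ s < z))
    (hbad : 2 * κ * Real.log T * √((K : ℝ) * ((z : ℝ) - x)) ≤ ∑ s ∈ Finset.Ico x z, E.gap s a)
    (hmin : ∀ y, x < y → y < z →
      ∑ s ∈ Finset.Ico x y, E.gap s a < 2 * κ * Real.log T * √((K : ℝ) * ((y : ℝ) - x))) :
    √((z : ℝ) - x) ≤ 12 * √((r : ℝ) - u) *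
      ∑ p ∈ exposing E T S κ u r a with x < p.1 ∧ p.1 < z, (replayProb u p.1 p.2 : ℝ) := by
  classical
  have hL := half_le_log hT
  have hK1 : 1 ≤ K := NeZero.one_le
  have hK : (1 : ℝ) ≤ K := by exact_mod_cast hK1
  obtain ⟨n, rfl⟩ : ∃ n, z = x + n := ⟨z - x, by omega⟩
  have hn0 : (0 : ℝ) ≤ n := Nat.cast_nonneg n
  have ezx : ((x + n : ℕ) : ℝ) - x = n := by push_cast; ring
  rw [ezx] at hbad ⊢
  have hκL : 8 ≤ κ * Real.log T := by nlinarith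
  -- the regret per round is at most one, so the interval is long
  have hlen : (256 : ℝ) * K ≤ n := by
    have h1 : ∑ s ∈ Finset.Ico x (x + n), E.gap s a ≤ n := by
      refine (Finset.sum_le_card_nsmul _ _ 1 fun s _ => E.gap_le_one s a).trans ?_
      simp
    have h2 : 16 * √((K : ℝ) * n) ≤ n := by
      have := mul_le_mul_of_nonneg_right hκL (Real.sqrt_nonneg ((K : ℝ) * n))
      linarith
    have hnpos : (0 : ℝ) < n := by
      have : 0 < n := by omega
      exact_mod_cast this
    have h3 : (16 * √((K : ℝ) * n)) ^ 2 ≤ (n : ℝ) ^ 2 := pow_le_pow_left₀ (by positivity) h2 2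
    rw [mul_pow, Real.sq_sqrt (by positivity)] at h3
    nlinarith
  have hlenN : 256 ≤ n := by
    have : (256 : ℝ) ≤ n := by linarith
    exact_mod_cast this
  have hKn : (K : ℝ) ≤ n := by linarith
  -- the shortest replay duration that covers the interval
  set m := 2 ^ Nat.clog 2 n with hm
  have hnm : n ≤ m := Nat.le_pow_clog (by norm_num) n
  have hmn : m < 2 * n := by
    have h1 : 2 ^ (Nat.clog 2 n - 1) < n := Nat.pow_pred_clog_lt_self (by norm_num) (by omega)
    have h2 : 0 < Nat.clog 2 n := Nat.clog_pos (by norm_num) (by omega)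
    have h3 : m = 2 * 2 ^ (Nat.clog 2 n - 1) := by
      rw [hm, ← pow_succ', Nat.sub_add_cancel h2]
    omega
  have hmem : m ∈ replayDurations T := by
    refine Finset.mem_image.2 ⟨_, Finset.mem_Icc.2 ⟨Nat.clog_pos (by norm_num) (by omega), ?_⟩, rfl⟩
    exact Nat.clog_mono_right 2 (by omega)
  -- by minimality, the first quarter of the interval carries at most half of the regret, so that a
  -- replay starting there still sees the other half
  have hsub : (Finset.Ioc x (x + n / 4)).image (fun t => (t, m))
      ⊆ (exposing E T S κ u r a).filter fun p => x < p.1 ∧ p.1 < x + n := by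
    intro p hp
    obtain ⟨t, ht, rfl⟩ := Finset.mem_image.1 hp
    rw [Finset.mem_Ioc] at ht
    rw [Finset.mem_filter, mem_exposing]
    refine ⟨⟨⟨by simp only; omega, by simp only; omega⟩, hmem, x + n - 1, by simp only; omega,
      by omega, by simp only; omega, fun s hs h => hS s hs (by simp only at h; omega), ?_⟩,
      by simp only; omega⟩
    simp only
    have e1 : Finset.Icc t (x + n - 1) = Finset.Ico t (x + n) := by
      ext i; simp only [Finset.mem_Icc, Finset.mem_Ico]; omega
    have e2 := Finset.sum_Ico_consecutive (fun s => E.gap s a) (show x ≤ t by omega)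
      (show t ≤ x + n by omega)
    have h1 := hmin t (by omega) (by omega)
    have htx : 4 * ((t : ℝ) - x) ≤ n := by
      have : 4 * t ≤ n + 4 * x := by omega
      have : (4 * t : ℝ) ≤ n + 4 * x := by exact_mod_cast this
      linarith
    have h2 : √((K : ℝ) * ((t : ℝ) - x)) ≤ √((K : ℝ) * n) / 2 := by
      rw [Real.sqrt_le_left (by positivity), div_pow, Real.sq_sqrt (by positivity)]
      nlinarith
    have h3 : √(max ((K : ℝ) * (((x + n - 1 : ℕ) : ℝ) - (t : ℝ))) ((K : ℝ) ^ 2))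
        ≤ √((K : ℝ) * n) := by
      refine Real.sqrt_le_sqrt (max_le ?_ (by nlinarith))
      refine mul_le_mul_of_nonneg_left ?_ (by linarith)
      have : x + n - 1 ≤ n + t := by omega
      have : ((x + n - 1 : ℕ) : ℝ) ≤ n + t := by exact_mod_cast this
      linarith
    have h4 := mul_le_mul_of_nonneg_left h3 (show 0 ≤ κ * Real.log T by linarith)
    have h5 := mul_le_mul_of_nonneg_left h2 (show 0 ≤ κ * Real.log T by linarith)
    rw [e1]
    linarith
  have hru : (0 : ℝ) < (r : ℝ) - u := by
    have : u < r := by omega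
    have : (u : ℝ) < r := by exact_mod_cast this
    linarith
  have hnpos : (0 : ℝ) < n := by linarith
  -- there are at least `n / 8` such starts, with `m ≤ 2 * n` and less than `r - u` rounds after `u`
  have hsum : (n : ℝ) / 8 * (1 / √(2 * n * ((r : ℝ) - u)))
      ≤ ∑ p ∈ exposing E T S κ u r a with x < p.1 ∧ p.1 < x + n, (replayProb u p.1 p.2 : ℝ) := by
    refine le_trans ?_ (Finset.sum_le_sum_of_subset_of_nonneg hsub
      fun p _ _ => (replayProb u p.1 p.2).2.1)
    rw [Finset.sum_image (fun s _ t _ h => (Prod.ext_iff.1 h).1)]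
    have hterm : ∀ t ∈ Finset.Ioc x (x + n / 4),
        1 / √(2 * n * ((r : ℝ) - u)) ≤ (replayProb u t m : ℝ) := by
      intro t ht
      rw [Finset.mem_Ioc] at ht
      change _ ≤ 1 / √((m : ℝ) * ((t - u : ℕ) : ℝ))
      have h1 : (0 : ℝ) < ((t - u : ℕ) : ℝ) := by
        have : 0 < t - u := by omega
        exact_mod_cast this
      have h2 : ((t - u : ℕ) : ℝ) ≤ (r : ℝ) - u := by
        rw [Nat.cast_sub (by omega)]
        have : t ≤ r := by omega
        have : (t : ℝ) ≤ r := by exact_mod_cast this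
        linarith
      have h3 : (0 : ℝ) < m := by
        have : 0 < m := by omega
        exact_mod_cast this
      have h4 : (m : ℝ) ≤ 2 * n := by exact_mod_cast hmn.le
      refine one_div_le_one_div_of_le (Real.sqrt_pos.2 (mul_pos h3 h1)) (Real.sqrt_le_sqrt ?_)
      exact mul_le_mul h4 h2 h1.le (by linarith)
    have h1 := Finset.card_nsmul_le_sum _ _ _ hterm
    refine le_trans ?_ h1
    rw [Nat.card_Ioc, nsmul_eq_mul, Nat.add_sub_cancel_left]
    refine mul_le_mul_of_nonneg_right ?_ (by positivity)
    have : n ≤ 8 * (n / 4) := by omega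
    have : (n : ℝ) ≤ 8 * ((n / 4 : ℕ) : ℝ) := by exact_mod_cast this
    linarith
  refine le_trans ?_ (mul_le_mul_of_nonneg_left hsum (by positivity))
  have hsn : 0 < √(n : ℝ) := Real.sqrt_pos.2 hnpos
  have hsr : 0 < √((r : ℝ) - u) := Real.sqrt_pos.2 hru
  rw [Real.sqrt_mul (by positivity), Real.sqrt_mul (by positivity)]
  have h2 : 0 < √(2 : ℝ) := by positivity
  have h2' : √(2 : ℝ) ≤ 3 / 2 := by
    rw [Real.sqrt_le_left (by norm_num)]; norm_num
  have e : 12 * √((r : ℝ) - u) * ((n : ℝ) / 8 * (1 / (√2 * √(n : ℝ) * √((r : ℝ) - u))))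
      = √(n : ℝ) * (3 / 2 / √2) := by
    have : (n : ℝ) = √(n : ℝ) * √(n : ℝ) := (Real.mul_self_sqrt hn0).symm
    field_simp
    nlinarith
  rw [e]
  refine le_mul_of_one_le_right hsn.le ?_
  rw [le_div_iff₀ h2]
  linarith

/-- Cutting `[x, r)` greedily into minimal intervals of large regret, and at the points of `S`,
bounds the regret of an arm by the expected number of exposing replays. -/
theorem sum_gap_le_exposing [NeZero K] (E : Environment K) {T : ℕ} (hT : 2 ≤ T) (S : Finset ℕ)
    {κ : ℝ} (hκ : 16 ≤ κ) {l : ℝ} (hl : 0 < l) {u r : ℕ} (hr : r ≤ T) (a : Fin K) (x : ℕ)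
    (hu : u ≤ x) (hxr : x ≤ r) :
    ∑ s ∈ Finset.Ico x r, E.gap s a
      ≤ 2 * κ * Real.log T * √K *
          (l * ((r : ℝ) - x) + (1 + ((S.filter fun s => x < s ∧ s < r).card : ℝ)) / l)
        + 48 * κ * Real.log T * √K * √((r : ℝ) - u) *
          ∑ p ∈ exposing E T S κ u r a with x < p.1, (replayProb u p.1 p.2 : ℝ) := by
  classical
  have hL := half_le_log hT
  have hκL : 8 ≤ κ * Real.log T := by nlinarith
  have hK : (1 : ℝ) ≤ K := by exact_mod_cast (NeZero.one_le : 1 ≤ K)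
  have hsK : 0 < √(K : ℝ) := by positivity
  induction hd : r - x using Nat.strong_induction_on generalizing x with
  | _ d ih =>
  have hq : ∀ q : ℕ × ℕ, (0 : ℝ) ≤ (replayProb u q.1 q.2 : ℝ) := fun q => (replayProb u q.1 q.2).2.1
  have hxr' : (0 : ℝ) ≤ (r : ℝ) - x := by
    have : (x : ℝ) ≤ r := by exact_mod_cast hxr
    linarith
  have hW0 : ∀ y : ℕ, 0 ≤ ∑ p ∈ exposing E T S κ u r a with y < p.1, (replayProb u p.1 p.2 : ℝ) :=
    fun y => Finset.sum_nonneg fun q _ => hq q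
  rcases hxr.eq_or_lt with rfl | hlt
  · rw [Finset.Ico_self, Finset.sum_empty]
    have := hW0 x
    have h1 : 0 ≤ 2 * (κ * Real.log T) * √K := by positivity
    have h2 : 0 ≤ 48 * (κ * Real.log T) * √K * √((x : ℝ) - u) := by positivity
    have h3 : 0 ≤ l * ((x : ℝ) - x)
      + (1 + ((S.filter fun s => x < s ∧ s < x).card : ℝ)) / l := by
      simp only [sub_self, mul_zero]; positivity
    have := mul_nonneg h1 h3
    have := mul_nonneg h2 (hW0 x)
    nlinarith
  -- the next point of `S`, or `r`
  obtain ⟨y, hxy, hyr, hyS, hyS'⟩ : ∃ y, x < y ∧ y ≤ r ∧ (∀ s ∈ S, ¬ (x < s ∧ s < y)) ∧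
      (y = r ∨ y ∈ S) := by
    by_cases h : ((S.filter fun s => x < s ∧ s < r)).Nonempty
    · obtain ⟨y, hy, hmin⟩ := Finset.exists_min_image _ id h
      have hmem := Finset.mem_filter.1 hy
      refine ⟨y, hmem.2.1, hmem.2.2.le, fun s hs hs' => ?_, Or.inr hmem.1⟩
      have := hmin s
        (Finset.mem_filter.2 (And.intro hs (And.intro hs'.1 (hs'.2.trans hmem.2.2))))
      simp only [id] at this
      omega
    · refine ⟨r, hlt, le_rfl, fun s hs hs' => h ⟨s, Finset.mem_filter.2 ⟨hs, hs'⟩⟩, Or.inl rfl⟩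
  -- cut where the regret first becomes large, or at `y` if it never does
  by_cases hb : ∃ z, x < z ∧ z ≤ y ∧
      2 * κ * Real.log T * √((K : ℝ) * ((z : ℝ) - x)) ≤ ∑ s ∈ Finset.Ico x z, E.gap s a
  · obtain ⟨hxz, hzy, hbad⟩ := Nat.find_spec hb
    set z := Nat.find hb
    have hmin : ∀ w, x < w → w < z →
        ∑ s ∈ Finset.Ico x w, E.gap s a < 2 * κ * Real.log T * √((K : ℝ) * ((w : ℝ) - x)) := by
      intro w h1 h2
      have := Nat.find_min hb h2
      push Not at this
      exact this h1 (by omega)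
    have hmass := sqrt_le_exposing E hT S hκ hu hxz (hzy.trans hyr) hr a
      (fun s hs h => hyS s hs ⟨h.1, by omega⟩) hbad hmin
    have hih := ih (r - z) (by omega) z (by omega) (by omega) rfl
    rw [← Finset.sum_Ico_consecutive _ hxz.le (hzy.trans hyr)]
    have hzx1 : (1 : ℝ) ≤ (z : ℝ) - x := by
      have : x + 1 ≤ z := hxz
      have : (x + 1 : ℝ) ≤ z := by exact_mod_cast this
      linarith
    -- minimality, and a gap of at most one in the last round
    have hupper : ∑ s ∈ Finset.Ico x z, E.gap s a
        ≤ 4 * (κ * Real.log T) * (√K * √((z : ℝ) - x)) := by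
      obtain ⟨z', hz'⟩ : ∃ z', z = z' + 1 := ⟨z - 1, by omega⟩
      have h1 : ∑ s ∈ Finset.Ico x z', E.gap s a
          ≤ 2 * (κ * Real.log T) * (√K * √((z : ℝ) - x)) := by
        rcases Nat.lt_or_ge x z' with h | h
        · refine (hmin z' h (by omega)).le.trans ?_
          rw [Real.sqrt_mul (by linarith)]
          have : √((z' : ℝ) - x) ≤ √((z : ℝ) - x) := by
            refine Real.sqrt_le_sqrt ?_
            rw [hz']; push_cast; linarith
          have h2 := mul_le_mul_of_nonneg_left this hsK.le
          have := mul_le_mul_of_nonneg_left h2 (show 0 ≤ κ * Real.log T by linarith)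
          linarith
        · rw [Finset.Ico_eq_empty (by omega), Finset.sum_empty]
          positivity
      rw [hz', Finset.sum_Ico_succ_top (by omega), ← hz']
      have h3 := E.gap_le_one z' a
      have h4 : 1 ≤ √(K : ℝ) * √((z : ℝ) - x) := by
        have h5 : 1 ≤ √(K : ℝ) := Real.one_le_sqrt.2 hK
        have h6 : 1 ≤ √((z : ℝ) - x) := Real.one_le_sqrt.2 hzx1
        nlinarith
      nlinarith
    have hcard : ((S.filter fun s => z < s ∧ s < r).card : ℝ)
        ≤ ((S.filter fun s => x < s ∧ s < r).card : ℝ) := by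
      refine Nat.cast_le.2 (Finset.card_le_card fun s hs => ?_)
      rw [Finset.mem_filter] at hs ⊢
      exact ⟨hs.1, by omega⟩
    have hWsplit : (∑ p ∈ exposing E T S κ u r a with x < p.1 ∧ p.1 < z,
          (replayProb u p.1 p.2 : ℝ))
        + ∑ p ∈ exposing E T S κ u r a with z < p.1, (replayProb u p.1 p.2 : ℝ)
        ≤ ∑ p ∈ exposing E T S κ u r a with x < p.1, (replayProb u p.1 p.2 : ℝ) := by
      rw [← Finset.sum_union]
      · refine Finset.sum_le_sum_of_subset_of_nonneg ?_ fun q _ _ => hq q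
        intro q hq
        simp only [Finset.mem_union, Finset.mem_filter] at hq ⊢
        rcases hq with h | h
        · exact ⟨h.1, h.2.1⟩
        · exact ⟨h.1, by omega⟩
      · rw [Finset.disjoint_left]
        intro q h1 h2
        rw [Finset.mem_filter] at h1 h2
        omega
    have hlin : l * ((r : ℝ) - z) + (1 + ((S.filter fun s => z < s ∧ s < r).card : ℝ)) / l
        ≤ l * ((r : ℝ) - x) + (1 + ((S.filter fun s => x < s ∧ s < r).card : ℝ)) / l := by
      have h1 : l * ((r : ℝ) - z) ≤ l * ((r : ℝ) - x) :=
        mul_le_mul_of_nonneg_left (by linarith) hl.le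
      have h2 := div_le_div_of_nonneg_right (add_le_add_right hcard 1) hl.le
      linarith
    have g1 := mul_le_mul_of_nonneg_left hlin (show 0 ≤ 2 * (κ * Real.log T) * √K by positivity)
    have g2 := mul_le_mul_of_nonneg_left hmass
      (show 0 ≤ 4 * (κ * Real.log T) * √(K : ℝ) by positivity)
    have g3 := mul_le_mul_of_nonneg_left hWsplit
      (show 0 ≤ 48 * (κ * Real.log T) * √K * √((r : ℝ) - u) by positivity)
    linarith
  · push Not at hb
    have h1 := (hb y hxy le_rfl).le
    rw [Real.sqrt_mul (by linarith)] at h1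
    have hyx : (0 : ℝ) ≤ (y : ℝ) - x := by
      have : (x : ℝ) < y := by exact_mod_cast hxy
      linarith
    have h2 := two_mul_sqrt_le hyx hl
    have h0 := Real.sqrt_nonneg ((y : ℝ) - x)
    have h3 : ∑ s ∈ Finset.Ico x y, E.gap s a
        ≤ 2 * (κ * Real.log T) * √K * (l * ((y : ℝ) - x) + 1 / l) := by
      have := mul_le_mul_of_nonneg_left (show √((y : ℝ) - x) ≤ l * ((y : ℝ) - x) + 1 / l by linarith)
        (show 0 ≤ 2 * (κ * Real.log T) * √K by positivity)
      linarith
    rcases hyr.eq_or_lt with hyr' | hyr'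
    · have h4 := mul_nonneg (show 0 ≤ 48 * (κ * Real.log T) * √K * √((r : ℝ) - u) by positivity)
        (hW0 x)
      have hN : (0 : ℝ) ≤ ((S.filter fun s => x < s ∧ s < r).card : ℝ) := Nat.cast_nonneg _
      have h5 : 1 / l ≤ (1 + ((S.filter fun s => x < s ∧ s < r).card : ℝ)) / l :=
        div_le_div_of_nonneg_right (by linarith) hl.le
      rw [hyr'] at h3
      have h6 := mul_le_mul_of_nonneg_left (add_le_add_right h5 (l * ((r : ℝ) - x)))
        (show 0 ≤ 2 * (κ * Real.log T) * √K by positivity)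
      linarith
    · have hyS' := hyS'.resolve_left hyr'.ne
      have hih := ih (r - y) (by omega) y (by omega) (by omega) rfl
      rw [← Finset.sum_Ico_consecutive _ hxy.le hyr]
      have hcard : ((S.filter fun s => y < s ∧ s < r).card : ℝ) + 1
          ≤ ((S.filter fun s => x < s ∧ s < r).card : ℝ) := by
        have : (S.filter fun s => y < s ∧ s < r).card < (S.filter fun s => x < s ∧ s < r).card := by
          refine Finset.card_lt_card (Finset.ssubset_iff_of_subset ?_ |>.2 ⟨y, ?_, ?_⟩)
          · intro i hi
            rw [Finset.mem_filter] at hi ⊢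
            exact ⟨hi.1, by omega⟩
          · exact Finset.mem_filter.2 ⟨hyS', by omega⟩
          · exact fun hm => absurd (Finset.mem_filter.1 hm).2 (by omega)
        exact_mod_cast this
      have hWle : ∑ p ∈ exposing E T S κ u r a with y < p.1, (replayProb u p.1 p.2 : ℝ)
          ≤ ∑ p ∈ exposing E T S κ u r a with x < p.1, (replayProb u p.1 p.2 : ℝ) := by
        refine Finset.sum_le_sum_of_subset_of_nonneg ?_ fun q _ _ => hq q
        intro q hq
        rw [Finset.mem_filter] at hq ⊢
        exact ⟨hq.1, by omega⟩
      have g1 := mul_le_mul_of_nonneg_left hWle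
        (show 0 ≤ 48 * (κ * Real.log T) * √K * √((r : ℝ) - u) by positivity)
      have h7 : 1 / l + (1 + ((S.filter fun s => y < s ∧ s < r).card : ℝ)) / l
          ≤ (1 + ((S.filter fun s => x < s ∧ s < r).card : ℝ)) / l := by
        rw [← add_div]
        exact div_le_div_of_nonneg_right (by linarith) hl.le
      have g2 := mul_le_mul_of_nonneg_left h7 (show 0 ≤ 2 * (κ * Real.log T) * √K by positivity)
      linarith

/-- The regret of an arm that is not evicted from an episode. -/
theorem Run.Valid.sum_gap_survivor_le [NeZero K] {C₀ : ℝ} {T : ℕ} {bit : ℕ → ℕ → ℕ → Bool}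
    {R : Run K} (hR : R.Valid C₀ T bit) {E : Environment K} {S : Finset ℕ} (hT : 2 ≤ T)
    (hC : 22 ≤ √C₀) (hconc : R.Concentrated E T) (hS : Hitting E T S)
    (hbits : ReplaysOccur E T S (√C₀ + 23) bit) {l : ℝ} (hl : 0 < l) {v r : ℕ} (hv1 : 1 ≤ v)
    (hv : v ≤ T) (hur : R.ep v ≤ r) (hrv : r ≤ v) {a : Fin K}
    (ha : a ∉ evicted C₀ T R.obs (R.ep v) r) :
    ∑ s ∈ Finset.Ico (R.ep v) r, E.gap s a
      ≤ 1000 * (√C₀ + 23) * Real.log T ^ 2 * √K *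
          (l * ((r : ℝ) - R.ep v)
            + (1 + ((S.filter fun s => R.ep v < s ∧ s < r).card : ℝ)) / l) := by
  classical
  have hL := half_le_log hT
  have hW : ∑ p ∈ exposing E T S (√C₀ + 23) (R.ep v) r a,
      (replayProb (R.ep v) p.1 p.2 : ℝ) ≤ 10 * Real.log T := by
    rcases hbits a (R.ep v) r (hR.one_le_ep v hv1 hv) ((hR.ep_le hv1 hv).trans hv) (by omega)
      with h | ⟨p, hp, hbit⟩
    · exact h
    · exact absurd hbit (hR.not_bit_of_exposing hT hC hconc hS hv1 hv hrv ha hp)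
  have h1 := sum_gap_le_exposing E hT S (κ := √C₀ + 23) (by linarith) hl (u := R.ep v) (r := r)
    (by omega) a (R.ep v) le_rfl hur
  have h2 : ∑ p ∈ exposing E T S (√C₀ + 23) (R.ep v) r a with R.ep v < p.1,
      (replayProb (R.ep v) p.1 p.2 : ℝ) ≤ 10 * Real.log T :=
    (Finset.sum_le_sum_of_subset_of_nonneg (Finset.filter_subset _ _)
      fun q _ _ => (replayProb (R.ep v) q.1 q.2).2.1).trans hW
  have hn : (0 : ℝ) ≤ (r : ℝ) - R.ep v := by
    have : (R.ep v : ℝ) ≤ r := by exact_mod_cast hur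
    linarith
  have h3 := two_mul_sqrt_le hn hl
  set N : ℝ := ((S.filter fun s => R.ep v < s ∧ s < r).card : ℝ)
  have hN : 0 ≤ N := Nat.cast_nonneg _
  set Q := l * ((r : ℝ) - R.ep v) + (1 + N) / l with hQ
  have h4 : 1 / l ≤ (1 + N) / l := div_le_div_of_nonneg_right (by linarith) hl.le
  have h5 : 2 * √((r : ℝ) - R.ep v) ≤ Q := by linarith
  have hQ0 : 0 ≤ Q := le_trans (by positivity) h5
  have h6 : √((r : ℝ) - R.ep v) *
      (∑ p ∈ exposing E T S (√C₀ + 23) (R.ep v) r a with R.ep v < p.1,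
        (replayProb (R.ep v) p.1 p.2 : ℝ)) ≤ (Q / 2) * (10 * Real.log T) :=
    mul_le_mul (by linarith) h2 (Finset.sum_nonneg fun q _ => (replayProb (R.ep v) q.1 q.2).2.1)
      (by positivity)
  have hκ : 0 ≤ (√C₀ + 23) * Real.log T * √K := by positivity
  have h7 := mul_le_mul_of_nonneg_left h6 (show 0 ≤ 48 * ((√C₀ + 23) * Real.log T * √K) by positivity)
  have h8 : 2 * ((√C₀ + 23) * Real.log T * √K) * Q
      ≤ 4 * Real.log T * ((√C₀ + 23) * Real.log T * √K) * Q := by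
    refine mul_le_mul_of_nonneg_right (mul_le_mul_of_nonneg_right ?_ hκ) hQ0
    linarith
  have h9 : 0 ≤ Real.log T * ((√C₀ + 23) * Real.log T * √K) * Q := by positivity
  nlinarith

end

section

variable {K : ℕ}

/-! ### Nested base algorithms -/

/-- The active rounds of nested intervals. On the rounds `[u, v]`, a new interval `[g, e g]` starts
at each `g` with `top g = g`, and `top t` is the start of the latest interval containing `t`. -/
structure IsNest (u v : ℕ) (top e : ℕ → ℕ) : Prop where
  le_top : ∀ t, u ≤ t → t ≤ v → u ≤ top t
  top_le : ∀ t, u ≤ t → t ≤ v → top t ≤ t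
  top_top : ∀ t, u ≤ t → t ≤ v → top (top t) = top t
  le_end : ∀ t, u ≤ t → t ≤ v → t ≤ e (top t)
  latest : ∀ s t, u ≤ s → s ≤ t → t ≤ v → top s = s → t ≤ e s → s ≤ top t

/-- Round `t` belongs to the part of `[g, e g]` before the start of a later interval that ends no
earlier. After such a start the interval of `g` is never the latest one again. -/
def InLife (top e : ℕ → ℕ) (g t : ℕ) : Prop :=
  g ≤ t ∧ t ≤ e g ∧ ∀ g', top g' = g' → g < g' → g' ≤ t → e g' < e g

/-- `j` is the last start before `g` of an interval that ends after the one of `g`. -/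
def IsChild (top e : ℕ → ℕ) (j g : ℕ) : Prop :=
  j < g ∧ e g < e j ∧ ∀ g', top g' = g' → j < g' → g' < g → e g' ≤ e g

namespace IsNest

variable {u v : ℕ} {top e : ℕ → ℕ}

open Classical in
/-- The rounds at which the interval of `j` is the latest one are its life, minus the disjoint lives
of its children. -/
theorem ite_life_eq (h : IsNest u v top e) {j t : ℕ} (hj : u ≤ j) (hjt : top j = j)
    (htu : u ≤ t) (htv : t ≤ v) (x : ℝ) :
    (if InLife top e j t then x else 0) = (if top t = j then x else 0) +
      ∑ g ∈ Finset.Icc u v with top g = g ∧ IsChild top e j g,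
        (if InLife top e g t then x else 0) := by
  have htop_le := h.top_le t htu htv
  have hle_top := h.le_top t htu htv
  have htt := h.top_top t htu htv
  have hend := h.le_end t htu htv
  -- children that live at `t` show that `j` lives but is not the latest
  have hchild : ∀ g, IsChild top e j g → top g = g → InLife top e g t →
      InLife top e j t ∧ top t ≠ j := by
    intro g hg hgt hgl
    refine ⟨⟨hg.1.le.trans hgl.1, hgl.2.1.trans hg.2.1.le, fun g' h1 h2 h3 => ?_⟩, ?_⟩
    · rcases lt_trichotomy g' g with h4 | h4 | h4
      · exact (hg.2.2 g' h1 h2 h4).trans_lt hg.2.1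
      · rw [h4]; exact hg.2.1
      · exact (hgl.2.2 g' h1 h4 h3).trans hg.2.1
    · have := h.latest g t (hj.trans hg.1.le) hgl.1 htv hgt hgl.2.1
      have := hg.1
      omega
  by_cases hl : InLife top e j t
  · by_cases hjt' : top t = j
    · rw [if_pos hl, if_pos hjt', Finset.sum_eq_zero, add_zero]
      intro g hg
      rw [Finset.mem_filter] at hg
      rw [if_neg fun hgl => (hchild g hg.2.2 hg.2.1 hgl).2 hjt']
    · have hjlt : j < top t := lt_of_le_of_ne (h.latest j t hj hl.1 htv hjt hl.2.1) (Ne.symm hjt')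
      -- the start of the latest longest interval above `j` is the child that lives at `t`
      obtain ⟨g, hg, hmax⟩ := Finset.exists_max_image
        ((Finset.Icc u t).filter fun g => top g = g ∧ j < g ∧ t ≤ e g)
        (fun g => toLex (e g, g))
        ⟨top t, Finset.mem_filter.2 ⟨Finset.mem_Icc.2 ⟨hle_top, htop_le⟩, htt, hjlt, hend⟩⟩
      obtain ⟨hg1, hgtop, hjg, htg⟩ := Finset.mem_filter.1 hg
      rw [Finset.mem_Icc] at hg1
      have hmax' : ∀ g', top g' = g' → j < g' → g' ≤ t → e g' ≤ e g ∧ (g < g' → e g' < e g) := by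
        intro g' h1 h2 h3
        by_cases h4 : t ≤ e g'
        · have := hmax g' (Finset.mem_filter.2
            ⟨Finset.mem_Icc.2 ⟨by omega, h3⟩, h1, h2, h4⟩)
          rw [Prod.Lex.toLex_le_toLex] at this
          simp only at this
          omega
        · omega
      have hgc : IsChild top e j g :=
        ⟨hjg, hl.2.2 g hgtop hjg hg1.2, fun g' h1 h2 h3 => (hmax' g' h1 h2 (by omega)).1⟩
      have hgl : InLife top e g t :=
        ⟨hg1.2, htg, fun g' h1 h2 h3 => (hmax' g' h1 (by omega) h3).2 h2⟩
      rw [if_pos hl, if_neg hjt', zero_add, Finset.sum_eq_single g]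
      · rw [if_pos hgl]
      · intro g' hg' hne
        rw [Finset.mem_filter] at hg'
        rw [if_neg]
        intro hgl'
        obtain ⟨-, h1, h2⟩ := hg'
        rcases lt_or_gt_of_ne hne with h3 | h3
        · have a1 := hgl'.2.2 g hgtop h3 hgl.1
          have a2 := hgc.2.2 g' h1 h2.1 h3
          have a3 := (hmax' g' h1 h2.1 hgl'.1).2
          have := h2.2.2
          have a4 := hgl.2.2
          omega
        · have a1 := hgl.2.2 g' h1 h3 hgl'.1
          have a2 := h2.2.2 g hgtop hjg h3
          omega
      · intro hn
        exact absurd (Finset.mem_filter.2 ⟨Finset.mem_Icc.2 ⟨by omega, by omega⟩, hgtop, hgc⟩) hn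
  · rw [if_neg hl]
    have : top t ≠ j := by
      intro hjt'
      refine hl ⟨by omega, by rw [← hjt']; exact hend, fun g' h1 h2 h3 => ?_⟩
      by_contra h4
      rw [hjt'] at hend
      have := h.latest g' t (by omega) h3 htv h1 (by omega)
      omega
    rw [if_neg this, zero_add, Finset.sum_eq_zero]
    intro g hg
    rw [Finset.mem_filter] at hg
    rw [if_neg fun hgl => hl (hchild g hg.2.2 hg.2.1 hgl).1]

open Classical in
/-- A sum over the rounds at which the interval of `j` is the latest one, which may be scattered, as a
difference of sums over lives, which are intervals of rounds. -/
theorem sum_top_eq (h : IsNest u v top e) {j : ℕ} (hj : u ≤ j) (hjt : top j = j) (D : Finset ℕ)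
    (hD : ∀ t ∈ D, u ≤ t ∧ t ≤ v) (x : ℕ → ℝ) :
    ∑ t ∈ D with top t = j, x t = ∑ t ∈ D with InLife top e j t, x t
      - ∑ g ∈ Finset.Icc u v with top g = g ∧ IsChild top e j g,
          ∑ t ∈ D with InLife top e g t, x t := by
  simp only [Finset.sum_filter (s := D)]
  rw [Finset.sum_comm, ← Finset.sum_sub_distrib]
  refine Finset.sum_congr rfl fun t ht => ?_
  rw [h.ite_life_eq hj hjt (hD t ht).1 (hD t ht).2]
  ring

open Classical in
/-- Every interval is the child of at most one other. -/
theorem sum_child_le (F : ℕ → ℝ) (hF : ∀ g, 0 ≤ F g) :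
    ∑ j ∈ Finset.Icc u v with top j = j,
      ∑ g ∈ Finset.Icc u v with top g = g ∧ IsChild top e j g, F g
      ≤ ∑ g ∈ Finset.Icc u v with top g = g, F g := by
  have e1 : ∀ j, ∑ g ∈ Finset.Icc u v with top g = g ∧ IsChild top e j g, F g
      = ∑ g ∈ Finset.Icc u v with top g = g, if IsChild top e j g then F g else 0 := by
    intro j
    rw [← Finset.sum_filter, Finset.filter_filter]
  simp only [e1]
  rw [Finset.sum_comm]
  refine Finset.sum_le_sum fun g hg => ?_
  rw [← Finset.sum_filter, Finset.sum_const, nsmul_eq_mul]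
  have hc : ((((Finset.Icc u v).filter fun j => top j = j).filter fun j =>
      IsChild top e j g).card : ℝ) ≤ 1 := by
    rw [← Nat.cast_one, Nat.cast_le, Finset.card_le_one]
    intro j hj j' hj'
    simp only [Finset.mem_filter] at hj hj'
    by_contra hne
    rcases lt_or_gt_of_ne hne with h1 | h1
    · have a1 := hj.2.2.2 j' hj'.1.2 h1 hj'.2.1
      have a2 := hj'.2.2.1
      omega
    · have a1 := hj'.2.2.2 j hj.1.2 h1 hj.2.1
      have a2 := hj.2.2.1
      omega
  exact mul_le_of_le_one_left (hF g) hc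

end IsNest

/-! ### Regret to an arm that survives an episode -/

namespace Run.Valid

variable {C₀ : ℝ} {T : ℕ} {bit : ℕ → ℕ → ℕ → Bool} {R : Run K}

theorem isNest (hR : R.Valid C₀ T bit) {v : ℕ} (hv1 : 1 ≤ v) (hv : v ≤ T) :
    IsNest (R.ep v) v R.top fun g => g + R.dur g := by
  have h1 := hR.one_le_ep v hv1 hv
  have hep : ∀ t, R.ep v ≤ t → t ≤ v → R.ep t = R.ep v := fun t => hR.ep_eq hv1 hv
  refine ⟨fun t ht ht' => ?_, fun t ht ht' => hR.top_le t (by omega) (by omega),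
    fun t ht ht' => hR.top_top t (by omega) (by omega),
    fun t ht ht' => hR.le_top_dur t (by omega) (by omega), fun s t hs hst ht' htop hd => ?_⟩
  · rw [← hep t ht ht']
    exact hR.ep_le_top t (by omega) (by omega)
  · exact hR.le_top s t (by omega) hst (by omega) (by rw [hep t (by omega) ht']; exact hs) htop hd

variable {v : ℕ} {a : Fin K}

theorem mem_cand_of_survivor (hR : R.Valid C₀ T bit) (hv1 : 1 ≤ v) (hv : v ≤ T)
    (ha : ∀ s, R.ep v ≤ s → s ≤ v → R.top s = s ∨ a ∉ evicted C₀ T R.obs (R.ep v) s)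
    {t : ℕ} (ht : R.ep v ≤ t) (htv : t ≤ v) : a ∈ R.cand t := by
  have h1 := hR.one_le_ep v hv1 hv
  rw [hR.cand_eq t (by omega) (by omega), Finset.mem_sdiff]
  refine ⟨Finset.mem_univ _, fun h => ?_⟩
  rcases ha t ht htv with h2 | h2
  · rw [h2, evicted_self] at h
    simp at h
  · exact h2 (evicted_mono ((hR.isNest hv1 hv).le_top t ht htv) le_rfl h)

theorem cand_subset (hR : R.Valid C₀ T bit) {s t : ℕ} (hs : 1 ≤ s) (hst : s ≤ t) (htT : t ≤ T)
    (htop : R.top t ≤ R.top s) : R.cand t ⊆ R.cand s := by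
  rw [hR.cand_eq t (by omega) htT, hR.cand_eq s hs (by omega)]
  exact Finset.sdiff_subset_sdiff le_rfl (evicted_mono htop hst)

/-- While arm `b` is a candidate of a base algorithm, its aggregate gap to a surviving arm is, in
absolute value, not much above the eviction threshold on any interval since the start of the base
algorithm: neither of the two arms has met the eviction criterion against the other. -/
theorem abs_sum_sub_le (hR : R.Valid C₀ T bit) [NeZero K] {E : Environment K} (hT : 2 ≤ T)
    (hC : 22 ≤ √C₀) (hconc : R.Concentrated E T) (hv1 : 1 ≤ v) (hv : v ≤ T)
    (ha : ∀ s, R.ep v ≤ s → s ≤ v → R.top s = s ∨ a ∉ evicted C₀ T R.obs (R.ep v) s)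
    {t : ℕ} (ht : R.ep v ≤ t) (htv : t ≤ v) {b : Fin K} (hb : b ∈ R.cand t) {x y : ℕ}
    (hx : R.top t ≤ x) (hxy : x ≤ y) (hy : y ≤ t) :
    |∑ s ∈ Finset.Ico x y, (E.mean s a - E.mean s b)|
      ≤ (√C₀ + 20) * Real.log T * √K * √((y - x : ℕ) : ℝ) := by
  have hL := half_le_log hT
  have hK : (1 : ℝ) ≤ K := by exact_mod_cast (NeZero.one_le : 1 ≤ K)
  have hΓ : 1 ≤ (√C₀ + 20) * Real.log T := by nlinarith
  obtain ⟨n, rfl⟩ : ∃ n, y = x + n := ⟨y - x, by omega⟩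
  rw [Nat.add_sub_cancel_left]
  have hn0 : (0 : ℝ) ≤ n := Nat.cast_nonneg n
  have hsn := Real.sqrt_nonneg (n : ℝ)
  have hsK := Real.sqrt_nonneg (K : ℝ)
  rcases le_or_gt n K with hnK | hnK
  · -- gaps are at most one, and `n ≤ √(K * n)`
    have h1 : |∑ s ∈ Finset.Ico x (x + n), (E.mean s a - E.mean s b)| ≤ n := by
      refine (Finset.abs_sum_le_sum_abs _ _).trans
        ((Finset.sum_le_card_nsmul _ _ 1 fun s _ => ?_).trans (by simp))
      rw [abs_le]
      constructor <;>
        linarith [E.mean_nonneg s a, E.mean_le_one s a, E.mean_nonneg s b, E.mean_le_one s b]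
    have h2 : √(n : ℝ) ≤ √(K : ℝ) := Real.sqrt_le_sqrt (by exact_mod_cast hnK)
    have h3 : (n : ℝ) = √(n : ℝ) * √(n : ℝ) := (Real.mul_self_sqrt hn0).symm
    have h4 : (n : ℝ) ≤ √(K : ℝ) * √(n : ℝ) := by
      rw [h3]
      refine (mul_le_mul_of_nonneg_right h2 hsn).trans_eq ?_
      rw [Real.sqrt_mul_self hsn]
    have h5 : √(K : ℝ) * √(n : ℝ) ≤ (√C₀ + 20) * Real.log T * (√(K : ℝ) * √(n : ℝ)) :=
      le_mul_of_one_le_left (by positivity) hΓ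
    linarith
  · have hK1 : 1 ≤ K := NeZero.one_le
    have h1 := hR.one_le_ep v hv1 hv
    have hnest := hR.isNest hv1 hv
    set j := R.top t with hj
    have hju := hnest.le_top t ht htv
    have hjt := hnest.top_le t ht htv
    have ha' : a ∉ evicted C₀ T R.obs (R.ep v) t := by
      rcases ha t ht htv with h | h
      · omega
      · exact h
    have hb' : b ∉ evicted C₀ T R.obs j t := by
      rw [hR.cand_eq t (by omega) (by omega)] at hb
      exact (Finset.mem_sdiff.1 hb).2
    have hbc : ∀ s, x ≤ s → s < x + n → b ∈ R.cand s := by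
      intro s hs hs'
      refine hR.cand_subset (by omega) (by omega) (by omega) ?_ hb
      have hend : t ≤ j + R.dur j := hnest.le_end t ht htv
      exact hnest.latest j s hju (by omega) (by omega) (hnest.top_top t ht htv)
        (show s ≤ j + R.dur j by omega)
    have hac : ∀ s, x ≤ s → s < x + n → a ∈ R.cand s := fun s hs hs' =>
      hR.mem_cand_of_survivor hv1 hv ha (by omega) (by omega)
    have e1 : Finset.Ico x (x + n) = Finset.Icc x (x + n - 1) := by
      ext i; simp only [Finset.mem_Icc, Finset.mem_Ico]; omega
    rw [e1]
    have hC0 : 0 ≤ C₀ := by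
      by_contra h
      rw [Real.sqrt_eq_zero_of_nonpos (by linarith)] at hC
      norm_num at hC
    set X : ℝ := max ((K : ℝ) * (((x + n - 1 : ℕ) : ℝ) - (x : ℝ))) ((K : ℝ) ^ 2) with hX
    have hXle : √X ≤ √K * √(n : ℝ) := by
      rw [← Real.sqrt_mul (by linarith)]
      refine Real.sqrt_le_sqrt (max_le ?_ ?_)
      · refine mul_le_mul_of_nonneg_left ?_ (by linarith)
        have : x + n - 1 ≤ n + x := by omega
        have : ((x + n - 1 : ℕ) : ℝ) ≤ n + x := by exact_mod_cast this
        linarith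
      · rw [sq]
        exact mul_le_mul_of_nonneg_left (by exact_mod_cast hnK.le) (by linarith)
    have hnot : ∀ {c c' : Fin K} {w : ℕ}, w ≤ x → c ∉ evicted C₀ T R.obs w t →
        ∑ s ∈ Finset.Icc x (x + n - 1), (R.obs s).gapEst c' c ≤ Real.log T * (√C₀ * √X) := by
      intro c c' w hw hc
      by_contra hlt
      push Not at hlt
      rw [← Real.sqrt_mul hC0] at hlt
      exact hc (mem_evicted.2 ⟨x, x + n - 1, hw, by omega, by omega, c', hlt⟩)
    have c1 := (abs_le.1 (hconc a b x (x + n - 1) (by omega) (by omega) (by omega))).1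
    have c2 := (abs_le.1 (hconc b a x (x + n - 1) (by omega) (by omega) (by omega))).1
    rw [Finset.sum_sub_distrib] at c1 c2
    have m1 : ∑ s ∈ Finset.Icc x (x + n - 1), R.meanEst E s a b
        = ∑ s ∈ Finset.Icc x (x + n - 1), (E.mean s a - E.mean s b) := by
      refine Finset.sum_congr rfl fun s hs => ?_
      rw [Finset.mem_Icc] at hs
      rw [Run.meanEst, if_pos (hac s hs.1 (by omega)), if_pos (hbc s hs.1 (by omega))]
    have m2 : ∑ s ∈ Finset.Icc x (x + n - 1), R.meanEst E s b a
        = -∑ s ∈ Finset.Icc x (x + n - 1), (E.mean s a - E.mean s b) := by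
      rw [← Finset.sum_neg_distrib]
      refine Finset.sum_congr rfl fun s hs => ?_
      rw [Finset.mem_Icc] at hs
      rw [Run.meanEst, if_pos (hac s hs.1 (by omega)), if_pos (hbc s hs.1 (by omega))]
      ring
    have d1 := hnot (c' := a) hx hb'
    have d2 := hnot (c' := b) (hju.trans hx) ha'
    have h5 := mul_le_mul_of_nonneg_left hXle (show 0 ≤ (√C₀ + 20) * Real.log T by linarith)
    rw [abs_le]
    constructor <;> linarith

open Classical in
/-- Regret of arm `b` to a surviving arm while it is a candidate of the base algorithm started at
`j`; the last such round is `θ`. The rounds this base algorithm plays are its life minus those of its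
children, so all tail sums are controlled, and Abel summation takes care of the shrinking candidate
set. -/
theorem sum_top_mul_le (hR : R.Valid C₀ T bit) [NeZero K] {E : Environment K} (hT : 2 ≤ T)
    (hC : 22 ≤ √C₀) (hconc : R.Concentrated E T) (hv1 : 1 ≤ v) (hv : v ≤ T)
    (ha : ∀ s, R.ep v ≤ s → s ≤ v → R.top s = s ∨ a ∉ evicted C₀ T R.obs (R.ep v) s)
    {j θ : ℕ} (hj : R.ep v ≤ j) (hjtop : R.top j = j) {b : Fin K}
    (hθv : θ ≤ v) (hθ : R.top θ = j) (hjθ : j ≤ θ) (hbθ : b ∈ R.cand θ)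
    (hmax : ∀ t, j ≤ t → t ≤ v → R.top t = j → b ∈ R.cand t → t ≤ θ) :
    ∑ t ∈ Finset.Icc j v with R.top t = j ∧ b ∈ R.cand t,
        (1 / ((R.cand t).card : ℝ)) * (E.mean t a - E.mean t b)
      ≤ 1 / ((R.cand θ).card : ℝ) * (1 + (√C₀ + 20) * Real.log T * √K *
          (√((min (R.dur j + 1) (v + 1 - R.ep v) : ℕ) : ℝ)
            + ∑ g ∈ Finset.Icc (R.ep v) v with R.top g = g ∧
                IsChild R.top (fun g => g + R.dur g) j g,
              √((min (R.dur g + 1) (v + 1 - R.ep v) : ℕ) : ℝ))) := by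
  have hL := half_le_log hT
  have h1 := hR.one_le_ep v hv1 hv
  have hnest := hR.isNest hv1 hv
  set e : ℕ → ℕ := fun g => g + R.dur g with he
  set x : ℕ → ℝ := fun t => E.mean t a - E.mean t b with hx
  set G := (√C₀ + 20) * Real.log T * √(K : ℝ) with hG
  have hG0 : 0 ≤ G := by positivity
  have hpos : ∀ t ∈ (Finset.Icc j v).filter (fun t => R.top t = j ∧ b ∈ R.cand t),
      j ≤ t ∧ t ≤ θ ∧ R.top t = j ∧ b ∈ R.cand t ∧ (0 : ℝ) < (R.cand t).card := by
    intro t ht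
    rw [Finset.mem_filter, Finset.mem_Icc] at ht
    refine ⟨ht.1.1, hmax t ht.1.1 ht.1.2 ht.2.1 ht.2.2, ht.2.1, ht.2.2, ?_⟩
    exact_mod_cast Finset.card_pos.2 ⟨b, ht.2.2⟩
  refine sum_mul_le_of_tail_le _ x _ (by positivity) (by positivity)
    (fun t _ => by positivity) ?_ ?_ ?_
  · intro t ht
    obtain ⟨g1, g2, g3, g4, g5⟩ := hpos t ht
    refine one_div_le_one_div_of_le ?_ ?_
    · exact_mod_cast Finset.card_pos.2 ⟨b, hbθ⟩
    · exact_mod_cast Finset.card_le_card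
        (hR.cand_subset (by omega) g2 (by omega) (by rw [g3, hθ]))
  · intro s hs t ht hst
    obtain ⟨g1, g2, g3, g4, g5⟩ := hpos t ht
    obtain ⟨k1, k2, k3, k4, k5⟩ := hpos s hs
    refine one_div_le_one_div_of_le g5 ?_
    exact_mod_cast Finset.card_le_card (hR.cand_subset (by omega) hst (by omega) (by rw [g3, k3]))
  · intro r hr
    obtain ⟨r1, r2, r3, r4, r5⟩ := hpos r hr
    -- the arm is a candidate at every round the base algorithm plays before `θ`
    have hset : ((Finset.Icc j v).filter (fun t => R.top t = j ∧ b ∈ R.cand t)).filter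
        (fun t => r ≤ t) = insert θ ((Finset.Ico r θ).filter fun t => R.top t = j) := by
      ext t
      simp only [Finset.mem_filter, Finset.mem_Icc, Finset.mem_insert, Finset.mem_Ico]
      constructor
      · rintro ⟨⟨⟨g1, g2⟩, g3, g4⟩, g5⟩
        have := hmax t g1 g2 g3 g4
        rcases this.eq_or_lt with h | h
        · exact Or.inl h
        · exact Or.inr ⟨⟨g5, h⟩, g3⟩
      · rintro (rfl | ⟨⟨g1, g2⟩, g3⟩)
        · exact ⟨⟨⟨hjθ, hθv⟩, hθ, hbθ⟩, r2⟩
        · exact ⟨⟨⟨by omega, by omega⟩, g3,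
            hR.cand_subset (by omega) g2.le (by omega) (by rw [g3, hθ]) hbθ⟩, g1⟩
    rw [hset, Finset.sum_insert (by simp), hnest.sum_top_eq hj hjtop _ (fun t ht => by
      rw [Finset.mem_Ico] at ht; omega)]
    -- a piece of a life is an interval, over which the gaps add up to little
    have hlife : ∀ g, |∑ t ∈ Finset.Ico r θ with InLife R.top e g t, x t|
        ≤ G * √((min (R.dur g + 1) (v + 1 - R.ep v) : ℕ) : ℝ) := by
      intro g
      obtain ⟨z, hz1, hz2, hz3⟩ := filter_Ico_eq_Ico (x := max r g) (y := θ) (InLife R.top e g)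
        (fun s t hs hst _ hP => ⟨by omega, hst.trans hP.2.1,
          fun g' k1 k2 k3 => hP.2.2 g' k1 k2 (k3.trans hst)⟩)
      have e1 : (Finset.Ico r θ).filter (InLife R.top e g) = Finset.Ico (max r g) z := by
        rw [← hz3]
        ext t
        simp only [Finset.mem_filter, Finset.mem_Ico]
        constructor
        · rintro ⟨k1, k2⟩; exact ⟨⟨max_le k1.1 k2.1, k1.2⟩, k2⟩
        · rintro ⟨k1, k2⟩; exact ⟨⟨(le_max_left _ _).trans k1.1, k1.2⟩, k2⟩
      rw [e1]
      rcases hz2.eq_or_lt with h | h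
      · rw [h, Finset.Ico_self, Finset.sum_empty, abs_zero]
        positivity
      · have hzm : z - 1 ∈ (Finset.Ico (max r g) θ).filter (InLife R.top e g) := by
          rw [hz3, Finset.mem_Ico]; omega
        obtain ⟨k1, k2⟩ := Finset.mem_filter.1 hzm
        rw [Finset.mem_Ico] at k1
        have k3 := k2.2.1
        simp only [he] at k3
        refine (hR.abs_sum_sub_le hT hC hconc hv1 hv ha (by omega) hθv hbθ
          (by omega) h.le (by omega)).trans (mul_le_mul_of_nonneg_left (Real.sqrt_le_sqrt ?_) hG0)
        rw [Nat.cast_le]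
        omega
    have t1 : x θ ≤ 1 := by
      simp only [hx]
      linarith [E.mean_le_one θ a, E.mean_nonneg θ b]
    have t2 := (abs_le.1 (hlife j)).2
    have t3 : -∑ g ∈ Finset.Icc (R.ep v) v with R.top g = g ∧ IsChild R.top e j g,
          ∑ t ∈ Finset.Ico r θ with InLife R.top e g t, x t
        ≤ G * ∑ g ∈ Finset.Icc (R.ep v) v with R.top g = g ∧ IsChild R.top e j g,
          √((min (R.dur g + 1) (v + 1 - R.ep v) : ℕ) : ℝ) := by
      rw [← Finset.sum_neg_distrib, Finset.mul_sum]
      exact Finset.sum_le_sum fun g _ => by linarith [(abs_le.1 (hlife g)).1]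
    linarith

open Classical in
/-- Regret of one base algorithm to a surviving arm. -/
theorem sum_top_avg_le (hR : R.Valid C₀ T bit) [NeZero K] {E : Environment K} (hT : 2 ≤ T)
    (hKT : K ≤ T) (hC : 22 ≤ √C₀) (hconc : R.Concentrated E T) (hv1 : 1 ≤ v) (hv : v ≤ T)
    (ha : ∀ s, R.ep v ≤ s → s ≤ v → R.top s = s ∨ a ∉ evicted C₀ T R.obs (R.ep v) s)
    {j : ℕ} (hj : R.ep v ≤ j) (hjv : j ≤ v) (hjtop : R.top j = j) :
    ∑ t ∈ Finset.Icc (R.ep v) v with R.top t = j,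
        (1 / ((R.cand t).card : ℝ)) * ∑ b ∈ R.cand t, (E.mean t a - E.mean t b)
      ≤ 3 * Real.log T * (1 + (√C₀ + 20) * Real.log T * √K *
          (√((min (R.dur j + 1) (v + 1 - R.ep v) : ℕ) : ℝ)
            + ∑ g ∈ Finset.Icc (R.ep v) v with R.top g = g ∧
                IsChild R.top (fun g => g + R.dur g) j g,
              √((min (R.dur g + 1) (v + 1 - R.ep v) : ℕ) : ℝ))) := by
  have hL := half_le_log hT
  have h1 := hR.one_le_ep v hv1 hv
  have hnest := hR.isNest hv1 hv
  have hcandj : R.cand j = Finset.univ := by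
    rw [hR.cand_eq j (by omega) (by omega), hjtop, evicted_self, Finset.sdiff_empty]
  have hset : (Finset.Icc (R.ep v) v).filter (fun t => R.top t = j)
      = (Finset.Icc j v).filter (fun t => R.top t = j) := by
    ext t
    simp only [Finset.mem_filter, Finset.mem_Icc]
    constructor
    · rintro ⟨⟨k1, k2⟩, k3⟩
      have := hnest.top_le t k1 k2
      exact ⟨⟨by omega, k2⟩, k3⟩
    · rintro ⟨⟨k1, k2⟩, k3⟩
      exact ⟨⟨by omega, k2⟩, k3⟩
  -- the last round at which `b` is a candidate of this base algorithm
  have hex : ∀ b : Fin K, ∃ θ, (j ≤ θ ∧ θ ≤ v ∧ R.top θ = j ∧ b ∈ R.cand θ) ∧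
      ∀ t, j ≤ t → t ≤ v → R.top t = j → b ∈ R.cand t → t ≤ θ := by
    intro b
    obtain ⟨θ, hθ, hmax⟩ := Finset.exists_max_image
      ((Finset.Icc j v).filter (fun t => R.top t = j ∧ b ∈ R.cand t)) id
      ⟨j, Finset.mem_filter.2 ⟨Finset.mem_Icc.2 ⟨le_rfl, hjv⟩, hjtop, by rw [hcandj]; simp⟩⟩
    rw [Finset.mem_filter, Finset.mem_Icc] at hθ
    exact ⟨θ, ⟨hθ.1.1, hθ.1.2, hθ.2.1, hθ.2.2⟩, fun t k1 k2 k3 k4 =>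
      hmax t (Finset.mem_filter.2 ⟨Finset.mem_Icc.2 ⟨k1, k2⟩, k3, k4⟩)⟩
  choose θ hθ hmax using hex
  have hswap : ∑ t ∈ Finset.Icc j v with R.top t = j,
        (1 / ((R.cand t).card : ℝ)) * ∑ b ∈ R.cand t, (E.mean t a - E.mean t b)
      = ∑ b, ∑ t ∈ Finset.Icc j v with R.top t = j ∧ b ∈ R.cand t,
        (1 / ((R.cand t).card : ℝ)) * (E.mean t a - E.mean t b) := by
    simp only [Finset.mul_sum]
    refine Finset.sum_comm' fun t b => ?_
    simp [and_assoc]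
  rw [hset, hswap]
  set F := 1 + (√C₀ + 20) * Real.log T * √(K : ℝ) *
          (√((min (R.dur j + 1) (v + 1 - R.ep v) : ℕ) : ℝ)
            + ∑ g ∈ Finset.Icc (R.ep v) v with R.top g = g ∧
                IsChild R.top (fun g => g + R.dur g) j g,
              √((min (R.dur g + 1) (v + 1 - R.ep v) : ℕ) : ℝ)) with hF
  have hF0 : 0 ≤ F := by positivity
  calc _ ≤ ∑ b, 1 / ((R.cand (θ b)).card : ℝ) * F :=
        Finset.sum_le_sum fun b _ => hR.sum_top_mul_le hT hC hconc hv1 hv ha hj hjtop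
          (hθ b).2.1 (hθ b).2.2.1 (hθ b).1 (hθ b).2.2.2 (hmax b)
    _ = (∑ b, 1 / ((R.cand (θ b)).card : ℝ)) * F := (Finset.sum_mul ..).symm
    _ ≤ _ := by
      refine mul_le_mul_of_nonneg_right ?_ hF0
      refine sum_inv_card_le NeZero.one_le hKT hT θ (fun b => (R.cand (θ b)).card) fun b => ?_
      refine Finset.card_le_card fun b' hb' => ?_
      have hb' := (Finset.mem_filter.1 hb').2
      obtain ⟨k1, k2, k3, k4⟩ := hθ b
      obtain ⟨l1, l2, l3, l4⟩ := hθ b'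
      exact hR.cand_subset (by omega) hb' (by omega) (by rw [k3, l3]) l4

/-- Regret of an episode to an arm that survives it: every base algorithm pays for its own life and
for the lives of its children. -/
theorem sum_avg_survivor_le (hR : R.Valid C₀ T bit) [NeZero K] {E : Environment K} (hT : 2 ≤ T)
    (hKT : K ≤ T) (hC : 22 ≤ √C₀) (hconc : R.Concentrated E T) (hv1 : 1 ≤ v) (hv : v ≤ T)
    (ha : ∀ s, R.ep v ≤ s → s ≤ v → R.top s = s ∨ a ∉ evicted C₀ T R.obs (R.ep v) s) :
    ∑ t ∈ Finset.Icc (R.ep v) v,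
        (1 / ((R.cand t).card : ℝ)) * ∑ b ∈ R.cand t, (E.mean t a - E.mean t b)
      ≤ 9 * (√C₀ + 20) * Real.log T ^ 2 * √K * (√((v : ℝ) + 1 - R.ep v)
          + ∑ g ∈ Finset.Ioc (R.ep v) v with R.top g = g, √((R.dur g : ℝ) + 1)) := by
  classical
  have hL := half_le_log hT
  have hK : (1 : ℝ) ≤ K := by exact_mod_cast (NeZero.one_le : 1 ≤ K)
  have h1 := hR.one_le_ep v hv1 hv
  have hle := hR.ep_le hv1 hv
  have hnest := hR.isNest hv1 hv
  set G := (√C₀ + 20) * Real.log T * √(K : ℝ) with hG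
  have hG1 : 1 ≤ G := by
    have h2 : 1 ≤ √(K : ℝ) := Real.one_le_sqrt.2 hK
    have h3 : 1 ≤ (√C₀ + 20) * Real.log T := by nlinarith
    exact one_le_mul_of_one_le_of_one_le h3 h2
  set O := (Finset.Icc (R.ep v) v).filter (fun g => R.top g = g) with hO
  set q : ℕ → ℝ := fun g => √((min (R.dur g + 1) (v + 1 - R.ep v) : ℕ) : ℝ) with hq
  have hq1 : ∀ g, 1 ≤ q g := fun g => by
    refine Real.one_le_sqrt.2 ?_
    have : 1 ≤ min (R.dur g + 1) (v + 1 - R.ep v) := by omega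
    exact_mod_cast this
  have hfib : ∑ t ∈ Finset.Icc (R.ep v) v,
        (1 / ((R.cand t).card : ℝ)) * ∑ b ∈ R.cand t, (E.mean t a - E.mean t b)
      = ∑ j ∈ O, ∑ t ∈ Finset.Icc (R.ep v) v with R.top t = j,
        (1 / ((R.cand t).card : ℝ)) * ∑ b ∈ R.cand t, (E.mean t a - E.mean t b) := by
    refine (Finset.sum_fiberwise_of_maps_to (fun t ht => ?_) _).symm
    rw [Finset.mem_Icc] at ht
    have := hnest.top_le t ht.1 ht.2
    exact Finset.mem_filter.2 ⟨Finset.mem_Icc.2 ⟨hnest.le_top t ht.1 ht.2, by omega⟩,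
      hnest.top_top t ht.1 ht.2⟩
  have hframe : ∑ j ∈ O, ∑ t ∈ Finset.Icc (R.ep v) v with R.top t = j,
        (1 / ((R.cand t).card : ℝ)) * ∑ b ∈ R.cand t, (E.mean t a - E.mean t b)
      ≤ ∑ j ∈ O, 3 * Real.log T * (1 + G * (q j
          + ∑ g ∈ Finset.Icc (R.ep v) v with R.top g = g ∧
                IsChild R.top (fun g => g + R.dur g) j g, q g)) := by
    refine Finset.sum_le_sum fun j hj => ?_
    rw [hO, Finset.mem_filter, Finset.mem_Icc] at hj
    exact hR.sum_top_avg_le hT hKT hC hconc hv1 hv ha hj.1.1 hj.1.2 hj.2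
  have hchild := IsNest.sum_child_le (u := R.ep v) (v := v) (top := R.top)
    (e := fun g => g + R.dur g) q (fun g => by linarith [hq1 g])
  rw [← hO] at hchild
  have hOq : (O.card : ℝ) ≤ ∑ g ∈ O, q g := by
    have := Finset.card_nsmul_le_sum O q 1 fun g _ => hq1 g
    simpa using this
  have hOsum : ∑ g ∈ O, q g ≤ √((v : ℝ) + 1 - R.ep v)
      + ∑ g ∈ Finset.Ioc (R.ep v) v with R.top g = g, √((R.dur g : ℝ) + 1) := by
    have e1 : O = insert (R.ep v) ((Finset.Ioc (R.ep v) v).filter (fun g => R.top g = g)) := by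
      ext g
      simp only [hO, Finset.mem_filter, Finset.mem_Icc, Finset.mem_insert, Finset.mem_Ioc]
      constructor
      · rintro ⟨⟨k1, k2⟩, k3⟩
        rcases k1.eq_or_lt with h | h
        · exact Or.inl h.symm
        · exact Or.inr ⟨⟨h, k2⟩, k3⟩
      · rintro (rfl | ⟨⟨k1, k2⟩, k3⟩)
        · exact ⟨⟨le_rfl, hle⟩, hR.top_ep hv1 hv⟩
        · exact ⟨⟨k1.le, k2⟩, k3⟩
    rw [e1, Finset.sum_insert (by simp)]
    refine add_le_add (Real.sqrt_le_sqrt ?_) (Finset.sum_le_sum fun g _ => Real.sqrt_le_sqrt ?_)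
    · have : ((min (R.dur (R.ep v) + 1) (v + 1 - R.ep v) : ℕ) : ℝ) ≤ ((v + 1 - R.ep v : ℕ) : ℝ) :=
        Nat.cast_le.2 (min_le_right _ _)
      rw [Nat.cast_sub (by omega)] at this
      push_cast at this ⊢
      exact this
    · have : ((min (R.dur g + 1) (v + 1 - R.ep v) : ℕ) : ℝ) ≤ ((R.dur g + 1 : ℕ) : ℝ) :=
        Nat.cast_le.2 (min_le_left _ _)
      push_cast at this ⊢
      exact this
  have hsum : ∑ j ∈ O, 3 * Real.log T * (1 + G * (q j
          + ∑ g ∈ Finset.Icc (R.ep v) v with R.top g = g ∧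
                IsChild R.top (fun g => g + R.dur g) j g, q g))
      ≤ 9 * Real.log T * G * ∑ g ∈ O, q g := by
    rw [← Finset.mul_sum, Finset.sum_add_distrib, ← Finset.mul_sum, Finset.sum_add_distrib,
      Finset.sum_const, nsmul_eq_mul, mul_one]
    have h2 : ∑ g ∈ O, q g ≤ G * ∑ g ∈ O, q g :=
      le_mul_of_one_le_left (Finset.sum_nonneg fun g _ => by linarith [hq1 g]) hG1
    have h3 := mul_le_mul_of_nonneg_left hchild (show 0 ≤ G by linarith)
    have h4 : (O.card : ℝ) + G * (∑ g ∈ O, q g + ∑ j ∈ O,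
          ∑ g ∈ Finset.Icc (R.ep v) v with R.top g = g ∧
                IsChild R.top (fun g => g + R.dur g) j g, q g) ≤ 3 * (G * ∑ g ∈ O, q g) := by
      linarith
    have := mul_le_mul_of_nonneg_left h4 (show 0 ≤ 3 * Real.log T by linarith)
    linarith
  rw [hfib]
  refine hframe.trans (hsum.trans ?_)
  have := mul_le_mul_of_nonneg_left hOsum (show 0 ≤ 9 * Real.log T * G by positivity)
  rw [hG] at this ⊢
  linarith

end Run.Valid

end

section

variable {K : ℕ}

/-! ### Regret of a run -/

/-- The mean regret of round `t`, given the past. -/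
noncomputable def Run.avgGap (E : Environment K) (R : Run K) (t : ℕ) : ℝ :=
  (1 / ((R.cand t).card : ℝ)) * ∑ b ∈ R.cand t, E.gap t b

theorem Run.avgGap_nonneg (E : Environment K) (R : Run K) (t : ℕ) : 0 ≤ R.avgGap E t :=
  mul_nonneg (by positivity) (Finset.sum_nonneg fun b _ => E.gap_nonneg t b)

theorem Run.avgGap_le_one [NeZero K] (E : Environment K) (R : Run K) (t : ℕ) :
    R.avgGap E t ≤ 1 := by
  have h := Finset.sum_le_card_nsmul (R.cand t) (fun b => E.gap t b) 1 fun b _ => E.gap_le_one t b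
  rw [nsmul_eq_mul, mul_one] at h
  unfold Run.avgGap
  rw [one_div, inv_mul_eq_div]
  exact div_le_one_of_le₀ h (Nat.cast_nonneg _)

namespace Run.Valid

variable {C₀ : ℝ} {T : ℕ} {bit : ℕ → ℕ → ℕ → Bool} {R : Run K}

/-- Regret of an episode up to round `v`. -/
theorem sum_avgGap_episode_le (hR : R.Valid C₀ T bit) [NeZero K] {E : Environment K}
    {S : Finset ℕ} (hT : 2 ≤ T) (hKT : K ≤ T) (hC : 22 ≤ √C₀) (hconc : R.Concentrated E T)
    (hS : Hitting E T S) (hbits : ReplaysOccur E T S (√C₀ + 23) bit) {l : ℝ} (hl : 0 < l) {v : ℕ}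
    (hv1 : 1 ≤ v) (hv : v ≤ T) :
    ∑ t ∈ Finset.Icc (R.ep v) v, R.avgGap E t
      ≤ 1100 * (√C₀ + 23) * Real.log T ^ 2 * √K * (l * ((v : ℝ) + 1 - R.ep v)
          + (1 + ((S.filter fun s => R.ep v < s ∧ s ≤ v).card : ℝ)) / l
          + ∑ g ∈ Finset.Ioc (R.ep v) v with R.top g = g, √((R.dur g : ℝ) + 1)) := by
  classical
  have hL := half_le_log hT
  have hK : (1 : ℝ) ≤ K := by exact_mod_cast (NeZero.one_le : 1 ≤ K)
  have h1 := hR.one_le_ep v hv1 hv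
  have hle := hR.ep_le hv1 hv
  obtain ⟨a, ha⟩ := hR.survivor v hv1 hv
  have hsplit : ∑ t ∈ Finset.Icc (R.ep v) v, R.avgGap E t
      = ∑ t ∈ Finset.Icc (R.ep v) v, E.gap t a + ∑ t ∈ Finset.Icc (R.ep v) v,
        (1 / ((R.cand t).card : ℝ)) * ∑ b ∈ R.cand t, (E.mean t a - E.mean t b) := by
    rw [← Finset.sum_add_distrib]
    refine Finset.sum_congr rfl fun t ht => ?_
    rw [Finset.mem_Icc] at ht
    have hc : (0 : ℝ) < (R.cand t).card := by
      exact_mod_cast Finset.card_pos.2 ⟨a, hR.mem_cand_of_survivor hv1 hv ha ht.1 ht.2⟩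
    unfold Run.avgGap
    simp only [← E.gap_sub_gap, Finset.sum_sub_distrib, Finset.sum_const, nsmul_eq_mul]
    field_simp
    ring
  -- the last round of the episode at which candidate sets were updated
  obtain ⟨r, hr, hmax⟩ := Finset.exists_max_image
    ((Finset.Icc (R.ep v) v).filter fun t => t = R.ep v ∨ R.top t ≠ t) id
    ⟨R.ep v, Finset.mem_filter.2 ⟨Finset.mem_Icc.2 ⟨le_rfl, hle⟩, Or.inl rfl⟩⟩
  rw [Finset.mem_filter, Finset.mem_Icc] at hr
  obtain ⟨⟨hur, hrv⟩, hr'⟩ := hr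
  have har : a ∉ evicted C₀ T R.obs (R.ep v) r := by
    rcases hr' with h | h
    · rw [h, evicted_self]; simp
    · exact (ha r hur hrv).resolve_left h
  have hA := hR.sum_gap_survivor_le hT hC hconc hS hbits hl hv1 hv hur hrv har
  have hB := hR.sum_avg_survivor_le hT hKT hC hconc hv1 hv ha
  set Op := ∑ g ∈ Finset.Ioc (R.ep v) v with R.top g = g, √((R.dur g : ℝ) + 1) with hOp
  -- every later round starts a replay
  have hrest : ∑ t ∈ Finset.Icc r v, E.gap t a ≤ 1 + Op := by
    have e1 : Finset.Icc r v = insert r (Finset.Ioc r v) := by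
      ext i; simp only [Finset.mem_Icc, Finset.mem_insert, Finset.mem_Ioc]; omega
    rw [e1, Finset.sum_insert (by simp)]
    refine add_le_add (E.gap_le_one r a) ?_
    have e2 : Finset.Ioc r v ⊆ (Finset.Ioc (R.ep v) v).filter fun g => R.top g = g := by
      intro g hg
      rw [Finset.mem_Ioc] at hg
      refine Finset.mem_filter.2 ⟨Finset.mem_Ioc.2 ⟨by omega, hg.2⟩, ?_⟩
      by_contra h
      have := hmax g (Finset.mem_filter.2 ⟨Finset.mem_Icc.2 ⟨by omega, hg.2⟩, Or.inr h⟩)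
      simp only [id] at this
      omega
    refine le_trans (Finset.sum_le_sum fun g _ => ?_)
      (Finset.sum_le_sum_of_subset_of_nonneg e2 fun g _ _ => Real.sqrt_nonneg _)
    refine (E.gap_le_one g a).trans (Real.one_le_sqrt.2 ?_)
    linarith [Nat.cast_nonneg (α := ℝ) (R.dur g)]
  have hgap : ∑ t ∈ Finset.Icc (R.ep v) v, E.gap t a
      = ∑ t ∈ Finset.Ico (R.ep v) r, E.gap t a + ∑ t ∈ Finset.Icc r v, E.gap t a := by
    rw [← Finset.sum_union]
    · congr 1
      ext i; simp only [Finset.mem_Icc, Finset.mem_union, Finset.mem_Ico]; omega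
    · rw [Finset.disjoint_left]
      intro i hi hi'
      rw [Finset.mem_Ico] at hi
      rw [Finset.mem_Icc] at hi'
      omega
  have hOp0 : 0 ≤ Op := Finset.sum_nonneg fun g _ => Real.sqrt_nonneg _
  set N : ℝ := ((S.filter fun s => R.ep v < s ∧ s ≤ v).card : ℝ) with hN
  have hN0 : 0 ≤ N := Nat.cast_nonneg _
  have hNr : ((S.filter fun s => R.ep v < s ∧ s < r).card : ℝ) ≤ N := by
    refine Nat.cast_le.2 (Finset.card_le_card fun s hs => ?_)
    rw [Finset.mem_filter] at hs ⊢
    exact ⟨hs.1, by omega⟩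
  set n : ℝ := (v : ℝ) + 1 - R.ep v with hn
  have hn1 : 1 ≤ n := by
    have : (R.ep v : ℝ) ≤ v := by exact_mod_cast hle
    linarith
  have hrn : (r : ℝ) - R.ep v ≤ n := by
    have : (r : ℝ) ≤ v := by exact_mod_cast hrv
    linarith
  set Q := l * n + (1 + N) / l with hQ
  have hQr : l * ((r : ℝ) - R.ep v)
      + (1 + ((S.filter fun s => R.ep v < s ∧ s < r).card : ℝ)) / l ≤ Q :=
    add_le_add (mul_le_mul_of_nonneg_left hrn hl.le)
      (div_le_div_of_nonneg_right (by linarith) hl.le)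
  have hsq := two_mul_sqrt_le (by linarith : 0 ≤ n) hl
  have h1l : 1 / l ≤ (1 + N) / l := div_le_div_of_nonneg_right (by linarith) hl.le
  have hs1 : 1 ≤ √n := Real.one_le_sqrt.2 hn1
  have hQ2 : 2 * √n ≤ Q := by linarith
  set G := Real.log T ^ 2 * √(K : ℝ) with hG
  have hG1 : 1 / 4 ≤ G := by
    have h2 : 1 ≤ √(K : ℝ) := Real.one_le_sqrt.2 hK
    have h3 : 1 / 4 ≤ Real.log T ^ 2 := by nlinarith
    nlinarith
  have hκG : 1 ≤ (√C₀ + 23) * G := by nlinarith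
  have hκG0 : 0 ≤ (√C₀ + 23) * G := by linarith
  rw [hsplit, hgap]
  have i1 : ∑ t ∈ Finset.Ico (R.ep v) r, E.gap t a ≤ 1000 * ((√C₀ + 23) * G) * Q := by
    have := mul_le_mul_of_nonneg_left hQr (show 0 ≤ 1000 * ((√C₀ + 23) * G) by positivity)
    linarith
  have i2 : 1 + Op ≤ ((√C₀ + 23) * G) * (Q + Op) := by
    have : Q + Op ≤ ((√C₀ + 23) * G) * (Q + Op) :=
      le_mul_of_one_le_left (by linarith) hκG
    linarith
  have i3 : 9 * (√C₀ + 20) * Real.log T ^ 2 * √K * (√n + Op) ≤ 9 * ((√C₀ + 23) * G) * (Q + Op) := by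
    have g1 : 9 * (√C₀ + 20) * Real.log T ^ 2 * √K ≤ 9 * ((√C₀ + 23) * G) := by
      have h0 : 0 ≤ G := by linarith
      have h1 := mul_le_mul_of_nonneg_right (show √C₀ + 20 ≤ √C₀ + 23 by linarith) h0
      have h2 : 9 * (√C₀ + 20) * Real.log T ^ 2 * √K = 9 * ((√C₀ + 20) * G) := by rw [hG]; ring
      linarith
    exact mul_le_mul g1 (by linarith) (by linarith) (by linarith)
  have i4 : 0 ≤ ((√C₀ + 23) * G) * Op := mul_nonneg hκG0 hOp0
  have i5 : 0 ≤ ((√C₀ + 23) * G) * Q := mul_nonneg hκG0 (by linarith)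
  have i6 : 1100 * (√C₀ + 23) * Real.log T ^ 2 * √K * (Q + Op)
      = 1100 * (((√C₀ + 23) * G) * Q) + 1100 * (((√C₀ + 23) * G) * Op) := by
    rw [hG]; ring
  rw [i6]
  linarith

/-- Summation over episodes: a potential `P` that pays for every episode pays for their total. -/
theorem sum_le_of_episode (hR : R.Valid C₀ T bit) (f P : ℕ → ℝ) (hP0 : 0 ≤ P 0)
    (hP : ∀ v, 1 ≤ v → v ≤ T → ∑ t ∈ Finset.Icc (R.ep v) v, f t + P (R.ep v - 1) ≤ P v)
    (v : ℕ) (hv : v ≤ T) : ∑ t ∈ Finset.Icc 1 v, f t ≤ P v := by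
  induction v using Nat.strong_induction_on with
  | _ v ih =>
  rcases Nat.eq_zero_or_pos v with rfl | hv1
  · simpa using hP0
  have h1 := hR.one_le_ep v hv1 hv
  have hle := hR.ep_le hv1 hv
  have hih := ih (R.ep v - 1) (by omega) (by omega)
  have e : ∑ t ∈ Finset.Icc 1 v, f t
      = ∑ t ∈ Finset.Icc 1 (R.ep v - 1), f t + ∑ t ∈ Finset.Icc (R.ep v) v, f t := by
    rw [← Finset.sum_union]
    · congr 1
      ext i; simp only [Finset.mem_Icc, Finset.mem_union]; omega
    · rw [Finset.disjoint_left]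
      intro i hi hi'
      rw [Finset.mem_Icc] at hi hi'
      omega
  have := hP v hv1 hv
  linarith

/-- The number of episodes that start in the rounds up to `v`. -/
def _root_.SigShift.Run.numEp (R : Run K) (v : ℕ) : ℕ :=
  ((Finset.Icc 1 v).filter fun s => R.ep s = s).card

theorem numEp_add_one_le (hR : R.Valid C₀ T bit) {v : ℕ} (hv1 : 1 ≤ v) (hv : v ≤ T) :
    R.numEp (R.ep v - 1) + 1 ≤ R.numEp v := by
  have h1 := hR.one_le_ep v hv1 hv
  have hle := hR.ep_le hv1 hv
  unfold Run.numEp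
  refine Finset.card_lt_card (Finset.ssubset_iff_of_subset ?_ |>.2 ⟨R.ep v, ?_, ?_⟩)
  · intro i hi
    rw [Finset.mem_filter, Finset.mem_Icc] at hi ⊢
    exact ⟨by omega, hi.2⟩
  · exact Finset.mem_filter.2 ⟨Finset.mem_Icc.2 ⟨h1, hle⟩, hR.ep_ep hv1 hv⟩
  · intro hm
    rw [Finset.mem_filter, Finset.mem_Icc] at hm
    omega

/-- The sum of the square roots of the lengths of all replays whose bit is set, including those that
are not run because a longer one starts in the same round. -/
noncomputable def _root_.SigShift.Run.replayCost (T : ℕ) (bit : ℕ → ℕ → ℕ → Bool) (R : Run K) :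
    ℝ :=
  ∑ t ∈ Finset.Icc 1 (T - 1), ∑ m ∈ replayDurations T,
    if bit (R.ep t) (t + 1) m = true then √((m : ℝ) + 1) else 0

theorem sum_replay_le_replayCost (hR : R.Valid C₀ T bit) :
    ∑ g ∈ Finset.Icc 1 T with R.top g = g ∧ R.ep g ≠ g, √((R.dur g : ℝ) + 1)
      ≤ R.replayCost T bit := by
  classical
  have hsub : ((Finset.Icc 1 T).filter fun g => R.top g = g ∧ R.ep g ≠ g)
      ⊆ ((Finset.Icc 1 (T - 1)).filter fun t => R.top (t + 1) = t + 1 ∧ R.ep (t + 1) ≠ t + 1).image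
        (fun t => t + 1) := by
    intro g hg
    rw [Finset.mem_filter, Finset.mem_Icc] at hg
    have : g ≠ 1 := fun h => hg.2.2 (by rw [h]; exact hR.ep_one)
    obtain ⟨t, rfl⟩ : ∃ t, g = t + 1 := ⟨g - 1, by omega⟩
    exact Finset.mem_image.2 ⟨t, Finset.mem_filter.2 ⟨Finset.mem_Icc.2 (by omega), hg.2⟩, rfl⟩
  refine (Finset.sum_le_sum_of_subset_of_nonneg hsub fun _ _ _ => Real.sqrt_nonneg _).trans ?_
  rw [Finset.sum_image (fun s _ t _ h => by simpa using h)]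
  unfold Run.replayCost
  rw [Finset.sum_filter]
  refine Finset.sum_le_sum fun t ht => ?_
  rw [Finset.mem_Icc] at ht
  have hnn : ∀ m ∈ replayDurations T,
      (0 : ℝ) ≤ if bit (R.ep t) (t + 1) m = true then √((m : ℝ) + 1) else 0 := by
    intro m _
    split_ifs <;> positivity
  split_ifs with h
  · have h3 : R.ep (t + 1) = R.ep t :=
      (hR.ep_step t ht.1 (by omega)).resolve_right fun h' => h.2 h'.1
    obtain ⟨h4, h5⟩ := hR.bit_of_replay t ht.1 (by omega) h3 h.1
    refine le_trans ?_ (Finset.single_le_sum hnn h4)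
    rw [if_pos h5]
  · exact Finset.sum_nonneg hnn

/-- The regret of a run on which the estimates are concentrated and exposing replays occur. -/
theorem sum_avgGap_le (hR : R.Valid C₀ T bit) [NeZero K] {E : Environment K}
    {S : Finset ℕ} (hT : 2 ≤ T) (hKT : K ≤ T) (hC : 22 ≤ √C₀) (hconc : R.Concentrated E T)
    (hS : Hitting E T S) (hbits : ReplaysOccur E T S (√C₀ + 23) bit) {l : ℝ} (hl : 0 < l) :
    ∑ t ∈ Finset.Icc 1 T, R.avgGap E t
      ≤ 1100 * (√C₀ + 23) * Real.log T ^ 2 * √K *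
          (l * T + 2 * ((S.card : ℝ) + 1) / l + R.replayCost T bit) := by
  classical
  set M := 1100 * (√C₀ + 23) * Real.log T ^ 2 * √(K : ℝ) with hM
  have hM0 : 0 ≤ M := by positivity
  have hmain := hR.sum_le_of_episode (R.avgGap E) (fun v => M * (l * v
      + ((R.numEp v : ℝ) + ((S.filter fun s => s ≤ v).card : ℝ)) / l
      + ∑ g ∈ Finset.Icc 1 v with R.top g = g ∧ R.ep g ≠ g, √((R.dur g : ℝ) + 1)))
    (by
      simp only [CharP.cast_eq_zero, mul_zero, zero_add]
      exact mul_nonneg hM0 (add_nonneg (div_nonneg (by positivity) hl.le)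
        (Finset.sum_nonneg fun _ _ => Real.sqrt_nonneg _)))
    (by
      intro v hv1 hv
      have h1 := hR.one_le_ep v hv1 hv
      have hle := hR.ep_le hv1 hv
      have hep := hR.sum_avgGap_episode_le hT hKT hC hconc hS hbits hl hv1 hv
      rw [← hM] at hep
      have n1 : (R.numEp (R.ep v - 1) : ℝ) + 1 ≤ R.numEp v := by
        exact_mod_cast hR.numEp_add_one_le hv1 hv
      have n2 : ((S.filter fun s => s ≤ R.ep v - 1).card : ℝ)
          + ((S.filter fun s => R.ep v < s ∧ s ≤ v).card : ℝ)
          ≤ ((S.filter fun s => s ≤ v).card : ℝ) := by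
        rw [← Nat.cast_add, Nat.cast_le, ← Finset.card_union_of_disjoint]
        · refine Finset.card_le_card fun s hs => ?_
          simp only [Finset.mem_union, Finset.mem_filter] at hs ⊢
          rcases hs with h | h
          · exact ⟨h.1, by omega⟩
          · exact ⟨h.1, h.2.2⟩
        · rw [Finset.disjoint_left]
          intro s hs hs'
          rw [Finset.mem_filter] at hs hs'
          omega
      have n3 : (∑ g ∈ Finset.Icc 1 (R.ep v - 1) with R.top g = g ∧ R.ep g ≠ g,
            √((R.dur g : ℝ) + 1))
          + ∑ g ∈ Finset.Ioc (R.ep v) v with R.top g = g, √((R.dur g : ℝ) + 1)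
          ≤ ∑ g ∈ Finset.Icc 1 v with R.top g = g ∧ R.ep g ≠ g, √((R.dur g : ℝ) + 1) := by
        rw [← Finset.sum_union]
        · refine Finset.sum_le_sum_of_subset_of_nonneg ?_ fun _ _ _ => Real.sqrt_nonneg _
          intro g hg
          simp only [Finset.mem_union, Finset.mem_filter, Finset.mem_Icc, Finset.mem_Ioc] at hg ⊢
          rcases hg with h | h
          · exact ⟨by omega, h.2⟩
          · refine ⟨by omega, h.2, ?_⟩
            rw [hR.ep_eq hv1 hv h.1.1.le h.1.2]
            omega
        · rw [Finset.disjoint_left]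
          intro g hg hg'
          rw [Finset.mem_filter, Finset.mem_Icc] at hg
          rw [Finset.mem_filter, Finset.mem_Ioc] at hg'
          omega
      have e4 : ((R.ep v - 1 : ℕ) : ℝ) = (R.ep v : ℝ) - 1 := by
        rw [Nat.cast_sub h1, Nat.cast_one]
      have n5 := div_le_div_of_nonneg_right (add_le_add n1 n2) hl.le
      have n6 : l * ((v : ℝ) + 1 - R.ep v)
          + (1 + ((S.filter fun s => R.ep v < s ∧ s ≤ v).card : ℝ)) / l
          + ∑ g ∈ Finset.Ioc (R.ep v) v with R.top g = g, √((R.dur g : ℝ) + 1)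
          + (l * ((R.ep v - 1 : ℕ) : ℝ) + ((R.numEp (R.ep v - 1) : ℝ)
              + ((S.filter fun s => s ≤ R.ep v - 1).card : ℝ)) / l
            + ∑ g ∈ Finset.Icc 1 (R.ep v - 1) with R.top g = g ∧ R.ep g ≠ g, √((R.dur g : ℝ) + 1))
          ≤ l * v + ((R.numEp v : ℝ) + ((S.filter fun s => s ≤ v).card : ℝ)) / l
            + ∑ g ∈ Finset.Icc 1 v with R.top g = g ∧ R.ep g ≠ g, √((R.dur g : ℝ) + 1) := by
        rw [e4]
        have e5 : (1 + ((S.filter fun s => R.ep v < s ∧ s ≤ v).card : ℝ)) / l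
            + ((R.numEp (R.ep v - 1) : ℝ) + ((S.filter fun s => s ≤ R.ep v - 1).card : ℝ)) / l
            = ((R.numEp (R.ep v - 1) : ℝ) + 1 + (((S.filter fun s => s ≤ R.ep v - 1).card : ℝ)
              + ((S.filter fun s => R.ep v < s ∧ s ≤ v).card : ℝ))) / l := by
          rw [← add_div]; congr 1; ring
        linarith
      have := mul_le_mul_of_nonneg_left n6 hM0
      linarith) T le_rfl
  refine hmain.trans (mul_le_mul_of_nonneg_left ?_ hM0)
  have c1 : (R.numEp T : ℝ) ≤ (S.card : ℝ) + 1 := by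
    have h := hR.card_episodes_le hT hC hconc hS (by omega : 1 ≤ T) le_rfl
    have h2 : (S.filter fun s => s < R.ep T).card ≤ S.card := Finset.card_filter_le _ _
    have : R.numEp T ≤ S.card + 1 := by unfold Run.numEp; omega
    exact_mod_cast this
  have c2 : ((S.filter fun s => s ≤ T).card : ℝ) ≤ S.card := by
    exact_mod_cast Finset.card_filter_le _ _
  have c3 : ((R.numEp T : ℝ) + ((S.filter fun s => s ≤ T).card : ℝ)) / l
      ≤ 2 * ((S.card : ℝ) + 1) / l := div_le_div_of_nonneg_right (by linarith) hl.le
  have := hR.sum_replay_le_replayCost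
  linarith

theorem _root_.SigShift.sum_one_div_sqrt_le (n : ℕ) :
    ∑ k ∈ Finset.range n, 1 / √((k : ℝ) + 1) ≤ 2 * √(n : ℝ) := by
  induction n with
  | zero => simp
  | succ n ih =>
    rw [Finset.sum_range_succ]
    push_cast
    have h0 : (0 : ℝ) ≤ n := Nat.cast_nonneg n
    have h1 : 0 < √((n : ℝ) + 1) := Real.sqrt_pos.2 (by positivity)
    have h2 : √(n : ℝ) ≤ √((n : ℝ) + 1) := Real.sqrt_le_sqrt (by linarith)
    have h3 := Real.mul_self_sqrt h0
    have h4 := Real.mul_self_sqrt (show 0 ≤ (n : ℝ) + 1 by positivity)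
    have h5 : 1 / √((n : ℝ) + 1) ≤ 2 * (√((n : ℝ) + 1) - √(n : ℝ)) := by
      rw [div_le_iff₀ h1]
      nlinarith [Real.sqrt_nonneg (n : ℝ)]
    linarith

/-- The probabilities of replays, up to the factors `1 / √m`, sum to the order of `√n` over an
episode of `n` rounds. -/
theorem sum_one_div_sqrt_ep_le (hR : R.Valid C₀ T bit) [NeZero K] {E : Environment K}
    {S : Finset ℕ} (hT : 2 ≤ T) (hC : 22 ≤ √C₀) (hconc : R.Concentrated E T)
    (hS : Hitting E T S) {l : ℝ} (hl : 0 < l) :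
    ∑ t ∈ Finset.Icc 1 (T - 1), 1 / √((t + 1 - R.ep t : ℕ) : ℝ)
      ≤ l * T + ((S.card : ℝ) + 1) / l := by
  have hmain := hR.sum_le_of_episode (fun t => 1 / √((t + 1 - R.ep t : ℕ) : ℝ))
    (fun v => l * v + (R.numEp v : ℝ) / l)
    (by simp [Run.numEp])
    (by
      intro v hv1 hv
      have h1 := hR.one_le_ep v hv1 hv
      have hle := hR.ep_le hv1 hv
      have n1 : (R.numEp (R.ep v - 1) : ℝ) + 1 ≤ R.numEp v := by
        exact_mod_cast hR.numEp_add_one_le hv1 hv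
      have n2 := div_le_div_of_nonneg_right n1 hl.le
      rw [add_div] at n2
      have e4 : ((R.ep v - 1 : ℕ) : ℝ) = (R.ep v : ℝ) - 1 := by
        rw [Nat.cast_sub h1, Nat.cast_one]
      have e5 : ∑ t ∈ Finset.Icc (R.ep v) v, 1 / √((t + 1 - R.ep t : ℕ) : ℝ)
          = ∑ k ∈ Finset.range (v + 1 - R.ep v), 1 / √((k : ℝ) + 1) := by
        have : Finset.Icc (R.ep v) v = Finset.Ico (R.ep v) (v + 1) := by
          ext i; simp only [Finset.mem_Icc, Finset.mem_Ico]; omega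
        rw [this, Finset.sum_Ico_eq_sum_range]
        refine Finset.sum_congr rfl fun k hk => ?_
        rw [Finset.mem_range] at hk
        rw [hR.ep_eq (s := R.ep v + k) hv1 hv (by omega) (by omega)]
        have : R.ep v + k + 1 - R.ep v = k + 1 := by omega
        rw [this]
        push_cast
        rfl
      have h6 := sum_one_div_sqrt_le (v + 1 - R.ep v)
      have h7 := two_mul_sqrt_le (Nat.cast_nonneg (α := ℝ) (v + 1 - R.ep v)) hl
      have e8 : ((v + 1 - R.ep v : ℕ) : ℝ) = (v : ℝ) + 1 - R.ep v := by
        rw [Nat.cast_sub (by omega)]; push_cast; ring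
      rw [e5, e4]
      rw [e8] at h6 h7
      linarith) T le_rfl
  have c1 : (R.numEp T : ℝ) ≤ (S.card : ℝ) + 1 := by
    have h := hR.card_episodes_le hT hC hconc hS (by omega : 1 ≤ T) le_rfl
    have h2 : (S.filter fun s => s < R.ep T).card ≤ S.card := Finset.card_filter_le _ _
    have : R.numEp T ≤ S.card + 1 := by unfold Run.numEp; omega
    exact_mod_cast this
  have c2 := div_le_div_of_nonneg_right c1 hl.le
  refine le_trans ?_ (hmain.trans (by linarith))
  refine Finset.sum_le_sum_of_subset_of_nonneg ?_ fun t _ _ => by positivity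
  intro i hi
  rw [Finset.mem_Icc] at hi ⊢
  omega

end Run.Valid

end

section

variable {K : ℕ}

/-! ### Resampling one coordinate -/

/-- A product measure is unchanged when one coordinate is drawn afresh. -/
theorem map_update_infinitePi {ι : Type*} [DecidableEq ι] {X : ι → Type*}
    [∀ i, MeasurableSpace (X i)] (μ : ∀ i, Measure (X i)) [∀ i, IsProbabilityMeasure (μ i)] (i : ι) :
    ((Measure.infinitePi μ).prod (μ i)).map (fun p => Function.update p.1 i p.2)
      = Measure.infinitePi μ := by
  refine Measure.eq_infinitePi _ fun s t ht => ?_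
  rw [Measure.map_apply measurable_update' (MeasurableSet.pi s.countable_toSet fun i _ => ht i)]
  by_cases hi : i ∈ s
  · have e : (fun p : (∀ i, X i) × X i => Function.update p.1 i p.2) ⁻¹' (Set.pi s t)
        = (Set.pi (s.erase i) t) ×ˢ t i := by
      ext p
      simp only [Set.mem_preimage, Set.mem_pi, Finset.mem_coe, Set.mem_prod, Finset.mem_erase]
      constructor
      · intro h
        refine ⟨fun k hk => ?_, ?_⟩
        · have := h k hk.2
          rwa [Function.update_of_ne hk.1] at this
        · have := h i hi
          rwa [Function.update_self] at this
      · rintro ⟨h1, h2⟩ k hk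
        by_cases hki : k = i
        · subst hki
          rwa [Function.update_self]
        · rw [Function.update_of_ne hki]
          exact h1 k ⟨hki, hk⟩
    rw [e, Measure.prod_prod, Measure.infinitePi_pi _ (fun i _ => ht i), Finset.prod_erase_mul _ _ hi]
  · have e : (fun p : (∀ i, X i) × X i => Function.update p.1 i p.2) ⁻¹' (Set.pi s t)
        = (Set.pi s t) ×ˢ Set.univ := by
      ext p
      simp only [Set.mem_preimage, Set.mem_pi, Finset.mem_coe, Set.mem_prod, Set.mem_univ, and_true]
      refine forall_congr' fun k => forall_congr' fun hk => ?_
      rw [Function.update_of_ne (by rintro rfl; exact hi hk)]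
    rw [e, Measure.prod_prod, Measure.infinitePi_pi _ (fun i _ => ht i), measure_univ, mul_one]

theorem lintegral_update_infinitePi {ι : Type*} [DecidableEq ι] {X : ι → Type*}
    [∀ i, MeasurableSpace (X i)] (μ : ∀ i, Measure (X i)) [∀ i, IsProbabilityMeasure (μ i)] (i : ι)
    {f : (∀ i, X i) → ENNReal} (hf : Measurable f) :
    ∫⁻ x, f x ∂(Measure.infinitePi μ)
      = ∫⁻ x, ∫⁻ y, f (Function.update x i y) ∂(μ i) ∂(Measure.infinitePi μ) := by
  conv_lhs => rw [← map_update_infinitePi μ i]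
  rw [lintegral_map hf measurable_update', lintegral_prod]
  exact (hf.comp measurable_update').aemeasurable

/-! ### Maps into a set without structure -/

/-- Measurability for the discrete `σ`-algebra on the target. States of META carry no measurable space
structure, and their discrete part takes countably many values. -/
def FiberMeasurable {Ω α : Type*} [MeasurableSpace Ω] (f : Ω → α) : Prop :=
  ∀ s : Set α, MeasurableSet (f ⁻¹' s)

namespace FiberMeasurable

variable {Ω α β : Type*}

theorem preimage_bind {f : Ω → α} (g : α → Ω → β) (s : Set β) :
    (fun ω => g (f ω) ω) ⁻¹' s = ⋃ a, f ⁻¹' {a} ∩ g a ⁻¹' s := by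
  ext ω
  simp only [Set.mem_preimage, Set.mem_iUnion, Set.mem_inter_iff, Set.mem_singleton_iff]
  constructor
  · intro h
    exact ⟨f ω, rfl, h⟩
  · rintro ⟨a, h1, h2⟩
    rw [h1]; exact h2

variable [MeasurableSpace Ω]

theorem of_measurable [MeasurableSpace α] [DiscreteMeasurableSpace α] {f : Ω → α}
    (hf : Measurable f) : FiberMeasurable f := fun _ => hf (.of_discrete)

theorem measurable [MeasurableSpace α] {f : Ω → α} (hf : FiberMeasurable f) : Measurable f :=
  fun s _ => hf s

theorem const (a : α) : FiberMeasurable fun _ : Ω => a := fun s => by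
  by_cases h : a ∈ s <;> simp [h]

theorem comp {f : Ω → α} (hf : FiberMeasurable f) (g : α → β) :
    FiberMeasurable fun ω => g (f ω) := fun s => hf (g ⁻¹' s)

theorem bind [Countable α] {f : Ω → α} (hf : FiberMeasurable f) {g : α → Ω → β}
    (hg : ∀ a, FiberMeasurable (g a)) : FiberMeasurable fun ω => g (f ω) ω := fun s => by
  rw [preimage_bind]
  exact MeasurableSet.iUnion fun a => (hf _).inter (hg a s)

theorem bind_measurable [Countable α] [MeasurableSpace β] {f : Ω → α} (hf : FiberMeasurable f)
    {g : α → Ω → β} (hg : ∀ a, Measurable (g a)) : Measurable fun ω => g (f ω) ω := fun s hs => by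
  rw [preimage_bind]
  exact MeasurableSet.iUnion fun a => (hf _).inter (hg a hs)

theorem finset [Countable α] {f : Ω → Finset α} (hf : ∀ a, MeasurableSet {ω | a ∈ f ω}) :
    FiberMeasurable f := fun s => by
  have e : f ⁻¹' s = ⋃ A ∈ s, ⋂ a, {ω | a ∈ f ω ↔ a ∈ A} := by
    ext ω
    simp only [Set.mem_preimage, Set.mem_iUnion, Set.mem_iInter, Set.mem_ofPred_eq, exists_prop]
    constructor
    · intro h
      exact ⟨f ω, h, fun a => Iff.rfl⟩
    · rintro ⟨A, hA, h⟩
      rw [Finset.ext h]; exact hA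
  rw [e]
  refine MeasurableSet.biUnion (Set.to_countable s) fun A _ => MeasurableSet.iInter fun a => ?_
  by_cases h : a ∈ A
  · simpa [h] using hf a
  · have e' : {ω | a ∈ f ω ↔ a ∈ A} = {ω | a ∈ f ω}ᶜ := by
      ext ω
      simp [h]
    rw [e']
    exact (hf a).compl

end FiberMeasurable

theorem fiberMeasurable_evicted (C₀ : ℝ) (T : ℕ) {Ω : Type*} [MeasurableSpace Ω] {h : Ω → ℕ → Obs K}
    (hh : ∀ s a' a, Measurable fun ω => (h ω s).gapEst a' a) (u t : ℕ) :
    FiberMeasurable fun ω => evicted C₀ T (h ω) u t := by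
  refine FiberMeasurable.finset fun a => ?_
  simp only [mem_evicted, ElimOn]
  have : {ω | ∃ s₁ s₂ : ℕ, u ≤ s₁ ∧ s₁ < s₂ ∧ s₂ < t ∧ ∃ a' : Fin K,
      Real.log T * √(C₀ * max ((K : ℝ) * ((s₂ : ℝ) - (s₁ : ℝ))) ((K : ℝ) ^ 2))
      < ∑ t ∈ Finset.Icc s₁ s₂, (h ω t).gapEst a' a}
      = ⋃ s₁ : ℕ, ⋃ s₂ : ℕ, ⋃ _ : u ≤ s₁, ⋃ _ : s₁ < s₂, ⋃ _ : s₂ < t, ⋃ a' : Fin K,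
      {ω | Real.log T * √(C₀ * max ((K : ℝ) * ((s₂ : ℝ) - (s₁ : ℝ))) ((K : ℝ) ^ 2))
      < ∑ t ∈ Finset.Icc s₁ s₂, (h ω t).gapEst a' a} := by
    ext ω
    simp only [Set.mem_ofPred_eq, Set.mem_iUnion, exists_prop]
  rw [this]
  refine MeasurableSet.iUnion fun s₁ => MeasurableSet.iUnion fun s₂ => MeasurableSet.iUnion fun _ =>
    MeasurableSet.iUnion fun _ => MeasurableSet.iUnion fun _ => MeasurableSet.iUnion fun a' => ?_
  exact measurableSet_lt measurable_const (Finset.measurable_sum _ fun s _ => hh s a' a)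

theorem measurable_seed_reward (t : ℕ) (a : Fin K) : Measurable fun ω : Seed K => ω.1 t a := by
  fun_prop

theorem fiberMeasurable_play (t : ℕ) (A : Finset (Fin K)) :
    FiberMeasurable fun ω : Seed K => ω.2.1 (t, A) :=
  FiberMeasurable.of_measurable (by fun_prop)

variable [NeZero K] (E : Environment K)

/-- Redrawing the rewards of one round. -/
theorem lintegral_seed_reward (s : ℕ) {f : Seed K → ENNReal} (hf : Measurable f) :
    ∫⁻ ω, f ω ∂(seedLaw E)
      = ∫⁻ ω, ∫⁻ y, f (Function.update ω.1 s y, ω.2) ∂(E.law s) ∂(seedLaw E) := by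
  have hm : Measurable fun p : Seed K × (Fin K → ℝ) =>
      f (Function.update p.1.1 s p.2, p.1.2) := by
    refine hf.comp (Measurable.prodMk ?_ (by fun_prop))
    exact measurable_update'.comp (Measurable.prodMk (by fun_prop) (by fun_prop))
  unfold seedLaw
  rw [lintegral_prod _ hf.aemeasurable, lintegral_prod _ hm.lintegral_prod_right'.aemeasurable,
    lintegral_update_infinitePi E.law s hf.lintegral_prod_right']
  refine lintegral_congr fun x => ?_
  rw [lintegral_lintegral_swap]
  refine (hm.comp (f := fun p : (Fin K → ℝ) × _ => ((x, p.2), p.1)) ?_).aemeasurable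
  fun_prop

/-- Redrawing the arm to be played in one round from a given candidate set. -/
theorem lintegral_seed_arm (q : ℕ × Finset (Fin K)) {f : Seed K → ENNReal} (hf : Measurable f) :
    ∫⁻ ω, f ω ∂(seedLaw E)
      = ∫⁻ ω, ∫⁻ c, f (ω.1, Function.update ω.2.1 q c, ω.2.2) ∂(uniformArm q.2).toMeasure
          ∂(seedLaw E) := by
  have hm : Measurable fun p : Seed K × Fin K =>
      f (p.1.1, Function.update p.1.2.1 q p.2, p.1.2.2) := by
    refine hf.comp (Measurable.prodMk (by fun_prop) (Measurable.prodMk ?_ (by fun_prop)))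
    exact measurable_update'.comp (Measurable.prodMk (by fun_prop) (by fun_prop))
  unfold seedLaw
  rw [lintegral_prod _ hf.aemeasurable, lintegral_prod _ hm.lintegral_prod_right'.aemeasurable]
  refine lintegral_congr fun x => ?_
  have hf' : Measurable fun z => f (x, z) := hf.comp (by fun_prop)
  have hm' : Measurable fun p : ((ℕ × Finset (Fin K) → Fin K) × (ℕ × ℕ × ℕ → Bool)) × Fin K =>
      f (x, Function.update p.1.1 q p.2, p.1.2) :=
    hm.comp (f := fun p : ((ℕ × Finset (Fin K) → Fin K) × (ℕ × ℕ × ℕ → Bool)) × Fin K =>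
      ((x, p.1), p.2)) (by fun_prop)
  rw [lintegral_prod _ hf'.aemeasurable, lintegral_prod _ hm'.lintegral_prod_right'.aemeasurable,
    lintegral_update_infinitePi (fun q : ℕ × Finset (Fin K) => (uniformArm q.2).toMeasure) q
      hf'.lintegral_prod_right']
  refine lintegral_congr fun z => ?_
  rw [lintegral_lintegral_swap]
  refine (hm'.comp (f := fun p : Fin K × _ => ((z, p.2), p.1)) ?_).aemeasurable
  fun_prop

/-- Redrawing one replay bit. -/
theorem lintegral_seed_bit (q : ℕ × ℕ × ℕ) {f : Seed K → ENNReal} (hf : Measurable f) :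
    ∫⁻ ω, f ω ∂(seedLaw E)
      = ∫⁻ ω, ∫⁻ b, f (ω.1, ω.2.1, Function.update ω.2.2 q b)
          ∂(bernoulliMeasure true false (replayProb q.1 q.2.1 q.2.2)) ∂(seedLaw E) := by
  have hm : Measurable fun p : Seed K × Bool =>
      f (p.1.1, p.1.2.1, Function.update p.1.2.2 q p.2) := by
    refine hf.comp (Measurable.prodMk (by fun_prop) (Measurable.prodMk (by fun_prop) ?_))
    exact measurable_update'.comp (Measurable.prodMk (by fun_prop) (by fun_prop))
  unfold seedLaw
  rw [lintegral_prod _ hf.aemeasurable, lintegral_prod _ hm.lintegral_prod_right'.aemeasurable]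
  refine lintegral_congr fun x => ?_
  have hf' : Measurable fun z => f (x, z) := hf.comp (by fun_prop)
  have hm' : Measurable fun p : ((ℕ × Finset (Fin K) → Fin K) × (ℕ × ℕ × ℕ → Bool)) × Bool =>
      f (x, p.1.1, Function.update p.1.2 q p.2) :=
    hm.comp (f := fun p : ((ℕ × Finset (Fin K) → Fin K) × (ℕ × ℕ × ℕ → Bool)) × Bool =>
      ((x, p.1), p.2)) (by fun_prop)
  rw [lintegral_prod _ hf'.aemeasurable, lintegral_prod _ hm'.lintegral_prod_right'.aemeasurable]
  refine lintegral_congr fun z => ?_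
  have hf2 : Measurable fun w => f (x, z, w) := hf.comp (by fun_prop)
  rw [lintegral_update_infinitePi (fun q : ℕ × ℕ × ℕ =>
    bernoulliMeasure true false (replayProb q.1 q.2.1 q.2.2)) q hf2]

/-! ### What the state depends on -/

variable (C₀ : ℝ) (T : ℕ)

/-- The state before round `n + 1` depends on the rewards and arms of the rounds up to `n` and on the
replay bits of the rounds up to `n + 1`. -/
theorem metaState_congr {ω ω' : Seed K} (n : ℕ) (hY : ∀ s, s ≤ n → ω.1 s = ω'.1 s)
    (hU : ∀ s A, s ≤ n → ω.2.1 (s, A) = ω'.2.1 (s, A))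
    (hB : ∀ u s m, s ≤ n + 1 → ω.2.2 (u, s, m) = ω'.2.2 (u, s, m)) :
    metaState C₀ T ω n = metaState C₀ T ω' n := by
  induction n with
  | zero => rfl
  | succ n ih =>
    have hs := ih (fun s hs => hY s (by omega)) (fun s A hs => hU s A (by omega))
      (fun u s m hs => hB u s m (by omega))
    have hr := metaState_round C₀ T ω' n
    have hp : (metaState C₀ T ω' n).play ω = (metaState C₀ T ω' n).play ω' := by
      unfold State.play
      rw [hr]
      exact hU _ _ le_rfl
    simp only [metaState]
    rw [hs, hp, hr, hY _ le_rfl]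
    congr 1
    funext m
    exact hB _ _ _ le_rfl

theorem stateAt_congr {ω ω' : Seed K} {t : ℕ} (ht : 1 ≤ t) (hY : ∀ s, s < t → ω.1 s = ω'.1 s)
    (hU : ∀ s A, s < t → ω.2.1 (s, A) = ω'.2.1 (s, A))
    (hB : ∀ u s m, s ≤ t → ω.2.2 (u, s, m) = ω'.2.2 (u, s, m)) :
    stateAt C₀ T ω t = stateAt C₀ T ω' t :=
  metaState_congr C₀ T (t - 1) (fun s hs => hY s (by omega)) (fun s A hs => hU s A (by omega))
    (fun u s m hs => hB u s m (by omega))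

/-! ### Measurability of the run -/

/-- The part of the state that takes countably many values. -/
structure Control (K : ℕ) where
  epStart : ℕ
  master : Finset (Fin K)
  stack : List (Frame K)

instance : Countable (Frame K) :=
  Function.Injective.countable (f := fun f : Frame K => (f.start, f.dur, f.cand)) (by
    rintro ⟨a, b, c⟩ ⟨a', b', c'⟩ h
    simp only [Prod.mk.injEq] at h
    obtain ⟨rfl, rfl, rfl⟩ := h
    rfl)

instance : Countable (Control K) :=
  Function.Injective.countable (f := fun f : Control K => (f.epStart, f.master, f.stack)) (by
    rintro ⟨a, b, c⟩ ⟨a', b', c'⟩ h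
    simp only [Prod.mk.injEq] at h
    obtain ⟨rfl, rfl, rfl⟩ := h
    rfl)

/-- The discrete part of a state. -/
abbrev State.control (s : State K) : Control K := ⟨s.epStart, s.master, s.stack⟩

/-- The state with given discrete part, round and record. -/
abbrev Control.toState (c : Control K) (t : ℕ) (h : ℕ → Obs K) : State K :=
  ⟨t, c.epStart, c.master, c.stack, h⟩

theorem fiberMeasurable_resume {Ω : Type*} [MeasurableSpace Ω] {h : Ω → ℕ → Obs K}
    (hh : ∀ s a' a, Measurable fun ω => (h ω s).gapEst a' a) (c : Control K) (t : ℕ) :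
    FiberMeasurable fun ω => ((c.toState t (h ω)).resume C₀ T).control := by
  cases hd : c.stack.dropWhile (fun f => decide (f.start + f.dur < t)) with
  | nil =>
    have e : (fun ω => ((c.toState t (h ω)).resume C₀ T).control)
        = fun _ => (newEpisode (K := K) T t fun _ => ⟨0, 0, 0⟩).control := by
      funext ω
      unfold State.resume
      split
      · rfl
      · next f rest h => exact absurd (hd.symm.trans h) (by simp)
    rw [e]
    exact FiberMeasurable.const _
  | cons f rest =>
    have e : (fun ω => ((c.toState t (h ω)).resume C₀ T).control)
        = fun ω => if c.master \ evicted C₀ T (h ω) c.epStart t = ∅ then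
            (⟨t, Finset.univ, [⟨t, T + 1 - t, Finset.univ⟩]⟩ : Control K)
          else ⟨c.epStart, c.master \ evicted C₀ T (h ω) c.epStart t,
            ⟨f.start, f.dur, f.cand \ evicted C₀ T (h ω) f.start t⟩ :: rest⟩ := by
      funext ω
      unfold State.resume
      split
      · next hd' => exact absurd (hd.symm.trans hd') (by simp)
      · next f' rest' hd' =>
        obtain ⟨rfl, rfl⟩ := List.cons.inj (hd.symm.trans hd')
        by_cases hE : c.master \ evicted C₀ T (h ω) c.epStart t = ∅
        · rw [if_pos hE, if_pos hE]
          rfl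
        · rw [if_neg hE, if_neg hE]
    rw [e]
    refine (fiberMeasurable_evicted C₀ T hh c.epStart t).bind
      (g := fun A ω => if c.master \ A = ∅ then
            (⟨t, Finset.univ, [⟨t, T + 1 - t, Finset.univ⟩]⟩ : Control K)
          else ⟨c.epStart, c.master \ A,
            ⟨f.start, f.dur, f.cand \ evicted C₀ T (h ω) f.start t⟩ :: rest⟩) fun A => ?_
    exact (fiberMeasurable_evicted C₀ T hh f.start t).comp fun B => if c.master \ A = ∅ then
            (⟨t, Finset.univ, [⟨t, T + 1 - t, Finset.univ⟩]⟩ : Control K)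
          else ⟨c.epStart, c.master \ A, ⟨f.start, f.dur, f.cand \ B⟩ :: rest⟩

theorem fiberMeasurable_metaState (n : ℕ) :
    FiberMeasurable (fun ω : Seed K => (metaState C₀ T ω n).control) ∧
      ∀ s a' a, Measurable fun ω : Seed K => ((metaState C₀ T ω n).hist s).gapEst a' a := by
  induction n with
  | zero =>
    refine ⟨?_, fun s a' a => ?_⟩
    · simp only [metaState]
      exact FiberMeasurable.const _
    · simp only [metaState, newEpisode]
      exact measurable_const
  | succ n ih =>
    obtain ⟨ih1, ih2⟩ := ih
    -- the history after round `n + 1`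
    set h' : Seed K → ℕ → Obs K := fun ω => Function.update (metaState C₀ T ω n).hist (n + 1)
      ⟨(metaState C₀ T ω n).active.card, ω.2.1 (n + 1, (metaState C₀ T ω n).active),
        ω.1 (n + 1) (ω.2.1 (n + 1, (metaState C₀ T ω n).active))⟩ with hh'
    have hactive : FiberMeasurable fun ω : Seed K => (metaState C₀ T ω n).active :=
      ih1.comp fun c => (c.toState 0 fun _ => ⟨0, 0, 0⟩).active
    have hmeas : ∀ s a' a, Measurable fun ω : Seed K => (h' ω s).gapEst a' a := by
      intro s a' a
      by_cases hs : s = n + 1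
      · subst hs
        simp only [hh', Function.update_self]
        refine hactive.bind_measurable (g := fun A ω => (Obs.mk A.card (ω.2.1 (n + 1, A))
          (ω.1 (n + 1) (ω.2.1 (n + 1, A)))).gapEst a' a) fun A => ?_
        refine (fiberMeasurable_play (n + 1) A).bind_measurable
          (g := fun c ω => (Obs.mk A.card c (ω.1 (n + 1) c)).gapEst a' a) fun c => ?_
        simp only [Obs.gapEst]
        have hite : ∀ b : Fin K,
            Measurable fun ω : Seed K => if c = b then ω.1 (n + 1) c else 0 := fun b =>
          Measurable.ite (.const _) (measurable_seed_reward _ _) measurable_const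
        exact ((hite a').sub (hite a)).const_mul _
      · simp only [hh', Function.update_of_ne hs]
        exact ih2 s a' a
    have hround := fun ω : Seed K => metaState_round C₀ T ω n
    have hstep : ∀ ω : Seed K, metaState C₀ T ω (n + 1)
        = if hM : ((replayDurations T).filter fun m =>
              ω.2.2 ((metaState C₀ T ω n).epStart, n + 2, m) = true).Nonempty then
            ⟨n + 2, (metaState C₀ T ω n).epStart, (metaState C₀ T ω n).master,
              ⟨n + 2, Finset.max' _ hM, Finset.univ⟩ :: (metaState C₀ T ω n).stack, h' ω⟩
          else ((metaState C₀ T ω n).control.toState (n + 2) (h' ω)).resume C₀ T := by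
      intro ω
      simp only [metaState, State.step, State.play, hround ω, Control.toState, hh']
    have hhist : ∀ ω : Seed K, (metaState C₀ T ω (n + 1)).hist = h' ω := by
      intro ω
      rw [hstep ω]
      split_ifs
      · rfl
      · unfold State.resume
        split
        · rfl
        · simp only
          split_ifs <;> rfl
    refine ⟨?_, fun s a' a => ?_⟩
    · have e : (fun ω : Seed K => (metaState C₀ T ω (n + 1)).control)
          = fun ω => (fun (c : Control K) (ω : Seed K) =>
            if hM : ((replayDurations T).filter fun m =>
              ω.2.2 (c.epStart, n + 2, m) = true).Nonempty then
              (⟨c.epStart, c.master,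
                ⟨n + 2, Finset.max' _ hM, Finset.univ⟩ :: c.stack⟩ : Control K)
            else ((c.toState (n + 2) (h' ω)).resume C₀ T).control)
              (metaState C₀ T ω n).control ω := by
        funext ω
        rw [hstep ω]
        by_cases hM : ((replayDurations T).filter fun m =>
            ω.2.2 ((metaState C₀ T ω n).epStart, n + 2, m) = true).Nonempty
        · rw [dif_pos hM]
          change _ = dite ((replayDurations T).filter fun m =>
            ω.2.2 ((metaState C₀ T ω n).epStart, n + 2, m) = true).Nonempty _ _
          rw [dif_pos hM]
        · rw [dif_neg hM]
          change _ = dite ((replayDurations T).filter fun m =>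
            ω.2.2 ((metaState C₀ T ω n).epStart, n + 2, m) = true).Nonempty _ _
          rw [dif_neg hM]
      rw [e]
      refine ih1.bind (g := fun (c : Control K) (ω : Seed K) =>
            if hM : ((replayDurations T).filter fun m =>
              ω.2.2 (c.epStart, n + 2, m) = true).Nonempty then
              (⟨c.epStart, c.master,
                ⟨n + 2, Finset.max' _ hM, Finset.univ⟩ :: c.stack⟩ : Control K)
            else ((c.toState (n + 2) (h' ω)).resume C₀ T).control) fun c => ?_
      have hM : FiberMeasurable fun ω : Seed K => (replayDurations T).filter fun m =>
          ω.2.2 (c.epStart, n + 2, m) = true := by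
        refine FiberMeasurable.finset fun m => ?_
        simp only [Finset.mem_filter]
        refine (MeasurableSet.const _).inter ?_
        have : Measurable fun ω : Seed K => ω.2.2 (c.epStart, n + 2, m) := by fun_prop
        exact this (measurableSet_singleton true)
      refine hM.bind (g := fun (M : Finset ℕ) ω => if hM : M.Nonempty then
              (⟨c.epStart, c.master, ⟨n + 2, M.max' hM, Finset.univ⟩ :: c.stack⟩ : Control K)
            else ((c.toState (n + 2) (h' ω)).resume C₀ T).control) fun M => ?_
      by_cases hne : M.Nonempty
      · simp only [hne, dif_pos]
        exact FiberMeasurable.const _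
      · simp only [hne, dif_neg, not_false_eq_true]
        exact fiberMeasurable_resume C₀ T hmeas c (n + 2)
    · simp only [hhist]
      exact hmeas s a' a

theorem fiberMeasurable_cand (t : ℕ) :
    FiberMeasurable fun ω : Seed K => (metaRun C₀ T ω).cand t :=
  (fiberMeasurable_metaState C₀ T (t - 1)).1.comp fun c =>
    (c.toState 0 fun _ => ⟨0, 0, 0⟩).active

theorem fiberMeasurable_ep (t : ℕ) : FiberMeasurable fun ω : Seed K => (metaRun C₀ T ω).ep t :=
  (fiberMeasurable_metaState C₀ T (t - 1)).1.comp Control.epStart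

theorem obs_arm_eq (ω : Seed K) {t : ℕ} (ht : 1 ≤ t) :
    ((metaRun C₀ T ω).obs t).arm = ω.2.1 (t, (metaRun C₀ T ω).cand t) := by
  change (stateAt C₀ T ω t).play ω = _
  have h : (stateAt C₀ T ω t).round = t := by
    unfold stateAt
    rw [metaState_round]; omega
  unfold State.play
  rw [h]
  rfl

/-- Given the past, the arm of round `t` is uniform on the candidate set and the rewards have law
`E.law t`. -/
theorem lintegral_round {t : ℕ} (ht : 1 ≤ t) {Φ : Seed K → ENNReal} (hΦ : Measurable Φ)
    (hΦ' : ∀ ω ω' : Seed K, (∀ s, s < t → ω.1 s = ω'.1 s) →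
      (∀ s A, s < t → ω.2.1 (s, A) = ω'.2.1 (s, A)) → ω.2.2 = ω'.2.2 → Φ ω = Φ ω')
    {g : Finset (Fin K) → Fin K → (Fin K → ℝ) → ENNReal} (hg : ∀ A c, Measurable (g A c)) :
    ∫⁻ ω, Φ ω * g ((metaRun C₀ T ω).cand t) ((metaRun C₀ T ω).obs t).arm (ω.1 t) ∂(seedLaw E)
      = ∫⁻ ω, Φ ω * ∫⁻ y, ∫⁻ c, g ((metaRun C₀ T ω).cand t) c y
          ∂(uniformArm ((metaRun C₀ T ω).cand t)).toMeasure ∂(E.law t) ∂(seedLaw E) := by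
  classical
  have hcand := fiberMeasurable_cand (K := K) C₀ T t
  have hgm : ∀ A, Measurable fun p : (Fin K → ℝ) × Fin K => g A p.2 p.1 := fun A =>
    measurable_from_prod_countable_left fun c => hg A c
  have hgi : ∀ A, Measurable fun y => ∫⁻ c, g A c y ∂(uniformArm A).toMeasure := fun A =>
    (hgm A).lintegral_prod_right'
  -- for every possible candidate set `A`, the arm stored for `(t, A)` and the rewards of round `t` are
  -- independent of the event that the candidate set is `A`
  set Ψ : Finset (Fin K) → Seed K → ENNReal := fun A ω =>
    if (metaRun C₀ T ω).cand t = A then Φ ω else 0 with hΨ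
  have hΨm : ∀ A, Measurable (Ψ A) := fun A =>
    Measurable.ite (hcand {A}) hΦ measurable_const
  have hΨ' : ∀ A, ∀ ω ω' : Seed K, (∀ s, s < t → ω.1 s = ω'.1 s) →
      (∀ s A, s < t → ω.2.1 (s, A) = ω'.2.1 (s, A)) → ω.2.2 = ω'.2.2 → Ψ A ω = Ψ A ω' := by
    intro A ω ω' h1 h2 h3
    have hc : (metaRun C₀ T ω).cand t = (metaRun C₀ T ω').cand t := by
      change (stateAt C₀ T ω t).active = (stateAt C₀ T ω' t).active
      rw [stateAt_congr C₀ T ht h1 h2 (fun u s m _ => by rw [h3])]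
    simp only [hΨ, hc, hΦ' ω ω' h1 h2 h3]
  have key : ∀ A, ∫⁻ ω, Ψ A ω * g A (ω.2.1 (t, A)) (ω.1 t) ∂(seedLaw E)
      = ∫⁻ ω, Ψ A ω * ∫⁻ y, ∫⁻ c, g A c y ∂(uniformArm A).toMeasure ∂(E.law t) ∂(seedLaw E) := by
    intro A
    have m1 : Measurable fun ω : Seed K => Ψ A ω * g A (ω.2.1 (t, A)) (ω.1 t) := by
      refine (hΨm A).mul ?_
      exact (hgm A).comp (f := fun ω : Seed K => (ω.1 t, ω.2.1 (t, A))) (by fun_prop)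
    have m2 : Measurable fun ω : Seed K =>
        Ψ A ω * ∫⁻ c, g A c (ω.1 t) ∂(uniformArm A).toMeasure := by
      refine (hΨm A).mul ?_
      exact (hgi A).comp (f := fun ω : Seed K => ω.1 t) (by fun_prop)
    rw [lintegral_seed_arm E (t, A) m1]
    have e1 : ∀ ω : Seed K, ∫⁻ c, Ψ A (ω.1, Function.update ω.2.1 (t, A) c, ω.2.2)
          * g A (Function.update ω.2.1 (t, A) c (t, A)) (ω.1 t) ∂(uniformArm A).toMeasure
        = Ψ A ω * ∫⁻ c, g A c (ω.1 t) ∂(uniformArm A).toMeasure := by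
      intro ω
      rw [← lintegral_const_mul _ (Measurable.of_discrete)]
      refine lintegral_congr fun c => ?_
      rw [Function.update_self, hΨ' A (ω.1, Function.update ω.2.1 (t, A) c, ω.2.2) ω
        (fun _ _ => rfl) (fun s A' hs => ?_) rfl]
      exact Function.update_of_ne (fun h => by
        have := (Prod.ext_iff.1 h).1
        omega) _ _
    refine (lintegral_congr e1).trans ?_
    rw [lintegral_seed_reward E t m2]
    refine lintegral_congr fun ω => ?_
    rw [← lintegral_const_mul _ (hgi A)]
    refine lintegral_congr fun y => ?_
    simp only [Function.update_self]
    rw [hΨ' A (Function.update ω.1 t y, ω.2) ω (fun s hs => Function.update_of_ne hs.ne _ _)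
      (fun _ _ _ => rfl) rfl]
  have s1 : ∀ ω : Seed K,
      Φ ω * g ((metaRun C₀ T ω).cand t) ((metaRun C₀ T ω).obs t).arm (ω.1 t)
        = ∑ A, Ψ A ω * g A (ω.2.1 (t, A)) (ω.1 t) := by
    intro ω
    rw [Finset.sum_eq_single ((metaRun C₀ T ω).cand t)]
    · simp only [hΨ, if_true, obs_arm_eq C₀ T ω ht]
    · intro A _ hA
      simp only [hΨ, if_neg (Ne.symm hA), zero_mul]
    · simp
  have s2 : ∀ ω : Seed K, Φ ω * ∫⁻ y, ∫⁻ c, g ((metaRun C₀ T ω).cand t) c y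
          ∂(uniformArm ((metaRun C₀ T ω).cand t)).toMeasure ∂(E.law t)
        = ∑ A, Ψ A ω * ∫⁻ y, ∫⁻ c, g A c y ∂(uniformArm A).toMeasure ∂(E.law t) := by
    intro ω
    rw [Finset.sum_eq_single ((metaRun C₀ T ω).cand t)]
    · simp only [hΨ, if_true]
    · intro A _ hA
      simp only [hΨ, if_neg (Ne.symm hA), zero_mul]
    · simp
  rw [lintegral_congr s1, lintegral_congr s2, lintegral_finsetSum, lintegral_finsetSum]
  · exact Finset.sum_congr rfl fun A _ => key A
  · exact fun A _ => (hΨm A).mul_const _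
  · intro A _
    refine (hΨm A).mul ?_
    exact (hgm A).comp (f := fun ω : Seed K => (ω.1 t, ω.2.1 (t, A))) (by fun_prop)

/-- Given the past, a replay of duration `m` is called for in the next round with probability
`replayProb`. -/
theorem lintegral_bit {t : ℕ} (ht : 1 ≤ t) (m : ℕ) :
    ∫⁻ ω, (if ω.2.2 ((metaRun C₀ T ω).ep t, t + 1, m) = true then 1 else 0) ∂(seedLaw E)
      = ∫⁻ ω, ENNReal.ofReal (replayProb ((metaRun C₀ T ω).ep t) (t + 1) m) ∂(seedLaw E) := by
  have hep := fiberMeasurable_ep (K := K) C₀ T t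
  -- for every possible start `u` of the episode, the bit stored for `(u, t + 1, m)` is independent of
  -- the event that the episode starts at `u`
  set Ψ : ℕ → Seed K → ENNReal := fun u ω => if (metaRun C₀ T ω).ep t = u then 1 else 0 with hΨ
  have hΨm : ∀ u, Measurable (Ψ u) := fun u =>
    Measurable.ite (hep {u}) measurable_const measurable_const
  have m0 : ∀ u, Measurable fun ω : Seed K =>
      (if ω.2.2 (u, t + 1, m) = true then (1 : ENNReal) else 0) := fun u => by
    refine Measurable.ite ?_ measurable_const measurable_const
    have : Measurable fun ω : Seed K => ω.2.2 (u, t + 1, m) := by fun_prop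
    exact this (measurableSet_singleton true)
  have key : ∀ u, ∫⁻ ω, Ψ u ω * (if ω.2.2 (u, t + 1, m) = true then 1 else 0) ∂(seedLaw E)
      = ∫⁻ ω, Ψ u ω * ENNReal.ofReal (replayProb u (t + 1) m) ∂(seedLaw E) := by
    intro u
    have m1 : Measurable fun ω : Seed K =>
        Ψ u ω * (if ω.2.2 (u, t + 1, m) = true then (1 : ENNReal) else 0) := (hΨm u).mul (m0 u)
    rw [lintegral_seed_bit E (u, t + 1, m) m1]
    refine lintegral_congr fun ω => ?_
    have e1 : ∀ b, Ψ u (ω.1, ω.2.1, Function.update ω.2.2 (u, t + 1, m) b) = Ψ u ω := by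
      intro b
      have : (metaRun C₀ T (ω.1, ω.2.1, Function.update ω.2.2 (u, t + 1, m) b)).ep t
          = (metaRun C₀ T ω).ep t := by
        change (stateAt C₀ T _ t).epStart = (stateAt C₀ T ω t).epStart
        refine congrArg State.epStart
          (stateAt_congr C₀ T ht (fun _ _ => rfl) (fun _ _ _ => rfl) fun u1 s m1 hs => ?_)
        change Function.update ω.2.2 (u, t + 1, m) b (u1, s, m1) = ω.2.2 (u1, s, m1)
        refine Function.update_of_ne (fun h => ?_) _ _
        have h2 : s = t + 1 := congrArg (fun q : ℕ × ℕ × ℕ => q.2.1) h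
        omega
      simp only [hΨ, this]
    simp only [e1, Function.update_self]
    rw [lintegral_const_mul _ Measurable.of_discrete, bernoulliMeasure_def,
      lintegral_add_measure, lintegral_smul_measure, lintegral_smul_measure, lintegral_dirac,
      lintegral_dirac]
    simp only [if_true, Bool.false_eq_true, if_false, smul_zero, add_zero]
    congr 1
    rw [ENNReal.smul_def, smul_eq_mul, mul_one, ENNReal.ofReal]
    congr 1
    ext
    rw [Real.coe_toNNReal _ (replayProb u (t + 1) m).2.1]
    rfl
  have s1 : ∀ (ω : Seed K) (F : ℕ → ENNReal), F ((metaRun C₀ T ω).ep t) = ∑' u, Ψ u ω * F u := by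
    intro ω F
    rw [tsum_eq_single ((metaRun C₀ T ω).ep t)]
    · simp [hΨ]
    · intro u hu
      simp [hΨ, Ne.symm hu]
  rw [lintegral_congr fun ω => s1 ω fun u => if ω.2.2 (u, t + 1, m) = true then 1 else 0,
    lintegral_congr fun ω => s1 ω fun u => ENNReal.ofReal (replayProb u (t + 1) m),
    lintegral_tsum, lintegral_tsum]
  · exact tsum_congr key
  · exact fun u => ((hΨm u).mul_const _).aemeasurable
  · exact fun u => ((hΨm u).mul (m0 u)).aemeasurable

end

section

variable {K : ℕ}

/-! ### Concentration of the estimates -/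

/-- The deviation of the estimate `δ̂_t(a', a)` from its mean, if arm `c` is drawn from `A` and the
reward vector is `y`. -/
noncomputable def estDev (E : Environment K) (t : ℕ) (a' a : Fin K) (A : Finset (Fin K)) (c : Fin K)
    (y : Fin K → ℝ) : ℝ :=
  (A.card : ℝ) * ((if c = a' then y c else 0) - (if c = a then y c else 0))
    - ((if a' ∈ A then E.mean t a' else 0) - (if a ∈ A then E.mean t a else 0))

theorem measurable_estDev (E : Environment K) (t : ℕ) (a' a : Fin K) (A : Finset (Fin K))
    (c : Fin K) : Measurable (estDev E t a' a A c) := by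
  have hite : ∀ b : Fin K, Measurable fun y : Fin K → ℝ => if c = b then y c else 0 := fun b =>
    Measurable.ite (.const _) (measurable_pi_apply c) measurable_const
  exact (((hite a').sub (hite a)).const_mul _).sub_const _

theorem lintegral_uniformArm [NeZero K] {A : Finset (Fin K)} (hA : A.Nonempty) (f : Fin K → ℝ)
    (hf : ∀ c, 0 ≤ f c) : ∫⁻ c, ENNReal.ofReal (f c) ∂(uniformArm A).toMeasure
      = ENNReal.ofReal (1 / (A.card : ℝ) * ∑ c ∈ A, f c) := by
  have hc : (0 : ℝ) < A.card := by exact_mod_cast hA.card_pos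
  rw [lintegral_fintype, Finset.mul_sum,
    ENNReal.ofReal_sum_of_nonneg fun c _ => mul_nonneg (by positivity) (hf c),
    ← Finset.sum_subset (Finset.subset_univ A)]
  · refine Finset.sum_congr rfl fun c hcA => ?_
    rw [PMF.toMeasure_apply_singleton _ _ (measurableSet_singleton c), uniformArm, dif_pos hA,
      PMF.uniformOfFinset_apply_of_mem _ hcA, mul_comm (1 / (A.card : ℝ)),
      ENNReal.ofReal_mul (hf c), one_div, ENNReal.ofReal_inv_of_pos hc, ENNReal.ofReal_natCast]
  · intro c _ hcA
    rw [PMF.toMeasure_apply_singleton _ _ (measurableSet_singleton c), uniformArm, dif_pos hA,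
      PMF.uniformOfFinset_apply_of_notMem _ hcA, mul_zero]

/-- For a fixed reward vector, the average over the arms of the exponential of the deviation. The
second moment is of order `K`, not `K ^ 2`, as only two arms contribute. -/
theorem avg_exp_estDev_le (E : Environment K) (t : ℕ) (a' a : Fin K) {A : Finset (Fin K)}
    (hA : A.Nonempty) {l : ℝ} (hl : 0 ≤ l) (hKl : 2 * K * l ≤ 1) {y : Fin K → ℝ}
    (hy : ∀ b, y b ∈ Set.Icc (0 : ℝ) 1) :
    1 / (A.card : ℝ) * ∑ c ∈ A, Real.exp (l * estDev E t a' a A c y)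
      ≤ 1 + 6 * K * l ^ 2 + l * ((if a' ∈ A then y a' - E.mean t a' else 0)
        - (if a ∈ A then y a - E.mean t a else 0)) := by
  have hc0 : (0 : ℝ) < A.card := by exact_mod_cast hA.card_pos
  have hc1 : (1 : ℝ) ≤ A.card := by exact_mod_cast hA.card_pos
  have hcK : (A.card : ℝ) ≤ K := by
    have := A.card_le_univ
    rw [Fintype.card_fin] at this
    exact_mod_cast this
  set k : ℝ := (A.card : ℝ) with hk
  set M : ℝ := (if a' ∈ A then E.mean t a' else 0) - (if a ∈ A then E.mean t a else 0) with hM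
  have hm : ∀ b : Fin K, 0 ≤ (if b ∈ A then E.mean t b else 0) ∧
      (if b ∈ A then E.mean t b else 0) ≤ 1 := by
    intro b
    split_ifs
    · exact ⟨E.mean_nonneg t b, E.mean_le_one t b⟩
    · exact ⟨le_rfl, zero_le_one⟩
  have hM1 : |M| ≤ 1 := by
    rw [abs_le]
    constructor <;> linarith [(hm a').1, (hm a').2, (hm a).1, (hm a).2]
  have hp : ∀ b c : Fin K, 0 ≤ (if c = b then y c else 0) ∧ (if c = b then y c else 0) ≤ 1 := by
    intro b c
    split_ifs
    · exact hy c
    · exact ⟨le_rfl, zero_le_one⟩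
  have hpsq : ∀ b c : Fin K, (if c = b then y c else 0) ^ 2 ≤ (if c = b then (1 : ℝ) else 0) := by
    intro b c
    split_ifs
    · nlinarith [(hy c).1, (hy c).2]
    · simp
  have hterm : ∀ c ∈ A, Real.exp (l * estDev E t a' a A c y)
      ≤ 1 + l * estDev E t a' a A c y + l ^ 2 * (2 * (k ^ 2 * ((if c = a' then (1 : ℝ) else 0)
        + (if c = a then (1 : ℝ) else 0))) + 2) := by
    intro c _
    set p := (if c = a' then y c else 0) with hp'
    set q := (if c = a then y c else 0) with hq'
    have e : estDev E t a' a A c y = k * (p - q) - M := rfl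
    obtain ⟨p0, p1⟩ := hp a' c
    obtain ⟨q0, q1⟩ := hp a c
    have hX : |k * (p - q)| ≤ k := by
      rw [abs_mul, abs_of_pos hc0]
      have : |p - q| ≤ 1 := by rw [abs_le]; constructor <;> linarith
      nlinarith
    have hd : |estDev E t a' a A c y| ≤ 2 * K := by
      rw [e]
      refine (abs_sub _ _).trans ?_
      linarith
    have hx : |l * estDev E t a' a A c y| ≤ 1 := by
      rw [abs_mul, abs_of_nonneg hl]
      calc l * |estDev E t a' a A c y| ≤ l * (2 * K) := by gcongr
        _ ≤ 1 := by linarith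
    have hexp := (abs_le.1 (Real.abs_exp_sub_one_sub_id_le hx)).2
    have hsq : (estDev E t a' a A c y) ^ 2 ≤ 2 * (k ^ 2 * ((if c = a' then (1 : ℝ) else 0)
        + (if c = a then (1 : ℝ) else 0))) + 2 := by
      rw [e]
      have h1 : (p - q) ^ 2 ≤ (if c = a' then (1 : ℝ) else 0) + (if c = a then (1 : ℝ) else 0) := by
        have := hpsq a' c
        have := hpsq a c
        nlinarith [mul_nonneg p0 q0]
      have h2 : M ^ 2 ≤ 1 := (sq_le_one_iff_abs_le_one M).2 hM1
      have h3 : k ^ 2 * (p - q) ^ 2 ≤ k ^ 2 * ((if c = a' then (1 : ℝ) else 0)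
        + (if c = a then (1 : ℝ) else 0)) := by gcongr
      nlinarith [sq_nonneg (k * (p - q) + M)]
    have := mul_le_mul_of_nonneg_left hsq (sq_nonneg l)
    rw [mul_pow] at hexp
    linarith
  have hsum := Finset.sum_le_sum hterm
  have hind : ∀ b : Fin K, ∑ c ∈ A, (if c = b then (1 : ℝ) else 0) ≤ 1 := by
    intro b
    rw [Finset.sum_ite_eq' A b]
    split_ifs <;> norm_num
  have hindy : ∀ b : Fin K, ∑ c ∈ A, (if c = b then y c else 0) = if b ∈ A then y b else 0 :=
    fun b => Finset.sum_ite_eq' A b y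
  have hmean : ∑ c ∈ A, estDev E t a' a A c y = k * ((if a' ∈ A then y a' - E.mean t a' else 0)
        - (if a ∈ A then y a - E.mean t a else 0)) := by
    have e : ∀ c ∈ A, estDev E t a' a A c y
        = k * ((if c = a' then y c else 0) - (if c = a then y c else 0)) - M := fun c _ => rfl
    rw [Finset.sum_congr rfl e, Finset.sum_sub_distrib, ← Finset.mul_sum, Finset.sum_sub_distrib,
      hindy, hindy, Finset.sum_const, nsmul_eq_mul, ← hk, ← mul_sub, hM]
    congr 1
    split_ifs <;> ring
  have htot : ∑ c ∈ A, (1 + l * estDev E t a' a A c y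
        + l ^ 2 * (2 * (k ^ 2 * ((if c = a' then (1 : ℝ) else 0)
        + (if c = a then (1 : ℝ) else 0))) + 2))
      ≤ k * (1 + 6 * K * l ^ 2 + l * ((if a' ∈ A then y a' - E.mean t a' else 0)
        - (if a ∈ A then y a - E.mean t a else 0))) := by
    rw [Finset.sum_add_distrib, Finset.sum_add_distrib, ← Finset.mul_sum, hmean, Finset.sum_const,
      nsmul_eq_mul, ← hk, ← Finset.mul_sum, Finset.sum_add_distrib, ← Finset.mul_sum,
      ← Finset.mul_sum, Finset.sum_add_distrib, Finset.sum_const, nsmul_eq_mul, ← hk]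
    have h1 := hind a'
    have h2 := hind a
    have h3 : 2 * (k ^ 2 * (∑ c ∈ A, (if c = a' then (1 : ℝ) else 0)
        + ∑ c ∈ A, (if c = a then (1 : ℝ) else 0))) + k * 2 ≤ 6 * K * k := by
      have : k ^ 2 * (∑ c ∈ A, (if c = a' then (1 : ℝ) else 0)
        + ∑ c ∈ A, (if c = a then (1 : ℝ) else 0)) ≤ k ^ 2 * 2 := by
        gcongr
        linarith
      nlinarith
    have := mul_le_mul_of_nonneg_left h3 (sq_nonneg l)
    linarith
  rw [one_div, inv_mul_le_iff₀ hc0]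
  exact hsum.trans htot

/-- Exponential moment of one deviation, given the past. -/
theorem lintegral_exp_estDev_le [NeZero K] (E : Environment K) (t : ℕ) (a' a : Fin K)
    (A : Finset (Fin K)) {l : ℝ} (hl : 0 ≤ l) (hKl : 2 * K * l ≤ 1) :
    ∫⁻ y, ∫⁻ c, ENNReal.ofReal (Real.exp (l * estDev E t a' a A c y)) ∂(uniformArm A).toMeasure
      ∂(E.law t) ≤ ENNReal.ofReal (Real.exp (6 * K * l ^ 2)) := by
  rcases A.eq_empty_or_nonempty with rfl | hA
  · have : ∀ c y, estDev E t a' a ∅ c y = 0 := fun c y => by simp [estDev]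
    simp only [this, mul_zero, Real.exp_zero, lintegral_const, measure_univ, mul_one]
    exact ENNReal.ofReal_le_ofReal (Real.one_le_exp (by positivity))
  · set h : (Fin K → ℝ) → ℝ := fun y => 1 + 6 * K * l ^ 2
      + l * ((if a' ∈ A then y a' - E.mean t a' else 0)
        - (if a ∈ A then y a - E.mean t a else 0)) with hh
    have hle : ∀ᵐ y ∂(E.law t), ∫⁻ c, ENNReal.ofReal (Real.exp (l * estDev E t a' a A c y))
        ∂(uniformArm A).toMeasure ≤ ENNReal.ofReal (h y) := by
      filter_upwards [E.reward_mem t] with y hy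
      rw [lintegral_uniformArm hA _ fun c => (Real.exp_pos _).le]
      exact ENNReal.ofReal_le_ofReal (avg_exp_estDev_le E t a' a hA hl hKl hy)
    have hnn : 0 ≤ᵐ[E.law t] h := by
      filter_upwards [E.reward_mem t] with y hy
      refine le_trans ?_ (avg_exp_estDev_le E t a' a hA hl hKl hy)
      exact mul_nonneg (by positivity) (Finset.sum_nonneg fun c _ => (Real.exp_pos _).le)
    have hi : ∀ b : Fin K, Integrable (fun y : Fin K → ℝ => if b ∈ A then y b - E.mean t b else 0)
        (E.law t) ∧ ∫ y, (if b ∈ A then y b - E.mean t b else 0) ∂(E.law t) = 0 := by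
      intro b
      split_ifs
      · refine ⟨(E.integrable_apply t b).sub (integrable_const _), ?_⟩
        rw [integral_sub (E.integrable_apply t b) (integrable_const _), integral_const]
        simp [Environment.mean]
      · exact ⟨integrable_const _, by simp⟩
    have hd := (hi a').1.sub (hi a).1
    have hint : Integrable h (E.law t) := (integrable_const _).add (hd.const_mul l)
    have hval : ∫ y, h y ∂(E.law t) = 1 + 6 * K * l ^ 2 := by
      have e : ∫ y, h y ∂(E.law t) = ∫ _y, (1 + 6 * K * l ^ 2) ∂(E.law t)
          + ∫ y, l * ((if a' ∈ A then y a' - E.mean t a' else 0)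
            - (if a ∈ A then y a - E.mean t a else 0)) ∂(E.law t) :=
        integral_add (integrable_const _) (hd.const_mul l)
      rw [e, integral_const_mul, integral_sub (hi a').1 (hi a).1, (hi a').2, (hi a).2]
      simp
    refine (lintegral_mono_ae hle).trans ?_
    rw [← ofReal_integral_eq_lintegral_ofReal hint hnn, hval]
    refine ENNReal.ofReal_le_ofReal ?_
    linarith [Real.add_one_le_exp (6 * K * l ^ 2)]

variable [NeZero K] (E : Environment K) (C₀ : ℝ) (T : ℕ)

theorem gapEst_sub_meanEst (ω : Seed K) (t : ℕ) (a' a : Fin K) :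
    ((metaRun C₀ T ω).obs t).gapEst a' a - (metaRun C₀ T ω).meanEst E t a' a
      = estDev E t a' a ((metaRun C₀ T ω).cand t) ((metaRun C₀ T ω).obs t).arm (ω.1 t) := rfl

theorem measurable_deviation {t : ℕ} (ht : 1 ≤ t) (a' a : Fin K) : Measurable fun ω : Seed K =>
    ((metaRun C₀ T ω).obs t).gapEst a' a - (metaRun C₀ T ω).meanEst E t a' a := by
  simp only [gapEst_sub_meanEst, obs_arm_eq C₀ T _ ht]
  refine (fiberMeasurable_cand C₀ T t).bind_measurable
    (g := fun A ω => estDev E t a' a A (ω.2.1 (t, A)) (ω.1 t)) fun A => ?_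
  refine (fiberMeasurable_play t A).bind_measurable
    (g := fun c ω => estDev E t a' a A c (ω.1 t)) fun c => ?_
  exact (measurable_estDev E t a' a A c).comp (by fun_prop)

theorem obs_congr {ω ω' : Seed K} {t : ℕ} (ht : 1 ≤ t) (hY : ∀ s, s ≤ t → ω.1 s = ω'.1 s)
    (hU : ∀ s A, s ≤ t → ω.2.1 (s, A) = ω'.2.1 (s, A)) (hB : ω.2.2 = ω'.2.2) :
    (metaRun C₀ T ω).obs t = (metaRun C₀ T ω').obs t ∧
      (metaRun C₀ T ω).cand t = (metaRun C₀ T ω').cand t := by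
  have hs : stateAt C₀ T ω t = stateAt C₀ T ω' t :=
    stateAt_congr C₀ T ht (fun s h => hY s h.le) (fun s A h => hU s A h.le) fun u s m _ => by rw [hB]
  have hcand : (metaRun C₀ T ω).cand t = (metaRun C₀ T ω').cand t := congrArg State.active hs
  have harm : ((metaRun C₀ T ω).obs t).arm = ((metaRun C₀ T ω').obs t).arm := by
    rw [obs_arm_eq C₀ T ω ht, obs_arm_eq C₀ T ω' ht, hcand, hU _ _ le_rfl]
  refine ⟨?_, hcand⟩
  change Obs.mk ((metaRun C₀ T ω).cand t).card ((metaRun C₀ T ω).obs t).arm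
      (ω.1 t ((metaRun C₀ T ω).obs t).arm)
    = Obs.mk ((metaRun C₀ T ω').cand t).card ((metaRun C₀ T ω').obs t).arm
      (ω'.1 t ((metaRun C₀ T ω').obs t).arm)
  rw [hcand, harm, hY t le_rfl]

/-- The exponential moments of the aggregate deviations. -/
theorem lintegral_exp_sum_le {s₁ : ℕ} (hs₁ : 1 ≤ s₁) (a' a : Fin K) {l : ℝ} (hl : 0 ≤ l)
    (hKl : 2 * K * l ≤ 1) (n : ℕ) :
    ∫⁻ ω, ENNReal.ofReal (Real.exp (l * ∑ s ∈ Finset.Ico s₁ (s₁ + n),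
        (((metaRun C₀ T ω).obs s).gapEst a' a - (metaRun C₀ T ω).meanEst E s a' a))) ∂(seedLaw E)
      ≤ ENNReal.ofReal (Real.exp (6 * K * l ^ 2 * n)) := by
  induction n with
  | zero => simp
  | succ n ih =>
    set Φ : Seed K → ENNReal := fun ω => ENNReal.ofReal (Real.exp (l * ∑ s ∈ Finset.Ico s₁ (s₁ + n),
        (((metaRun C₀ T ω).obs s).gapEst a' a - (metaRun C₀ T ω).meanEst E s a' a))) with hΦ
    have ht : 1 ≤ s₁ + n := by omega
    have hΦm : Measurable Φ := by
      refine ENNReal.measurable_ofReal.comp (Real.measurable_exp.comp ?_)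
      refine (Finset.measurable_sum _ fun s hs => ?_).const_mul l
      exact measurable_deviation E C₀ T (hs₁.trans (Finset.mem_Ico.1 hs).1) a' a
    have hΦ' : ∀ ω ω' : Seed K, (∀ s, s < s₁ + n → ω.1 s = ω'.1 s) →
        (∀ s A, s < s₁ + n → ω.2.1 (s, A) = ω'.2.1 (s, A)) → ω.2.2 = ω'.2.2 → Φ ω = Φ ω' := by
      intro ω ω' h1 h2 h3
      simp only [hΦ]
      congr 3
      refine Finset.sum_congr rfl fun s hs => ?_
      obtain ⟨hs1, hs2⟩ := Finset.mem_Ico.1 hs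
      obtain ⟨e1, e2⟩ := obs_congr C₀ T (hs₁.trans hs1) (fun s' h => h1 s' (by omega))
        (fun s' A h => h2 s' A (by omega)) h3
      rw [e1, Run.meanEst, Run.meanEst, e2]
    have hsplit : ∀ ω : Seed K, ENNReal.ofReal (Real.exp (l * ∑ s ∈ Finset.Ico s₁ (s₁ + (n + 1)),
        (((metaRun C₀ T ω).obs s).gapEst a' a - (metaRun C₀ T ω).meanEst E s a' a)))
        = Φ ω * ENNReal.ofReal (Real.exp (l * estDev E (s₁ + n) a' a
          ((metaRun C₀ T ω).cand (s₁ + n)) ((metaRun C₀ T ω).obs (s₁ + n)).arm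
            (ω.1 (s₁ + n)))) := by
      intro ω
      rw [← add_assoc, Finset.sum_Ico_succ_top (by omega), mul_add, Real.exp_add,
        ENNReal.ofReal_mul (Real.exp_pos _).le, gapEst_sub_meanEst E C₀ T ω (s₁ + n)]
    rw [lintegral_congr hsplit, lintegral_round E C₀ T ht hΦm hΦ'
      (g := fun A c y => ENNReal.ofReal (Real.exp (l * estDev E (s₁ + n) a' a A c y)))
      fun A c => ENNReal.measurable_ofReal.comp
        (Real.measurable_exp.comp ((measurable_estDev E (s₁ + n) a' a A c).const_mul l))]
    calc ∫⁻ ω, Φ ω * ∫⁻ y, ∫⁻ c, ENNReal.ofReal (Real.exp (l * estDev E (s₁ + n) a' a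
            ((metaRun C₀ T ω).cand (s₁ + n)) c y))
            ∂(uniformArm ((metaRun C₀ T ω).cand (s₁ + n))).toMeasure ∂(E.law (s₁ + n)) ∂(seedLaw E)
        ≤ ∫⁻ ω, Φ ω * ENNReal.ofReal (Real.exp (6 * K * l ^ 2)) ∂(seedLaw E) := by
          refine lintegral_mono fun ω => ?_
          gcongr
          exact lintegral_exp_estDev_le E (s₁ + n) a' a _ hl hKl
      _ = (∫⁻ ω, Φ ω ∂(seedLaw E)) * ENNReal.ofReal (Real.exp (6 * K * l ^ 2)) :=
          lintegral_mul_const _ hΦm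
      _ ≤ ENNReal.ofReal (Real.exp (6 * K * l ^ 2 * n))
            * ENNReal.ofReal (Real.exp (6 * K * l ^ 2)) := by gcongr
      _ = ENNReal.ofReal (Real.exp (6 * K * l ^ 2 * ((n + 1 : ℕ) : ℝ))) := by
          rw [← ENNReal.ofReal_mul (Real.exp_pos _).le, ← Real.exp_add]
          congr 2
          push_cast
          ring

/-- One-sided tail bound, from the exponential moment at `l = 1 / (2 √(K n ∨ K²))`. -/
theorem measure_deviation_le {s₁ s₂ : ℕ} (hs₁ : 1 ≤ s₁) (hs : s₁ < s₂) (a' a : Fin K) :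
    seedLaw E {ω | 20 * Real.log T * √(max ((K : ℝ) * ((s₂ : ℝ) - (s₁ : ℝ))) ((K : ℝ) ^ 2))
        < ∑ s ∈ Finset.Icc s₁ s₂,
          (((metaRun C₀ T ω).obs s).gapEst a' a - (metaRun C₀ T ω).meanEst E s a' a)}
      ≤ ENNReal.ofReal (Real.exp 3 * Real.exp (-(10 * Real.log T))) := by
  have hK : (1 : ℝ) ≤ K := by exact_mod_cast NeZero.one_le
  set v : ℝ := max ((K : ℝ) * ((s₂ : ℝ) - (s₁ : ℝ))) ((K : ℝ) ^ 2) with hv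
  have hv0 : 0 < v := lt_of_lt_of_le (by positivity) (le_max_right _ _)
  have hr0 : 0 < √v := Real.sqrt_pos.2 hv0
  have hsq : √v ^ 2 = v := Real.sq_sqrt hv0.le
  set l : ℝ := 1 / (2 * √v) with hl
  have hl0 : 0 ≤ l := by positivity
  have hKl : 2 * K * l ≤ 1 := by
    have : (K : ℝ) ≤ √v := Real.le_sqrt_of_sq_le (le_max_right _ _)
    rw [hl, mul_one_div, div_le_one (by positivity)]
    linarith
  obtain ⟨n, rfl⟩ : ∃ n, s₂ = s₁ + n := ⟨s₂ - s₁, by omega⟩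
  have hn : (1 : ℝ) ≤ n := by exact_mod_cast (by omega : 1 ≤ n)
  have hIcc : Finset.Icc s₁ (s₁ + n) = Finset.Ico s₁ (s₁ + (n + 1)) := by
    ext s
    simp only [Finset.mem_Icc, Finset.mem_Ico]
    omega
  have hexpo : 6 * K * l ^ 2 * ((n + 1 : ℕ) : ℝ) ≤ 3 := by
    have e : 6 * K * l ^ 2 * ((n + 1 : ℕ) : ℝ) = 6 * (K * ((n : ℝ) + 1)) / (4 * v) := by
      rw [hl, div_pow, mul_pow, hsq]
      push_cast
      ring
    have h1 : (K : ℝ) * n ≤ v := by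
      refine le_trans (le_of_eq ?_) (le_max_left _ _)
      push_cast
      ring
    rw [e, div_le_iff₀ (by positivity)]
    nlinarith
  have hm := lintegral_exp_sum_le E C₀ T hs₁ a' a hl0 hKl (n + 1)
  rw [← hIcc] at hm
  set Z : Seed K → ℝ := fun ω => ∑ s ∈ Finset.Icc s₁ (s₁ + n),
    (((metaRun C₀ T ω).obs s).gapEst a' a - (metaRun C₀ T ω).meanEst E s a' a) with hZ
  have hZm : Measurable Z := Finset.measurable_sum _ fun s hs =>
    measurable_deviation E C₀ T (hs₁.trans (Finset.mem_Icc.1 hs).1) a' a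
  have hfm : Measurable fun ω => ENNReal.ofReal (Real.exp (l * Z ω)) :=
    ENNReal.measurable_ofReal.comp (Real.measurable_exp.comp (hZm.const_mul l))
  have hsub : {ω | 20 * Real.log T * √v < Z ω} ⊆
      {ω | ENNReal.ofReal (Real.exp (10 * Real.log T)) ≤ ENNReal.ofReal (Real.exp (l * Z ω))} := by
    intro ω hω
    refine ENNReal.ofReal_le_ofReal (Real.exp_le_exp.2 ?_)
    have e : 10 * Real.log T = l * (20 * Real.log T * √v) := by
      rw [hl]
      field_simp
      ring
    rw [e]
    exact mul_le_mul_of_nonneg_left (le_of_lt hω) hl0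
  have hpos := Real.exp_pos (10 * Real.log T)
  calc seedLaw E {ω | 20 * Real.log T * √v < Z ω}
      ≤ seedLaw E {ω | ENNReal.ofReal (Real.exp (10 * Real.log T))
          ≤ ENNReal.ofReal (Real.exp (l * Z ω))} := measure_mono hsub
    _ ≤ (∫⁻ ω, ENNReal.ofReal (Real.exp (l * Z ω)) ∂(seedLaw E))
          / ENNReal.ofReal (Real.exp (10 * Real.log T)) :=
        meas_ge_le_lintegral_div hfm.aemeasurable (by simpa using hpos) ENNReal.ofReal_ne_top
    _ ≤ ENNReal.ofReal (Real.exp 3) / ENNReal.ofReal (Real.exp (10 * Real.log T)) := by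
        gcongr
        exact hm.trans (ENNReal.ofReal_le_ofReal (Real.exp_le_exp.2 hexpo))
    _ = ENNReal.ofReal (Real.exp 3 * Real.exp (-(10 * Real.log T))) := by
        rw [← ENNReal.ofReal_div_of_pos hpos, Real.exp_neg, div_eq_mul_inv]

/-! ### Occurrence of the replays -/

theorem measure_bit_false (q : ℕ × ℕ × ℕ) :
    bernoulliMeasure true false (replayProb q.1 q.2.1 q.2.2) {false}
      ≤ ENNReal.ofReal (Real.exp (-(replayProb q.1 q.2.1 q.2.2 : ℝ))) := by
  rw [bernoulliMeasure_apply_of_notMem_of_mem _ (measurableSet_singleton false) (by simp) rfl,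
    ← ENNReal.ofReal_coe_nnreal]
  refine ENNReal.ofReal_le_ofReal ?_
  have h : ((unitInterval.toNNReal (unitInterval.symm (replayProb q.1 q.2.1 q.2.2)) : NNReal) : ℝ)
      = 1 - (replayProb q.1 q.2.1 q.2.2 : ℝ) := rfl
  rw [h]
  linarith [Real.add_one_le_exp (-(replayProb q.1 q.2.1 q.2.2 : ℝ))]

/-- The bits are independent: the probability that none of the replays in `D` takes place is at most
the exponential of minus their expected number. -/
theorem measure_no_bit_le (u : ℕ) (D : Finset (ℕ × ℕ)) :
    seedLaw E {ω | ∀ p ∈ D, ω.2.2 (u, p.1, p.2) = false}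
      ≤ ENNReal.ofReal (Real.exp (-∑ p ∈ D, (replayProb u p.1 p.2 : ℝ))) := by
  classical
  set D' : Finset (ℕ × ℕ × ℕ) := D.image fun p => (u, p.1, p.2) with hD'
  have e : {ω : Seed K | ∀ p ∈ D, ω.2.2 (u, p.1, p.2) = false}
      = Set.univ ×ˢ (Set.univ ×ˢ Set.pi (D' : Set (ℕ × ℕ × ℕ)) fun _ => {false}) := by
    ext ω
    simp only [Set.mem_ofPred_eq, Set.mem_prod, Set.mem_univ, true_and, Set.mem_pi,
      Finset.mem_coe, Set.mem_singleton_iff, hD', Finset.mem_image]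
    constructor
    · rintro h q ⟨p, hp, rfl⟩
      exact h p hp
    · exact fun h p hp => h _ ⟨p, hp, rfl⟩
  rw [e, seedLaw, Measure.prod_prod, Measure.prod_prod, measure_univ, measure_univ, one_mul, one_mul,
    Measure.infinitePi_pi _ fun _ _ => measurableSet_singleton false, hD',
    Finset.prod_image fun p _ p' _ h => by simpa [Prod.ext_iff] using h]
  rw [← Finset.sum_neg_distrib, Real.exp_sum,
    ENNReal.ofReal_prod_of_nonneg fun p _ => (Real.exp_pos _).le]
  exact Finset.prod_le_prod' fun p _ => measure_bit_false (u, p.1, p.2)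

end

section

variable {K : ℕ}

/-! ### The good event -/

theorem Run.Valid.cand_nonempty {C₀ : ℝ} {T : ℕ} {bit : ℕ → ℕ → ℕ → Bool} {R : Run K}
    (hR : R.Valid C₀ T bit) {t : ℕ} (h1 : 1 ≤ t) (h2 : t ≤ T) : (R.cand t).Nonempty := by
  obtain ⟨a, ha⟩ := hR.survivor t h1 h2
  refine ⟨a, ?_⟩
  rw [hR.cand_eq t h1 h2, Finset.mem_sdiff]
  refine ⟨Finset.mem_univ _, fun hev => ?_⟩
  rcases ha t (hR.ep_le h1 h2) le_rfl with h | h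
  · rw [h, evicted_self] at hev
    simp at hev
  · exact h (evicted_mono (hR.ep_le_top t h1 h2) le_rfl hev)

variable [NeZero K] (E : Environment K) (C₀ : ℝ) (T : ℕ)

theorem measure_biUnion_le_card {Ω ι : Type*} [MeasurableSpace Ω] (μ : Measure Ω) (D : Finset ι)
    (A : ι → Set Ω) {ε : ENNReal} (h : ∀ i ∈ D, μ (A i) ≤ ε) :
    μ (⋃ i ∈ D, A i) ≤ D.card * ε := by
  refine (measure_biUnion_finset_le D A).trans ?_
  rw [← nsmul_eq_mul]
  exact Finset.sum_le_card_nsmul _ _ _ h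

/-- The runs on which some estimate is not concentrated or the expected replays do not occur. -/
def badEvent (S : Finset ℕ) (κ : ℝ) : Set (Seed K) :=
  {ω | ¬ ((metaRun C₀ T ω).Concentrated E T ∧
    ReplaysOccur E T S κ fun u t m => ω.2.2 (u, t, m))}

theorem exp_neg_ten_mul_log {T : ℕ} (hT : 2 ≤ T) :
    Real.exp (-(10 * Real.log T)) = 1 / (T : ℝ) ^ 10 := by
  have h : (0 : ℝ) < T := by exact_mod_cast (by omega : 0 < T)
  rw [Real.exp_neg, one_div]
  congr 1
  have := Real.exp_nat_mul (Real.log T) 10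
  rw [Real.exp_log h] at this
  exact_mod_cast this

/-- Union bound over pairs of arms and intervals of rounds for the estimates, and over arms and
intervals of rounds for the replays. -/
theorem measure_badEvent_le {T : ℕ} (hT : 2 ≤ T) (hKT : K ≤ T) (S : Finset ℕ) (κ : ℝ) :
    seedLaw E (badEvent E C₀ T S κ) ≤ ENNReal.ofReal ((Real.exp 3 + 2) / T) := by
  classical
  set D₁ : Finset (Fin K × Fin K × ℕ × ℕ) :=
    (Finset.univ ×ˢ Finset.univ ×ˢ Finset.Icc 1 T ×ˢ Finset.Icc 1 T).filter
      fun p => p.2.2.1 < p.2.2.2 with hD₁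
  set A₁ : Fin K × Fin K × ℕ × ℕ → Set (Seed K) := fun p =>
    {ω | 20 * Real.log T * √(max ((K : ℝ) * ((p.2.2.2 : ℝ) - (p.2.2.1 : ℝ))) ((K : ℝ) ^ 2))
        < ∑ s ∈ Finset.Icc p.2.2.1 p.2.2.2, (((metaRun C₀ T ω).obs s).gapEst p.1 p.2.1
          - (metaRun C₀ T ω).meanEst E s p.1 p.2.1)} with hA₁
  set D₂ : Finset (Fin K × ℕ × ℕ) :=
    (Finset.univ ×ˢ Finset.Icc 1 T ×ˢ Finset.range (T + 1)).filter fun q =>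
      10 * Real.log T < ∑ p ∈ exposing E T S κ q.2.1 q.2.2 q.1, (replayProb q.2.1 p.1 p.2 : ℝ)
    with hD₂
  set A₂ : Fin K × ℕ × ℕ → Set (Seed K) := fun q =>
    {ω | ∀ p ∈ exposing E T S κ q.2.1 q.2.2 q.1, ω.2.2 (q.2.1, p.1, p.2) = false} with hA₂
  have hsub : badEvent E C₀ T S κ ⊆ (⋃ p ∈ D₁, A₁ p) ∪ ⋃ q ∈ D₂, A₂ q := by
    intro ω hω
    by_contra hno
    simp only [Set.mem_union, Set.mem_iUnion, exists_prop, not_or, not_exists, not_and] at hno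
    obtain ⟨h1, h2⟩ := hno
    refine hω ⟨?_, ?_⟩
    · intro a' a s₁ s₂ hs1 hs12 hs2
      have hmem : ∀ b b' : Fin K, (b, b', s₁, s₂) ∈ D₁ := fun b b' => by
        simp only [hD₁, Finset.mem_filter, Finset.mem_product, Finset.mem_univ, Finset.mem_Icc,
          true_and]
        omega
      have g1 := h1 _ (hmem a' a)
      have g2 := h1 _ (hmem a a')
      simp only [hA₁, Set.mem_ofPred_eq, not_lt] at g1 g2
      refine abs_le.2 ⟨?_, g1⟩
      have e : ∑ s ∈ Finset.Icc s₁ s₂, (((metaRun C₀ T ω).obs s).gapEst a a'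
            - (metaRun C₀ T ω).meanEst E s a a')
          = -∑ s ∈ Finset.Icc s₁ s₂, (((metaRun C₀ T ω).obs s).gapEst a' a
            - (metaRun C₀ T ω).meanEst E s a' a) := by
        rw [← Finset.sum_neg_distrib]
        refine Finset.sum_congr rfl fun s _ => ?_
        simp only [Obs.gapEst, Run.meanEst]
        ring
      rw [e] at g2
      linarith
    · intro a u r hu1 hu hr
      by_contra hcon
      rw [not_or, not_le, not_exists] at hcon
      refine h2 (a, u, r) ?_ ?_
      · simp only [hD₂, Finset.mem_filter, Finset.mem_product, Finset.mem_univ, Finset.mem_Icc,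
          Finset.mem_range, true_and]
        exact ⟨⟨⟨hu1, hu⟩, by omega⟩, hcon.1⟩
      · intro p hp
        exact Bool.eq_false_iff.2 fun hb => hcon.2 p ⟨hp, hb⟩
  have hTpos : (0 : ℝ) < T := by exact_mod_cast (by omega : 0 < T)
  have hT1 : (1 : ℝ) ≤ T := by exact_mod_cast (by omega : 1 ≤ T)
  have hK : (K : ℝ) ≤ T := by exact_mod_cast hKT
  have b1 : seedLaw E (⋃ p ∈ D₁, A₁ p)
      ≤ D₁.card * ENNReal.ofReal (Real.exp 3 * Real.exp (-(10 * Real.log T))) := by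
    refine measure_biUnion_le_card _ _ _ fun p hp => ?_
    simp only [hD₁, Finset.mem_filter, Finset.mem_product, Finset.mem_univ, Finset.mem_Icc,
      true_and] at hp
    exact measure_deviation_le E C₀ T hp.1.1.1 hp.2 p.1 p.2.1
  have b2 : seedLaw E (⋃ q ∈ D₂, A₂ q) ≤ D₂.card * ENNReal.ofReal (Real.exp (-(10 * Real.log T))) := by
    refine measure_biUnion_le_card _ _ _ fun q hq => ?_
    refine (measure_no_bit_le E q.2.1 _).trans (ENNReal.ofReal_le_ofReal (Real.exp_le_exp.2 ?_))
    linarith [(Finset.mem_filter.1 hq).2]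
  have c1 : (D₁.card : ℝ) ≤ (T : ℝ) ^ 4 := by
    have h : D₁.card ≤ K * (K * (T * T)) := by
      refine (Finset.card_filter_le _ _).trans (le_of_eq ?_)
      simp only [Finset.card_product, Finset.card_univ, Fintype.card_fin, Nat.card_Icc,
        Nat.add_sub_cancel]
    have h' : (D₁.card : ℝ) ≤ K * (K * (T * T)) := by exact_mod_cast h
    calc (D₁.card : ℝ) ≤ K * (K * (T * T)) := h'
      _ ≤ T * (T * (T * T)) := by gcongr
      _ = (T : ℝ) ^ 4 := by ring
  have c2 : (D₂.card : ℝ) ≤ 2 * (T : ℝ) ^ 3 := by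
    have h : D₂.card ≤ K * (T * (T + 1)) := by
      refine (Finset.card_filter_le _ _).trans (le_of_eq ?_)
      simp only [Finset.card_product, Finset.card_univ, Fintype.card_fin, Nat.card_Icc,
        Nat.add_sub_cancel, Finset.card_range]
    have h' : (D₂.card : ℝ) ≤ K * (T * (T + 1)) := by exact_mod_cast h
    calc (D₂.card : ℝ) ≤ K * (T * (T + 1)) := h'
      _ ≤ T * (T * (T + T)) := by gcongr
      _ = 2 * (T : ℝ) ^ 3 := by ring
  refine (measure_mono hsub).trans ((measure_union_le _ _).trans ((add_le_add b1 b2).trans ?_))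
  rw [← ENNReal.ofReal_natCast, ← ENNReal.ofReal_natCast, ← ENNReal.ofReal_mul (by positivity),
    ← ENNReal.ofReal_mul (by positivity), ← ENNReal.ofReal_add (by positivity) (by positivity),
    exp_neg_ten_mul_log hT]
  refine ENNReal.ofReal_le_ofReal ?_
  have h5 : (1 : ℝ) ≤ (T : ℝ) ^ 5 := one_le_pow₀ hT1
  have h6 : (1 : ℝ) ≤ (T : ℝ) ^ 6 := one_le_pow₀ hT1
  calc (D₁.card : ℝ) * (Real.exp 3 * (1 / (T : ℝ) ^ 10)) + D₂.card * (1 / (T : ℝ) ^ 10)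
      ≤ (T : ℝ) ^ 4 * (Real.exp 3 * (1 / (T : ℝ) ^ 10)) + 2 * (T : ℝ) ^ 3 * (1 / (T : ℝ) ^ 10) := by
        gcongr
    _ = (Real.exp 3 * (1 / (T : ℝ) ^ 5) + 2 * (1 / (T : ℝ) ^ 6)) / T := by
        field_simp
    _ ≤ (Real.exp 3 * 1 + 2 * 1) / T := by
        gcongr
        · exact div_le_one_of_le₀ h5 (by positivity)
        · exact div_le_one_of_le₀ h6 (by positivity)
    _ = (Real.exp 3 + 2) / T := by ring

/-! ### Regret in expectation -/

theorem metaArm_eq {t : ℕ} (ω : Seed K) : metaArm C₀ T t ω = ((metaRun C₀ T ω).obs t).arm := rfl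

theorem fiberMeasurable_metaArm {t : ℕ} (ht : 1 ≤ t) :
    FiberMeasurable fun ω : Seed K => metaArm C₀ T t ω := by
  simp only [metaArm_eq, obs_arm_eq C₀ T _ ht]
  exact (fiberMeasurable_cand C₀ T t).bind (g := fun A ω => ω.2.1 (t, A)) fun A =>
    fiberMeasurable_play t A

theorem measurable_avgGap (t : ℕ) : Measurable fun ω : Seed K => (metaRun C₀ T ω).avgGap E t :=
  ((fiberMeasurable_cand C₀ T t).comp fun A =>
    (1 / (A.card : ℝ)) * ∑ b ∈ A, E.gap t b).measurable

/-- The regret is the expectation of the sum of the mean regrets of the rounds, given the past. -/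
theorem ofReal_metaRegret_eq : ENNReal.ofReal (metaRegret C₀ E T)
    = ∫⁻ ω, ENNReal.ofReal (∑ t ∈ Finset.Icc 1 T, (metaRun C₀ T ω).avgGap E t) ∂(seedLaw E) := by
  have hmean : ∀ t ∈ Finset.Icc 1 T,
      Integrable (fun ω => E.mean t (metaArm C₀ T t ω)) (seedLaw E) := by
    intro t ht
    refine Integrable.of_bound
      ((fiberMeasurable_metaArm C₀ T (Finset.mem_Icc.1 ht).1).comp
        (E.mean t)).measurable.aestronglyMeasurable 1 (Filter.Eventually.of_forall fun ω => ?_)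
    rw [Real.norm_of_nonneg (E.mean_nonneg _ _)]
    exact E.mean_le_one _ _
  have hgap : ∀ t ∈ Finset.Icc 1 T,
      Measurable fun ω => E.gap t (metaArm C₀ T t ω) := fun t ht =>
    ((fiberMeasurable_metaArm C₀ T (Finset.mem_Icc.1 ht).1).comp (E.gap t)).measurable
  have hsum : ∀ ω, ∑ t ∈ Finset.Icc 1 T, E.gap t (metaArm C₀ T t ω)
      = (∑ t ∈ Finset.Icc 1 T, ⨆ a : Fin K, E.mean t a)
        - ∑ t ∈ Finset.Icc 1 T, E.mean t (metaArm C₀ T t ω) := fun ω => by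
    rw [← Finset.sum_sub_distrib]
    exact Finset.sum_congr rfl fun t _ => E.gap_eq t _
  have hint := integrable_finsetSum _ hmean
  have hreg : metaRegret C₀ E T
      = ∫ ω, ∑ t ∈ Finset.Icc 1 T, E.gap t (metaArm C₀ T t ω) ∂(seedLaw E) := by
    simp only [hsum]
    rw [integral_sub (integrable_const _) hint, integral_const]
    simp [metaRegret, Environment.regret]
  have hint' : Integrable (fun ω => ∑ t ∈ Finset.Icc 1 T, E.gap t (metaArm C₀ T t ω))
      (seedLaw E) := by
    simp only [hsum]
    exact (integrable_const _).sub hint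
  rw [hreg, ofReal_integral_eq_lintegral_ofReal hint'
    (Filter.Eventually.of_forall fun ω => Finset.sum_nonneg fun t _ => E.gap_nonneg t _)]
  simp only [ENNReal.ofReal_sum_of_nonneg fun t (_ : t ∈ Finset.Icc 1 T) => E.gap_nonneg t _,
    ENNReal.ofReal_sum_of_nonneg fun t (_ : t ∈ Finset.Icc 1 T) => Run.avgGap_nonneg E _ t]
  rw [lintegral_finsetSum _ fun t ht => (hgap t ht).ennreal_ofReal,
    lintegral_finsetSum _ fun t _ => (measurable_avgGap E C₀ T t).ennreal_ofReal]
  refine Finset.sum_congr rfl fun t ht => ?_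
  obtain ⟨h1, h2⟩ := Finset.mem_Icc.1 ht
  have hr := lintegral_round E C₀ T h1 (Φ := fun _ => 1) measurable_const (fun _ _ _ _ _ => rfl)
    (g := fun _ c _ => ENNReal.ofReal (E.gap t c)) fun _ _ => measurable_const
  simp only [one_mul] at hr
  refine hr.trans (lintegral_congr fun ω => ?_)
  rw [lintegral_const, measure_univ, mul_one,
    lintegral_uniformArm ((metaRun_valid C₀ T ω).cand_nonempty h1 h2) _ fun c => E.gap_nonneg t c]
  rfl

theorem metaRegret_le_horizon : metaRegret C₀ E T ≤ T := by
  have h : ENNReal.ofReal (metaRegret C₀ E T) ≤ ENNReal.ofReal T := by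
    rw [ofReal_metaRegret_eq]
    calc ∫⁻ ω, ENNReal.ofReal (∑ t ∈ Finset.Icc 1 T, (metaRun C₀ T ω).avgGap E t) ∂(seedLaw E)
        ≤ ∫⁻ _ω : Seed K, ENNReal.ofReal T ∂(seedLaw E) := by
          refine lintegral_mono fun ω => ENNReal.ofReal_le_ofReal ?_
          refine (Finset.sum_le_sum fun t _ => Run.avgGap_le_one E _ t).trans (le_of_eq ?_)
          simp
      _ = ENNReal.ofReal T := by rw [lintegral_const, measure_univ, mul_one]
  exact (ENNReal.ofReal_le_ofReal_iff (Nat.cast_nonneg T)).1 h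

theorem card_replayDurations_le {T : ℕ} (hT : 2 ≤ T) :
    ((replayDurations T).card : ℝ) ≤ 4 * Real.log T := by
  have hc : (replayDurations T).card ≤ Nat.clog 2 T := by
    refine Finset.card_image_le.trans (le_of_eq ?_)
    rw [Nat.card_Icc, Nat.add_sub_cancel]
  have hT0 : (0 : ℝ) < T := by exact_mod_cast (by omega : 0 < T)
  have hpow : 2 ^ (Nat.clog 2 T - 1) < T := Nat.pow_pred_clog_lt_self (by norm_num) (by omega)
  have hpos : 0 < Nat.clog 2 T := Nat.clog_pos (by norm_num) hT
  have hlog : ((Nat.clog 2 T - 1 : ℕ) : ℝ) * Real.log 2 ≤ Real.log T := by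
    rw [← Real.log_pow]
    exact Real.log_le_log (by positivity) (by exact_mod_cast hpow.le)
  have h2 : Real.log 2 ≤ Real.log T := Real.log_le_log (by norm_num) (by exact_mod_cast hT)
  have hc' : ((replayDurations T).card : ℝ) ≤ Nat.clog 2 T := by exact_mod_cast hc
  rw [Nat.cast_sub hpos] at hlog
  have := Real.log_two_gt_d9
  push_cast at hlog
  nlinarith

theorem sqrt_mul_replayProb_le {u t m : ℕ} (hm : 1 ≤ m) :
    √((m : ℝ) + 1) * (replayProb u t m : ℝ) ≤ 2 * (1 / √((t - u : ℕ) : ℝ)) := by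
  have hm' : (1 : ℝ) ≤ m := by exact_mod_cast hm
  have e : (replayProb u t m : ℝ) = 1 / (√(m : ℝ) * √((t - u : ℕ) : ℝ)) := by
    rw [← Real.sqrt_mul (by positivity)]
    rfl
  have hs : 0 < √(m : ℝ) := Real.sqrt_pos.2 (by linarith)
  have h : √((m : ℝ) + 1) ≤ 2 * √(m : ℝ) := by
    refine Real.sqrt_le_iff.2 ⟨by positivity, ?_⟩
    rw [mul_pow, Real.sq_sqrt (by linarith)]
    linarith
  calc √((m : ℝ) + 1) * (replayProb u t m : ℝ)
      ≤ 2 * √(m : ℝ) * (1 / (√(m : ℝ) * √((t - u : ℕ) : ℝ))) := by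
        rw [e]
        gcongr
    _ = 2 * (1 / √((t - u : ℕ) : ℝ)) := by
        rw [← div_div, one_div (√(m : ℝ))]
        field_simp

theorem measurable_bit (t m : ℕ) : MeasurableSet
    {ω : Seed K | ω.2.2 ((metaRun C₀ T ω).ep t, t + 1, m) = true} := by
  have h : FiberMeasurable fun ω : Seed K => ω.2.2 ((metaRun C₀ T ω).ep t, t + 1, m) :=
    (fiberMeasurable_ep C₀ T t).bind (g := fun u ω => ω.2.2 (u, t + 1, m)) fun u =>
      FiberMeasurable.of_measurable (by fun_prop)
  exact h {true}

/-- A replay of duration `m` costs `√(m + 1)` and has probability `1 / √(m * n)` in the `n`-th round of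
an episode, so that each of the `O(log T)` durations costs `O(1 / √n)` in expectation. -/
theorem lintegral_replayCost_le {T : ℕ} (hT : 2 ≤ T) :
    ∫⁻ ω, ENNReal.ofReal ((metaRun C₀ T ω).replayCost T fun u t m => ω.2.2 (u, t, m)) ∂(seedLaw E)
      ≤ ∫⁻ ω, ENNReal.ofReal (8 * Real.log T *
        ∑ t ∈ Finset.Icc 1 (T - 1), 1 / √((t + 1 - (metaRun C₀ T ω).ep t : ℕ) : ℝ)) ∂(seedLaw E) := by
  have hcost : ∀ ω : Seed K,
      ENNReal.ofReal ((metaRun C₀ T ω).replayCost T fun u t m => ω.2.2 (u, t, m))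
      = ∑ t ∈ Finset.Icc 1 (T - 1), ∑ m ∈ replayDurations T, ENNReal.ofReal (√((m : ℝ) + 1)) *
        (if ω.2.2 ((metaRun C₀ T ω).ep t, t + 1, m) = true then 1 else 0) := by
    intro ω
    have h0 : ∀ t m, 0 ≤ (if ω.2.2 ((metaRun C₀ T ω).ep t, t + 1, m) = true
        then √((m : ℝ) + 1) else 0) := fun t m => by split_ifs <;> positivity
    unfold Run.replayCost
    rw [ENNReal.ofReal_sum_of_nonneg fun t _ => Finset.sum_nonneg fun m _ => h0 t m]
    refine Finset.sum_congr rfl fun t _ => ?_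
    rw [ENNReal.ofReal_sum_of_nonneg fun m _ => h0 t m]
    refine Finset.sum_congr rfl fun m _ => ?_
    split_ifs <;> simp
  have hmi : ∀ t m, Measurable fun ω : Seed K =>
      (if ω.2.2 ((metaRun C₀ T ω).ep t, t + 1, m) = true then (1 : ENNReal) else 0) := fun t m =>
    Measurable.ite (measurable_bit C₀ T t m) measurable_const measurable_const
  have hmp : ∀ t m, Measurable fun ω : Seed K =>
      ENNReal.ofReal (replayProb ((metaRun C₀ T ω).ep t) (t + 1) m) := fun t m =>
    ((fiberMeasurable_ep C₀ T t).comp fun u => ENNReal.ofReal (replayProb u (t + 1) m)).measurable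
  rw [lintegral_congr hcost, lintegral_finsetSum _ fun t _ =>
    Finset.measurable_sum _ fun m _ => (hmi t m).const_mul _]
  have hswap : ∑ t ∈ Finset.Icc 1 (T - 1), ∫⁻ ω, ∑ m ∈ replayDurations T,
        ENNReal.ofReal (√((m : ℝ) + 1)) *
          (if ω.2.2 ((metaRun C₀ T ω).ep t, t + 1, m) = true then 1 else 0) ∂(seedLaw E)
      = ∫⁻ ω, ∑ t ∈ Finset.Icc 1 (T - 1), ∑ m ∈ replayDurations T,
          ENNReal.ofReal (√((m : ℝ) + 1)) *
            ENNReal.ofReal (replayProb ((metaRun C₀ T ω).ep t) (t + 1) m) ∂(seedLaw E) := by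
    rw [lintegral_finsetSum _ fun t _ => Finset.measurable_sum _ fun m _ => (hmp t m).const_mul _]
    refine Finset.sum_congr rfl fun t ht => ?_
    rw [lintegral_finsetSum _ fun m _ => (hmi t m).const_mul _,
      lintegral_finsetSum _ fun m _ => (hmp t m).const_mul _]
    refine Finset.sum_congr rfl fun m _ => ?_
    rw [lintegral_const_mul _ (hmi t m), lintegral_const_mul _ (hmp t m),
      lintegral_bit E C₀ T (Finset.mem_Icc.1 ht).1 m]
  rw [hswap]
  refine lintegral_mono fun ω => ?_
  have hprod : ∀ t m : ℕ, ENNReal.ofReal (√((m : ℝ) + 1)) *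
        ENNReal.ofReal (replayProb ((metaRun C₀ T ω).ep t) (t + 1) m)
      = ENNReal.ofReal (√((m : ℝ) + 1) * (replayProb ((metaRun C₀ T ω).ep t) (t + 1) m : ℝ)) :=
    fun t m => (ENNReal.ofReal_mul (Real.sqrt_nonneg _)).symm
  have hp0 : ∀ t m : ℕ, 0 ≤ √((m : ℝ) + 1) * (replayProb ((metaRun C₀ T ω).ep t) (t + 1) m : ℝ) :=
    fun t m => mul_nonneg (Real.sqrt_nonneg _) (replayProb _ _ _).2.1
  simp only [hprod]
  simp only [← ENNReal.ofReal_sum_of_nonneg fun m (_ : m ∈ replayDurations T) => hp0 _ m]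
  rw [← ENNReal.ofReal_sum_of_nonneg fun t _ => Finset.sum_nonneg fun m _ => hp0 t m]
  refine ENNReal.ofReal_le_ofReal ?_
  rw [Finset.mul_sum]
  refine Finset.sum_le_sum fun t _ => ?_
  calc ∑ m ∈ replayDurations T,
        √((m : ℝ) + 1) * (replayProb ((metaRun C₀ T ω).ep t) (t + 1) m : ℝ)
      ≤ (replayDurations T).card • (2 * (1 / √((t + 1 - (metaRun C₀ T ω).ep t : ℕ) : ℝ))) := by
        refine Finset.sum_le_card_nsmul _ _ _ fun m hm => sqrt_mul_replayProb_le ?_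
        obtain ⟨n, _, rfl⟩ := Finset.mem_image.1 hm
        exact Nat.one_le_two_pow
    _ ≤ 4 * Real.log T * (2 * (1 / √((t + 1 - (metaRun C₀ T ω).ep t : ℕ) : ℝ))) := by
        rw [nsmul_eq_mul]
        gcongr
        exact card_replayDurations_le hT
    _ = 8 * Real.log T * (1 / √((t + 1 - (metaRun C₀ T ω).ep t : ℕ) : ℝ)) := by ring

end

section

variable {K : ℕ}

/-! ### Regret in terms of a hitting set -/

/-- Regret in expectation, for every balance `l` between the number of rounds and the size of a hitting
set. The bad event has probability `O(1 / T)` and costs at most `T`. -/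
theorem ofReal_metaRegret_le [NeZero K] (E : Environment K) {C₀ : ℝ} {T : ℕ} (hT : 2 ≤ T) (hKT : K ≤ T)
    (hC : 22 ≤ √C₀) {S : Finset ℕ} (hS : Hitting E T S) {l : ℝ} (hl : 0 < l) :
    ENNReal.ofReal (metaRegret C₀ E T)
      ≤ ENNReal.ofReal (1100 * (√C₀ + 23) * Real.log T ^ 2 * √K *
          (l * T + 2 * ((S.card : ℝ) + 1) / l + (8 * Real.log T *
            (l * T + ((S.card : ℝ) + 1) / l + (Real.exp 3 + 2)))) + (Real.exp 3 + 2)) := by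
  set μ := seedLaw E with hμ
  set c : ℝ := Real.exp 3 + 2 with hc
  have hc0 : 0 < c := by positivity
  have hL : 0 < Real.log T := lt_of_lt_of_le (by norm_num) (half_le_log hT)
  have hT0 : (0 : ℝ) < T := by exact_mod_cast (by omega : 0 < T)
  set M : ℝ := 1100 * (√C₀ + 23) * Real.log T ^ 2 * √(K : ℝ) with hM
  have hM0 : 0 ≤ M := by positivity
  -- a measurable hull, as the bad event is not known to be measurable
  set N : Set (Seed K) := toMeasurable μ (badEvent E C₀ T S (√C₀ + 23)) with hN
  have hNm : MeasurableSet N := measurableSet_toMeasurable _ _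
  have hNle : μ N ≤ ENNReal.ofReal (c / T) := by
    rw [hN, measure_toMeasurable]
    exact measure_badEvent_le E C₀ hT hKT S _
  have hind : ∀ x : ℝ, 0 ≤ x → ∫⁻ ω, N.indicator (fun _ => ENNReal.ofReal (x * T)) ω ∂μ
      ≤ ENNReal.ofReal (x * c) := by
    intro x hx
    rw [lintegral_indicator_const hNm]
    calc ENNReal.ofReal (x * T) * μ N ≤ ENNReal.ofReal (x * T) * ENNReal.ofReal (c / T) := by gcongr
      _ = ENNReal.ofReal (x * c) := by
        rw [← ENNReal.ofReal_mul (by positivity)]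
        congr 1
        field_simp
  have hgood : ∀ ω, ω ∉ N → (metaRun C₀ T ω).Concentrated E T ∧
      ReplaysOccur E T S (√C₀ + 23) fun u t m => ω.2.2 (u, t, m) := by
    intro ω hω
    by_contra h
    exact hω (subset_toMeasurable _ _ h)
  set W : Seed K → ℝ := fun ω =>
    ∑ t ∈ Finset.Icc 1 (T - 1), 1 / √((t + 1 - (metaRun C₀ T ω).ep t : ℕ) : ℝ) with hW
  set q₁ : ℝ := l * T + 2 * ((S.card : ℝ) + 1) / l with hq₁
  set q₂ : ℝ := l * T + ((S.card : ℝ) + 1) / l with hq₂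
  have hq₁0 : 0 ≤ q₁ := by positivity
  have hq₂0 : 0 ≤ q₂ := by positivity
  have hWle : ∀ ω, ENNReal.ofReal (8 * Real.log T * W ω)
      ≤ ENNReal.ofReal (8 * Real.log T * q₂)
        + N.indicator (fun _ => ENNReal.ofReal (8 * Real.log T * T)) ω := by
    intro ω
    by_cases hω : ω ∈ N
    · rw [Set.indicator_of_mem hω]
      refine le_trans (ENNReal.ofReal_le_ofReal ?_) le_add_self
      gcongr
      calc W ω ≤ ∑ _t ∈ Finset.Icc 1 (T - 1), (1 : ℝ) := by
            refine Finset.sum_le_sum fun t _ => ?_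
            rcases Nat.eq_zero_or_pos (t + 1 - (metaRun C₀ T ω).ep t) with h | h
            · rw [h]
              simp
            · refine div_le_one_of_le₀ (Real.one_le_sqrt.2 ?_) (Real.sqrt_nonneg _)
              exact_mod_cast h
        _ ≤ T := by
            rw [Finset.sum_const, Nat.card_Icc, nsmul_eq_mul, mul_one]
            exact_mod_cast (by omega : T - 1 + 1 - 1 ≤ T)
    · rw [Set.indicator_of_notMem hω, add_zero]
      refine ENNReal.ofReal_le_ofReal ?_
      gcongr
      exact (metaRun_valid C₀ T ω).sum_one_div_sqrt_ep_le hT hC (hgood ω hω).1 hS hl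
  have hcost : ∫⁻ ω, ENNReal.ofReal ((metaRun C₀ T ω).replayCost T fun u t m => ω.2.2 (u, t, m)) ∂μ
      ≤ ENNReal.ofReal (8 * Real.log T * (q₂ + c)) := by
    calc ∫⁻ ω, ENNReal.ofReal ((metaRun C₀ T ω).replayCost T fun u t m => ω.2.2 (u, t, m)) ∂μ
        ≤ ∫⁻ ω, ENNReal.ofReal (8 * Real.log T * W ω) ∂μ := lintegral_replayCost_le E C₀ hT
      _ ≤ ∫⁻ ω, (ENNReal.ofReal (8 * Real.log T * q₂)
            + N.indicator (fun _ => ENNReal.ofReal (8 * Real.log T * T)) ω) ∂μ := lintegral_mono hWle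
      _ ≤ ENNReal.ofReal (8 * Real.log T * q₂) + ENNReal.ofReal (8 * Real.log T * c) := by
          rw [lintegral_add_left measurable_const, lintegral_const, measure_univ, mul_one]
          gcongr
          exact hind _ (by positivity)
      _ = ENNReal.ofReal (8 * Real.log T * (q₂ + c)) := by
          rw [← ENNReal.ofReal_add (by positivity) (by positivity)]
          congr 1
          ring
  have hX : ∀ ω, ENNReal.ofReal (∑ t ∈ Finset.Icc 1 T, (metaRun C₀ T ω).avgGap E t)
      ≤ ENNReal.ofReal (M * q₁) + ENNReal.ofReal M *
          ENNReal.ofReal ((metaRun C₀ T ω).replayCost T fun u t m => ω.2.2 (u, t, m))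
        + N.indicator (fun _ => ENNReal.ofReal (1 * T)) ω := by
    intro ω
    by_cases hω : ω ∈ N
    · rw [Set.indicator_of_mem hω]
      refine le_trans (ENNReal.ofReal_le_ofReal ?_) le_add_self
      refine (Finset.sum_le_sum fun t _ => Run.avgGap_le_one E _ t).trans (le_of_eq ?_)
      simp
    · rw [Set.indicator_of_notMem hω, add_zero, ← ENNReal.ofReal_mul hM0]
      refine le_trans (ENNReal.ofReal_le_ofReal ?_) ENNReal.ofReal_add_le
      rw [← mul_add]
      exact (metaRun_valid C₀ T ω).sum_avgGap_le hT hKT hC (hgood ω hω).1 hS (hgood ω hω).2 hl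
  rw [ofReal_metaRegret_eq]
  refine (lintegral_mono hX).trans ?_
  rw [lintegral_add_right _ (measurable_const.indicator hNm), lintegral_add_left measurable_const,
    lintegral_const, measure_univ, mul_one, lintegral_const_mul' _ _ ENNReal.ofReal_ne_top]
  calc ENNReal.ofReal (M * q₁) + ENNReal.ofReal M *
          ∫⁻ ω, ENNReal.ofReal ((metaRun C₀ T ω).replayCost T fun u t m => ω.2.2 (u, t, m)) ∂μ
        + ∫⁻ ω, N.indicator (fun _ => ENNReal.ofReal (1 * T)) ω ∂μ
      ≤ ENNReal.ofReal (M * q₁) + ENNReal.ofReal M * ENNReal.ofReal (8 * Real.log T * (q₂ + c))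
        + ENNReal.ofReal (1 * c) := by
        gcongr
        exact hind 1 zero_le_one
    _ = ENNReal.ofReal (M * (q₁ + 8 * Real.log T * (q₂ + c)) + c) := by
        rw [← ENNReal.ofReal_mul hM0, ← ENNReal.ofReal_add (by positivity) (by positivity),
          ← ENNReal.ofReal_add (by positivity) (by positivity)]
        congr 1
        ring

/-- The constant of the regret bound. -/
noncomputable def regretConst (C₀ : ℝ) : ℝ :=
  1100 * (√C₀ + 23) * (22 + 8 * (Real.exp 3 + 2)) + 8 * (Real.exp 3 + 2)

theorem regretConst_ge (C₀ : ℝ) : 8 ≤ regretConst C₀ := by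
  have h1 := Real.exp_pos 3
  have h2 : 0 ≤ 1100 * (√C₀ + 23) * (22 + 8 * (Real.exp 3 + 2)) := by positivity
  unfold regretConst
  linarith

/-- The regret bound for any set that hits all intervals without a safe arm; for `K > T` it is weaker
than the trivial bound `T`. -/
theorem metaRegret_le [NeZero K] (E : Environment K) {C₀ : ℝ} {T : ℕ} (hT : 2 ≤ T) (hC : 22 ≤ √C₀)
    {S : Finset ℕ} (hS : Hitting E T S) {n : ℕ} (hn : S.card ≤ n) :
    metaRegret C₀ E T ≤ regretConst C₀ * Real.log T ^ 3 * √(((n : ℝ) + 1) * K * T) := by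
  have hL := half_le_log hT
  set L := Real.log T with hLdef
  have hL0 : 0 < L := by linarith
  have hL3 : 1 ≤ 8 * L ^ 3 := by
    have h := pow_le_pow_left₀ (by norm_num) hL 3
    norm_num at h
    linarith
  have hK1 : (1 : ℝ) ≤ K := by exact_mod_cast NeZero.one_le
  have hT1 : (1 : ℝ) ≤ T := by exact_mod_cast (by omega : 1 ≤ T)
  suffices h : metaRegret C₀ E T
      ≤ regretConst C₀ * L ^ 3 * √(((S.card : ℝ) + 1) * K * T) by
    refine h.trans ?_
    have := regretConst_ge C₀
    have hn' : (S.card : ℝ) ≤ n := by exact_mod_cast hn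
    gcongr
  set m : ℝ := (S.card : ℝ) + 1 with hm
  have hm1 : 1 ≤ m := by
    rw [hm]
    linarith [Nat.cast_nonneg (α := ℝ) S.card]
  rcases Nat.lt_or_ge T K with hTK | hKT
  · have hTK' : (T : ℝ) ≤ K := by exact_mod_cast hTK.le
    have h1 : (T : ℝ) ≤ √(m * K * T) := by
      refine Real.le_sqrt_of_sq_le ?_
      have : 1 * (T : ℝ) * T ≤ m * K * T := by gcongr
      nlinarith
    calc metaRegret C₀ E T ≤ T := metaRegret_le_horizon E C₀ T
      _ ≤ 1 * √(m * K * T) := by rwa [one_mul]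
      _ ≤ (8 * L ^ 3) * √(m * K * T) := by gcongr
      _ ≤ regretConst C₀ * L ^ 3 * √(m * K * T) := by
          gcongr
          exact regretConst_ge C₀
  · set Q : ℝ := √(m * T) with hQ
    set k : ℝ := √(K : ℝ) with hk
    set c : ℝ := Real.exp 3 + 2 with hc
    have hc0 : 0 < c := by positivity
    have hk1 : 1 ≤ k := Real.one_le_sqrt.2 hK1
    have hQ1 : 1 ≤ Q := Real.one_le_sqrt.2 (by nlinarith)
    have hmT : 0 < m / T := by positivity
    -- the choice of `l` that balances `l * T` and `m / l`
    set l : ℝ := √(m / T) with hl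
    have hl0 : 0 < l := Real.sqrt_pos.2 hmT
    have hlT : l * T = Q := by
      rw [hl, hQ, Real.sqrt_div (by linarith), Real.sqrt_mul (by linarith)]
      have h1 : √(T : ℝ) * √(T : ℝ) = T := Real.mul_self_sqrt (by linarith)
      have h2 : 0 < √(T : ℝ) := Real.sqrt_pos.2 (by linarith)
      field_simp
      linarith
    have hml : m / l = Q := by
      rw [div_eq_iff hl0.ne', hl, hQ, ← Real.sqrt_mul (by positivity)]
      have : m * T * (m / T) = m ^ 2 := by field_simp
      rw [this, Real.sqrt_sq (by linarith)]
    have hroot : √(m * K * T) = Q * k := by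
      rw [hQ, hk, ← Real.sqrt_mul (by positivity)]
      congr 1
      ring
    have hmain := ofReal_metaRegret_le E hT hKT hC hS hl0
    rw [← hm, ← hLdef, ← hk, ← hc, mul_div_assoc, hlT, hml] at hmain
    have hA : 0 ≤ √C₀ + 23 := by positivity
    have hle := (ENNReal.ofReal_le_ofReal_iff (by positivity)).1 hmain
    refine hle.trans ?_
    rw [hroot, regretConst, ← hc]
    have hB : 0 ≤ 1100 * (√C₀ + 23) * L ^ 2 * k := by positivity
    have h1 : Q + 2 * Q + 8 * L * (Q + Q + c) ≤ (22 + 8 * c) * L * Q := by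
      have e1 : Q ≤ 2 * L * Q := by nlinarith
      have e2 : L * c ≤ L * c * Q := le_mul_of_one_le_right (by positivity) hQ1
      linarith
    have h2 : c ≤ 8 * c * L ^ 3 * (Q * k) := by
      have e1 : 1 ≤ Q * k := one_le_mul_of_one_le_of_one_le hQ1 hk1
      have e2 : 1 ≤ 8 * L ^ 3 * (Q * k) := one_le_mul_of_one_le_of_one_le hL3 e1
      have := mul_le_mul_of_nonneg_left e2 hc0.le
      linarith
    have h3 := mul_le_mul_of_nonneg_left h1 hB
    calc _ ≤ 1100 * (√C₀ + 23) * L ^ 2 * k * ((22 + 8 * c) * L * Q) + 8 * c * L ^ 3 * (Q * k) :=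
          add_le_add h3 h2
      _ = _ := by ring

/-! ### Significant shifts and switches of the best arm -/

namespace Environment

theorem lt_of_noSafeArm [NeZero K] {E : Environment K} {x y : ℕ} (h : E.NoSafeArm x y) : x < y := by
  obtain ⟨s₁, s₂, h1, h2, h3, _⟩ := h 0
  omega

theorem shiftTime_succ_mem (E : Environment K) (T i : ℕ) : E.shiftTime T (i + 1) ∈
    {τ | E.shiftTime T i < τ ∧ τ ≤ T ∧ E.NoSafeArm (E.shiftTime T i) τ} ∪ {T + 1} :=
  Nat.sInf_mem (s := {τ | E.shiftTime T i < τ ∧ τ ≤ T ∧ E.NoSafeArm (E.shiftTime T i) τ} ∪ {T + 1})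
    ⟨T + 1, Or.inr rfl⟩

theorem shiftTime_succ_le (E : Environment K) {T i y : ℕ} (h1 : E.shiftTime T i < y) (h2 : y ≤ T)
    (h3 : E.NoSafeArm (E.shiftTime T i) y) : E.shiftTime T (i + 1) ≤ y :=
  Nat.sInf_le (Or.inl ⟨h1, h2, h3⟩)

theorem shiftTime_numSigShifts_succ (E : Environment K) (T : ℕ) :
    E.shiftTime T (E.numSigShifts T + 1) = T + 1 := by
  refine Nat.sInf_mem (s := {L | E.shiftTime T (L + 1) = T + 1}) ?_
  by_contra hne
  have hnot : ∀ i, E.shiftTime T (i + 1) ≠ T + 1 := fun i hi => hne ⟨i, hi⟩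
  have hstep : ∀ i, E.shiftTime T i < E.shiftTime T (i + 1) ∧ E.shiftTime T (i + 1) ≤ T := by
    intro i
    rcases E.shiftTime_succ_mem T i with h | h
    · exact ⟨h.1, h.2.1⟩
    · exact absurd h (hnot i)
  have hge : ∀ i, i ≤ E.shiftTime T i := by
    intro i
    induction i with
    | zero => exact Nat.zero_le _
    | succ i ih => exact Nat.succ_le_of_lt (ih.trans_lt (hstep i).1)
  have := hge (T + 1)
  have := (hstep T).2
  omega

/-- An interval without a safe arm contains the first significant shift after its left end. -/
theorem hitting_shiftTime [NeZero K] (E : Environment K) (T : ℕ) :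
    Hitting E T ((Finset.Icc 1 (E.numSigShifts T)).image (E.shiftTime T)) := by
  classical
  intro x y hx hy h
  have hxy := lt_of_noSafeArm h
  have hex : ∃ i, x < E.shiftTime T (i + 1) :=
    ⟨E.numSigShifts T, by rw [E.shiftTime_numSigShifts_succ]; omega⟩
  set i := Nat.find hex with hi
  have hxi : x < E.shiftTime T (i + 1) := Nat.find_spec hex
  have hix : E.shiftTime T i ≤ x := by
    rcases Nat.eq_zero_or_pos i with h0 | h0
    · rw [h0]
      exact hx
    · have := Nat.find_min hex (m := i - 1) (by omega)
      rw [Nat.sub_add_cancel h0] at this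
      exact not_lt.1 this
  have hiy := E.shiftTime_succ_le (hix.trans_lt hxy) hy (h.mono hix le_rfl)
  have hiL : i ≤ E.numSigShifts T := Nat.find_min' hex (by
    rw [E.shiftTime_numSigShifts_succ]
    omega)
  have hne : i ≠ E.numSigShifts T := by
    intro he
    have := E.shiftTime_numSigShifts_succ T
    rw [← he] at this
    omega
  exact ⟨_, Finset.mem_image.2 ⟨i + 1, Finset.mem_Icc.2 ⟨by omega, by omega⟩, rfl⟩, hxi, hiy⟩

/-- Between two switches the best arm is safe. -/
theorem hitting_switches [NeZero K] (E : Environment K) {T : ℕ} {best : ℕ → Fin K}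
    (hb : E.IsBestArmSeq T best) :
    Hitting E T ((Finset.Icc 2 T).filter fun t => best t ≠ best (t - 1)) := by
  intro x y hx hy h
  by_contra hno
  push Not at hno
  have hconst : ∀ s, x ≤ s → s ≤ y → best s = best x := by
    intro s hs
    induction s, hs using Nat.le_induction with
    | base => exact fun _ => rfl
    | succ s hs ih =>
      intro hsy
      by_contra hsw
      refine absurd hsy (not_le.2 (hno (s + 1) ?_ (by omega)))
      rw [Finset.mem_filter, Finset.mem_Icc, Nat.add_sub_cancel, ih (by omega)]
      exact ⟨by omega, hsw⟩
  obtain ⟨s₁, s₂, h1, h2, h3, hsig⟩ := h (best x)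
  have hzero : ∑ t ∈ Finset.Icc s₁ s₂, E.gap t (best x) ≤ 0 := by
    refine Finset.sum_nonpos fun t ht => ?_
    obtain ⟨ht1, ht2⟩ := Finset.mem_Icc.1 ht
    refine ciSup_le fun a' => ?_
    rw [← hconst t (by omega) (by omega)]
    exact sub_nonpos.2 (hb t (Finset.mem_Icc.2 ⟨by omega, by omega⟩) a')
  have hpos : 0 < √((K : ℝ) * ((s₂ : ℝ) - (s₁ : ℝ))) := by
    have hK : (0 : ℝ) < K := by exact_mod_cast NeZero.pos K
    have : (s₁ : ℝ) < s₂ := by exact_mod_cast h2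
    exact Real.sqrt_pos.2 (mul_pos hK (sub_pos.2 this))
  unfold Environment.SigRegret at hsig
  linarith

end Environment

end

end SigShift

theorem corollary1 :
    ∃ c₀ : ℝ, 0 < c₀ ∧ ∀ C₀ : ℝ, c₀ ≤ C₀ → ∃ C : ℝ, 0 < C ∧
      ∀ (K : ℕ) [NeZero K] (T : ℕ), 2 ≤ T → ∀ E : Environment K,
        metaRegret C₀ E T
            ≤ C * Real.log T ^ 3 * √(((E.numSigShifts T : ℝ) + 1) * K * T) ∧
        ∀ best : ℕ → Fin K, E.IsBestArmSeq T best →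
          metaRegret C₀ E T
            ≤ C * Real.log T ^ 3 * √(((numSwitches T best : ℝ) + 1) * K * T) := by
  refine ⟨484, by norm_num, fun C₀ hC₀ => ?_⟩
  have hC : 22 ≤ √C₀ := Real.le_sqrt_of_sq_le (by linarith)
  refine ⟨regretConst C₀, by linarith [regretConst_ge C₀], fun K _ T hT E => ⟨?_, ?_⟩⟩
  · refine metaRegret_le E hT hC (E.hitting_shiftTime T) (Finset.card_image_le.trans ?_)
    rw [Nat.card_Icc, Nat.add_sub_cancel]
  · exact fun best hb => metaRegret_le E hT hC (E.hitting_switches hb) le_rfl
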